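/- **Setting.** All systems are finite-dimensional complex Hilbert spaces and $\log$ is to base $2$. A density matrix is a positive semi-definite operator of unit trace. For positive semi-definite $\rho,\sigma$ write $\sigma\gg\rho$ if $\ker\sigma\subseteq\ker\rho$, and $\rho\perp\sigma$ if their supports are orthogonal, i.e. $\rho\sigma=0$. For a density matrix $\rho$, a positive semi-definite $\sigma$ and $\alpha\in(0,1)\cup(1,\infty)$, the sandwiched Rényi divergence is $$D_\alpha(\rho\|\sigma)=\begin{cases}\frac{1}{\alpha-1}\log\operatorname{tr}\left[\left(\sigma^{\frac{1-\alpha}{2\alpha}}\rho\,\sigma^{\frac{1-\alpha}{2\alpha}}\right)^{\alpha}\right] & \text{if } \rho\not\perp\sigma \text{ and } (\sigma\gg\rho \text{ or } \alpha<1),\\ \infty & \text{otherwise,}\end{cases}$$ with negative powers taken on the support. For $\alpha=1$, $D_1(\rho\|\sigma)=\operatorname{tr}[\rho(\log\rho-\log\sigma)]$ if $\sigma\gg\rho$ and $D_1(\rho\|\sigma)=\infty$ otherwise. For a density matrix $\rho_{AB}$ and a positive semi-definite $\tau_B$ put $$H_\alpha(\rho_{AB}\|\tau_B)=-D_\alpha(\rho_{AB}\|\mathrm{id}_A\otimes\tau_B),\qquad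 H^\uparrow_\alpha(A|B)_\rho=-\inf_{\sigma_B}D_\alpha(\rho_{AB}\|\mathrm{id}_A\otimes\sigma_B),$$ where the infimum is over density matrices $\sigma_B$. **Theorem.** Let $\alpha,\beta,\gamma\in\mathbb{R}$ satisfy $\alpha\beta\gamma-2\beta\gamma-\alpha+\beta+\gamma=0$ (equivalently $\frac{\alpha}{\alpha-1}=\frac{\beta}{\beta-1}+\frac{\gamma}{\gamma-1}$ when none of them equals $1$), with $\alpha,\gamma\ge\frac12$ and $\beta>\frac12$. Let $\rho_{ABC}$ be a density matrix with marginal $\rho_{BC}=\operatorname{tr}_A\rho_{ABC}$ and let $\tau_C$ be positive semi-definite. Assume that either both $\alpha<1$ and $\gamma<1$, or $\mathrm{id}_{AB}\otimes\tau_C\gg\rho_{ABC}$. If $\frac1\beta+\frac1\gamma\le 2$, and moreover $\alpha\le 1$ in case $\beta=\gamma=1$, then $$H_\alpha(\rho_{ABC}\|\tau_C)\ \ge\ H^\uparrow_\beta(A|BC)_\rho+H_\gamma(\rho_{BC}\|\tau_C).$$ If $\frac1\beta+\frac1\gamma\ge 2$, and moreover $\alpha\ge 1$ in case $\beta=\gamma=1$,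 then $$H_\alpha(\rho_{ABC}\|\tau_C)\ \le\ H^\uparrow_\beta(A|BC)_\rho+H_\gamma(\rho_{BC}\|\tau_C).$$ -/

import Mathlib

open scoped Kronecker ComplexOrder

noncomputable section

/-! Finite-dimensional quantum systems are modelled by nonempty finite index types, operators on the
system `X` by matrices in `Matrix X X ℂ`, and the composite system `XY` by the index type `X × Y`.
Logarithms are to base 2, and divergences and entropies take values in the extended reals. -/

namespace QRenyi

/-- Density matrices: positive semi-definite with unit trace. -/
def IsDensity {X : Type*} [Fintype X] (ρ : Matrix X X ℂ) : Prop :=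
  ρ.PosSemidef ∧ ρ.trace = 1

/-- `σ ≫ ρ`: the kernel of `σ` is contained in the kernel of `ρ`. -/
def Dominates {X : Type*} [Fintype X] (σ ρ : Matrix X X ℂ) : Prop :=
  ∀ v : X → ℂ, σ.mulVec v = 0 → ρ.mulVec v = 0

/-- The partial trace over the first factor of a composite system `XY`. -/
def traceFst {X Y : Type*} [Fintype X] (ρ : Matrix (X × Y) (X × Y) ℂ) : Matrix Y Y ℂ :=
  fun i j => ∑ x, ρ (x, i) (x, j)

/-- The real power `H ^ s` of a positive semi-definite matrix by spectral calculus. As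
`(0 : ℝ) ^ s = 0` for `s ≠ 0`, negative powers are taken on the support of `H`. -/
def mpow {X : Type*} [Fintype X] [DecidableEq X] (H : Matrix X X ℂ) (s : ℝ) : Matrix X X ℂ :=
  cfc (fun x : ℝ => x ^ s) H

/-- The base 2 logarithm of a positive semi-definite matrix by spectral calculus, taken on the
support: the kernel contributes `0`. -/
def mlog {X : Type*} [Fintype X] [DecidableEq X] (H : Matrix X X ℂ) : Matrix X X ℂ :=
  cfc (fun x : ℝ => Real.logb 2 x) H

open Classical in
/-- The quantum relative entropy `D(ρ‖σ) = tr [ρ (log ρ - log σ)]`, with value `∞` unless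
`σ ≫ ρ`. -/
def relEntropy {X : Type*} [Fintype X] [DecidableEq X] (ρ σ : Matrix X X ℂ) : EReal :=
  if Dominates σ ρ then (((ρ * (mlog ρ - mlog σ)).trace.re : ℝ) : EReal) else ⊤

open Classical in
/-- The sandwiched Rényi divergence `D_α(ρ‖σ)` of order `α > 0`, which is the quantum relative
entropy (its limit) at `α = 1`. For positive semi-definite matrices, `ρ * σ = 0` says that the
supports of `ρ` and `σ` are orthogonal. -/
def renyiDiv {X : Type*} [Fintype X] [DecidableEq X] (α : ℝ) (ρ σ : Matrix X X ℂ) : EReal :=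
  if α = 1 then relEntropy ρ σ
  else if ρ * σ ≠ 0 ∧ (Dominates σ ρ ∨ α < 1) then
    ((1 / (α - 1) * Real.logb 2
      (mpow (mpow σ ((1 - α) / (2 * α)) * ρ * mpow σ ((1 - α) / (2 * α))) α).trace.re : ℝ) : EReal)
  else ⊤

/-- `H_α(ρ_XY‖τ_Y) = - D_α(ρ_XY ‖ id_X ⊗ τ_Y)`. -/
def condEntropyRel {X Y : Type*} [Fintype X] [DecidableEq X] [Fintype Y] [DecidableEq Y]
    (α : ℝ) (ρ : Matrix (X × Y) (X × Y) ℂ) (τ : Matrix Y Y ℂ) : EReal :=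
  - renyiDiv α ρ ((1 : Matrix X X ℂ) ⊗ₖ τ)

/-- `H^↑_α(X|Y)_ρ = - inf_σ D_α(ρ_XY ‖ id_X ⊗ σ_Y)`, the infimum over density matrices on `Y`. -/
def condEntropyUp {X Y : Type*} [Fintype X] [DecidableEq X] [Fintype Y] [DecidableEq Y]
    (α : ℝ) (ρ : Matrix (X × Y) (X × Y) ℂ) : EReal :=
  - ⨅ σ : {σ : Matrix Y Y ℂ // IsDensity σ}, renyiDiv α ρ ((1 : Matrix X X ℂ) ⊗ₖ σ.1)

/-- An operator on `A(BC)` regarded as an operator on `(AB)C`. -/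
def regroup {A B C : Type*} (ρ : Matrix (A × B × C) (A × B × C) ℂ) :
    Matrix ((A × B) × C) ((A × B) × C) ℂ :=
  ρ.submatrix (Equiv.prodAssoc A B C) (Equiv.prodAssoc A B C)

end QRenyi

end

/-! Put a = 1 - 1/α, b = 1 - 1/β, c = 1 - 1/γ. The relation becomes a(b + c) = bc, that is 1/a = 1/b
+ 1/c away from order one, and the two halves of the theorem are the cases b + c ≥ 0 and b + c ≤ 0.
Write Y = BC, T = id_B ⊗ τ_C and ρ = X X† with X = ρ^{1/2}, where the domain D of X plays the role
of a purifying system.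

The base of the divergence is a Schatten (quasi-)norm on D: `sandwich a ρ (1 ⊗ σ)` equals ‖X†(1 ⊗
σ^{-a})X‖_{1/(1-a)} (`sandwich_eq_compress`). By Hölder and reverse Hölder it is a supremum (a > 0)
or infimum (a < 0) over states κ on D of tr[κ^a X†(1 ⊗ σ^{-a})X]. The same trace is tr[σ^{-a} tr_A(X
κ^a X†)], and optimizing it over σ gives ‖tr_A(X κ^a X†)‖_{1/(1+a)}. At order β, exchanging the two
optimizations turns the infimum over σ into an optimization over κ of N(κ) = ‖tr_A(X κ^b
X†)‖_{1/(1+b)}.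

For fixed κ consider R(x) = T^{-c(1-x)/2} X̃ (1 ⊗ κ^{bx/2}), where X̃ is X reshaped into an operator
from AD to Y, measured in the Schatten p-norm with 1/p affine in x. Up to support projections, its
squared norm is C = `sandwich c ρ_Y T` at x = 0 and N(κ) at x = 1. At x = a/b both exponents become
a and p = 2, so the squared norm is L(κ) = tr[κ^a X†(1 ⊗ T^{-a})X]. Hadamard's three lines theorem
makes these norms log-convex in x (`snorm_interp`). The order of 0, 1, a/b on the real line decides
which of the three is bounded by the other two. In each case -(1/b) log N - (1/c) log C ≤ -(1/a) log
L if b + c > 0, with the reverse inequality if b + c < 0 (`chain_logb`).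

If b + c > 0, take κ optimal for L; then weak duality between N(κ) and each σ suffices
(`sandwich_chain_of_pos`). If b + c < 0, a κ nearly optimal for N is needed, and Sion's minimax
theorem supplies it (`exists_optimizer_of_neg`, `exists_optimizer_of_pos`). If b or c vanishes, the
interpolation degenerates; there the exact chain rule at order one is combined with the comparison
of every order with order one (`rdiv_zero_le`, `rdiv_le_zero`). -/

set_option linter.unusedSectionVars false

noncomputable section
namespace QRenyi
open Matrix

/-! ### Spectral calculus of Hermitian matrices, intertwiners and eigenbasis overlaps. -/

section SpectralCalculus

variable {n m : Type*} [Fintype n] [DecidableEq n] [Fintype m] [DecidableEq m]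

/-- Spectral calculus of a Hermitian matrix for complex valued functions. -/
def fc {H : Matrix n n ℂ} (hH : H.IsHermitian) (f : ℝ → ℂ) : Matrix n n ℂ :=
  (hH.eigenvectorUnitary : Matrix n n ℂ) * diagonal (fun i => f (hH.eigenvalues i)) *
    star (hH.eigenvectorUnitary : Matrix n n ℂ)

lemma eigU_star_mul {H : Matrix n n ℂ} (hH : H.IsHermitian) :
    star (hH.eigenvectorUnitary : Matrix n n ℂ) * (hH.eigenvectorUnitary : Matrix n n ℂ) = 1 :=
  Unitary.coe_star_mul_self _

lemma eigU_mul_star {H : Matrix n n ℂ} (hH : H.IsHermitian) :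
    (hH.eigenvectorUnitary : Matrix n n ℂ) * star (hH.eigenvectorUnitary : Matrix n n ℂ) = 1 :=
  Unitary.coe_mul_star_self _

lemma cfc_eq_fc {H : Matrix n n ℂ} (hH : H.IsHermitian) (g : ℝ → ℝ) :
    cfc g H = fc hH (fun x => (g x : ℂ)) := by
  rw [hH.cfc_eq, Matrix.IsHermitian.cfc, Unitary.conjStarAlgAut_apply]
  rfl

lemma fc_congr {H : Matrix n n ℂ} (hH : H.IsHermitian) {f g : ℝ → ℂ}
    (h : ∀ i, f (hH.eigenvalues i) = g (hH.eigenvalues i)) : fc hH f = fc hH g := by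
  unfold fc
  simp only [h]

lemma fc_mul {H : Matrix n n ℂ} (hH : H.IsHermitian) (f g : ℝ → ℂ) :
    fc hH f * fc hH g = fc hH (fun x => f x * g x) := by
  unfold fc
  calc _ = (hH.eigenvectorUnitary : Matrix n n ℂ) * (diagonal (fun i => f (hH.eigenvalues i)) *
      (star (hH.eigenvectorUnitary : Matrix n n ℂ) * (hH.eigenvectorUnitary : Matrix n n ℂ)) *
      diagonal (fun i => g (hH.eigenvalues i))) *
      star (hH.eigenvectorUnitary : Matrix n n ℂ) := by noncomm_ring
    _ = _ := by rw [eigU_star_mul, Matrix.mul_one, diagonal_mul_diagonal]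

lemma fc_id {H : Matrix n n ℂ} (hH : H.IsHermitian) : fc hH (fun x => (x : ℂ)) = H := by
  conv_rhs => rw [hH.spectral_theorem, Unitary.conjStarAlgAut_apply]
  rfl

lemma fc_one {H : Matrix n n ℂ} (hH : H.IsHermitian) : fc hH (fun _ => 1) = 1 := by
  unfold fc
  rw [diagonal_one, Matrix.mul_one, eigU_mul_star]

lemma fc_conjTranspose {H : Matrix n n ℂ} (hH : H.IsHermitian) (f : ℝ → ℂ) :
    (fc hH f)ᴴ = fc hH (fun x => star (f x)) := by
  unfold fc
  rw [conjTranspose_mul, conjTranspose_mul, diagonal_conjTranspose, star_eq_conjTranspose,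
    conjTranspose_conjTranspose, Matrix.mul_assoc]
  rfl

lemma fc_posSemidef {H : Matrix n n ℂ} (hH : H.IsHermitian) {f : ℝ → ℂ}
    (hf : ∀ i, 0 ≤ f (hH.eigenvalues i)) : (fc hH f).PosSemidef := by
  unfold fc
  exact (PosSemidef.diagonal (d := fun i => f (hH.eigenvalues i)) hf).mul_mul_conjTranspose_same _

lemma fc_trace {H : Matrix n n ℂ} (hH : H.IsHermitian) (f : ℝ → ℂ) :
    (fc hH f).trace = ∑ i, f (hH.eigenvalues i) := by
  unfold fc
  rw [trace_mul_comm, ← Matrix.mul_assoc, eigU_star_mul, Matrix.one_mul, trace_diagonal]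

/-- The spectral calculus respects intertwining operators. -/
lemma fc_intertwine {H : Matrix n n ℂ} {K : Matrix m m ℂ} (hH : H.IsHermitian)
    (hK : K.IsHermitian) {M : Matrix n m ℂ} (h : H * M = M * K) (f : ℝ → ℂ) :
    fc hH f * M = M * fc hK f := by
  set U := (hH.eigenvectorUnitary : Matrix n n ℂ) with hU
  set V := (hK.eigenvectorUnitary : Matrix m m ℂ) with hV
  have key : ∀ g : ℝ → ℂ, (diagonal (fun i => g (hH.eigenvalues i)) * (star U * M * V) =
      (star U * M * V) * diagonal (fun i => g (hK.eigenvalues i))) ↔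
      fc hH g * M = M * fc hK g := by
    intro g
    have e1 : star U * (fc hH g * M) * V =
        diagonal (fun i => g (hH.eigenvalues i)) * (star U * M * V) := by
      simp only [fc, ← hU, ← Matrix.mul_assoc]
      rw [eigU_star_mul hH, Matrix.one_mul]
    have e2 : star U * (M * fc hK g) * V =
        (star U * M * V) * diagonal (fun i => g (hK.eigenvalues i)) := by
      simp only [fc, ← hV, ← Matrix.mul_assoc]
      rw [Matrix.mul_assoc _ (star V) V, eigU_star_mul hK, Matrix.mul_one]
    rw [← e1, ← e2]
    refine ⟨fun h => ?_, fun h => by rw [h]⟩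
    have h' := congrArg (fun Z => U * Z * star V) h
    simp only [← Matrix.mul_assoc] at h'
    rw [eigU_mul_star hH] at h'
    simp only [Matrix.mul_assoc] at h'
    rw [eigU_mul_star hK] at h'
    simpa [Matrix.mul_assoc] using h'
  rw [← key]
  have h0 := (key (fun x => (x : ℂ))).2 (by rw [fc_id, fc_id, h])
  -- In the two eigenbases `h0` says (λ_i - μ_j) m_ij = 0, so f(λ_i) = f(μ_j) wherever m_ij ≠ 0.
  ext i j
  have h1 := congrFun (congrFun h0 i) j
  rw [diagonal_mul, mul_diagonal] at h1 ⊢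
  by_cases hz : (star U * M * V) i j = 0
  · simp [hz]
  · have : (hH.eigenvalues i : ℂ) = hK.eigenvalues j := by
      rw [mul_comm] at h1
      exact mul_left_cancel₀ hz h1
    rw [Complex.ofReal_inj.1 this, mul_comm]

lemma cfc_intertwine {H : Matrix n n ℂ} {K : Matrix m m ℂ} (hH : H.IsHermitian)
    (hK : K.IsHermitian) {M : Matrix n m ℂ} (h : H * M = M * K) (f : ℝ → ℝ) :
    cfc f H * M = M * cfc f K := by
  rw [cfc_eq_fc hH, cfc_eq_fc hK, fc_intertwine hH hK h]

/-- Squared overlaps of a matrix between the eigenbases of two Hermitian matrices. -/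
def overlap {H : Matrix n n ℂ} {K : Matrix m m ℂ} (hH : H.IsHermitian) (hK : K.IsHermitian)
    (M : Matrix n m ℂ) (i : n) (j : m) : ℝ :=
  ‖(star (hH.eigenvectorUnitary : Matrix n n ℂ) * M * (hK.eigenvectorUnitary : Matrix m m ℂ)) i j‖ ^ 2

lemma overlap_nonneg {H : Matrix n n ℂ} {K : Matrix m m ℂ} (hH : H.IsHermitian)
    (hK : K.IsHermitian) (M : Matrix n m ℂ) (i : n) (j : m) : 0 ≤ overlap hH hK M i j := by
  unfold overlap; positivity

lemma trace_fc_mul_fc {H : Matrix n n ℂ} {K : Matrix m m ℂ} (hH : H.IsHermitian)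
    (hK : K.IsHermitian) (M : Matrix n m ℂ) (f g : ℝ → ℂ) :
    (fc hH f * M * fc hK g * Mᴴ).trace =
      ∑ i, ∑ j, f (hH.eigenvalues i) * g (hK.eigenvalues j) * (overlap hH hK M i j : ℂ) := by
  set U := (hH.eigenvectorUnitary : Matrix n n ℂ) with hU
  set V := (hK.eigenvectorUnitary : Matrix m m ℂ) with hV
  have e : (fc hH f * M * fc hK g * Mᴴ).trace =
      (diagonal (fun i => f (hH.eigenvalues i)) * (star U * M * V) *
        diagonal (fun i => g (hK.eigenvalues i)) * (star U * M * V)ᴴ).trace := by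
    simp only [fc, ← hU, ← hV, conjTranspose_mul, star_eq_conjTranspose,
      conjTranspose_conjTranspose, Matrix.mul_assoc]
    rw [trace_mul_comm]
    simp only [Matrix.mul_assoc]
  rw [e]
  refine Finset.sum_congr rfl fun i _ => ?_
  rw [diag_apply, mul_apply]
  refine Finset.sum_congr rfl fun j _ => ?_
  rw [mul_diagonal, diagonal_mul, conjTranspose_apply]
  have : (overlap hH hK M i j : ℂ) = (star U * M * V) i j * star ((star U * M * V) i j) := by
    rw [overlap, ← hU, ← hV]
    push_cast
    rw [← Complex.mul_conj']
    rfl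
  rw [this]
  ring

lemma overlap_sum_right {H : Matrix n n ℂ} {K : Matrix m m ℂ} (hH : H.IsHermitian)
    (hK : K.IsHermitian) {M : Matrix n m ℂ} (hM : M * Mᴴ = 1) (i : n) :
    ∑ j, overlap hH hK M i j = 1 := by
  set U := (hH.eigenvectorUnitary : Matrix n n ℂ) with hU
  set V := (hK.eigenvectorUnitary : Matrix m m ℂ) with hV
  have e : (star U * M * V) * (star U * M * V)ᴴ = 1 := by
    rw [conjTranspose_mul, conjTranspose_mul]
    calc _ = star U * (M * (V * star V) * Mᴴ) * U := by
          simp only [star_eq_conjTranspose, conjTranspose_conjTranspose, Matrix.mul_assoc]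
      _ = 1 := by rw [eigU_mul_star hK, Matrix.mul_one, hM, Matrix.mul_one, eigU_star_mul hH]
  have e2 := congrFun (congrFun e i) i
  rw [mul_apply, one_apply_eq] at e2
  have : ((∑ j, overlap hH hK M i j : ℝ) : ℂ) = 1 := by
    rw [← e2]
    push_cast
    refine Finset.sum_congr rfl fun j _ => ?_
    rw [overlap, ← hU, ← hV, conjTranspose_apply]
    push_cast
    rw [← Complex.mul_conj']
    rfl
  exact_mod_cast this

lemma overlap_sum_left {H : Matrix n n ℂ} {K : Matrix m m ℂ} (hH : H.IsHermitian)
    (hK : K.IsHermitian) {M : Matrix n m ℂ} (hM : Mᴴ * M = 1) (j : m) :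
    ∑ i, overlap hH hK M i j = 1 := by
  have h := overlap_sum_right hK hH (M := Mᴴ) (by rwa [conjTranspose_conjTranspose]) j
  rw [← h]
  refine Finset.sum_congr rfl fun i _ => ?_
  have : star (hK.eigenvectorUnitary : Matrix m m ℂ) * Mᴴ * (hH.eigenvectorUnitary : Matrix n n ℂ)
      = (star (hH.eigenvectorUnitary : Matrix n n ℂ) * M *
        (hK.eigenvectorUnitary : Matrix m m ℂ))ᴴ := by
    simp only [conjTranspose_mul, star_eq_conjTranspose, conjTranspose_conjTranspose, Matrix.mul_assoc]
  rw [overlap, overlap, this, conjTranspose_apply, norm_star]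

end SpectralCalculus

/-! ### Real powers on the support and their traces. -/

section SupportPowers

variable {n m : Type*} [Fintype n] [DecidableEq n] [Fintype m] [DecidableEq m]

/-- Real powers with value `0` at `0` for every exponent, including `0`. -/
def sp (s x : ℝ) : ℝ := if x = 0 then 0 else x ^ s

lemma sp_zero (s : ℝ) : sp s 0 = 0 := if_pos rfl

lemma sp_of_ne {s x : ℝ} (hx : x ≠ 0) : sp s x = x ^ s := if_neg hx

lemma sp_eq_rpow {s : ℝ} (hs : s ≠ 0) (x : ℝ) : sp s x = x ^ s := by
  unfold sp
  split_ifs with h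
  · rw [h, Real.zero_rpow hs]
  · rfl

lemma sp_nonneg {s x : ℝ} (hx : 0 ≤ x) : 0 ≤ sp s x := by
  unfold sp
  split_ifs
  · exact le_rfl
  · positivity

lemma sp_pos {s x : ℝ} (hx : 0 < x) : 0 < sp s x := by
  rw [sp_of_ne hx.ne']; positivity

lemma sp_mul {s r x : ℝ} (hx : 0 ≤ x) : sp s x * sp r x = sp (s + r) x := by
  unfold sp
  split_ifs with h
  · simp
  · rw [Real.rpow_add (lt_of_le_of_ne hx (Ne.symm h))]

lemma sp_sp {s r x : ℝ} (hx : 0 ≤ x) : sp r (sp s x) = sp (s * r) x := by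
  rcases hx.eq_or_lt with h | h
  · rw [← h, sp_zero, sp_zero, sp_zero]
  · rw [sp_of_ne (sp_pos h).ne', sp_of_ne h.ne', sp_of_ne h.ne', Real.rpow_mul hx]

lemma sp_one (x : ℝ) : sp 1 x = x := by
  rw [sp_eq_rpow one_ne_zero, Real.rpow_one]

lemma mul_sp {s c x : ℝ} (hc : 0 < c) (hx : 0 ≤ x) : sp s (c * x) = c ^ s * sp s x := by
  rcases hx.eq_or_lt with h | h
  · rw [← h, mul_zero, sp_zero, mul_zero]
  · rw [sp_of_ne (mul_pos hc h).ne', sp_of_ne h.ne', Real.mul_rpow hc.le hx]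

/-- The power `H ^ s` of a positive semi-definite matrix taken on the support of `H`; in particular
`spow H 0` is the projection onto the support. -/
def spow (H : Matrix n n ℂ) (s : ℝ) : Matrix n n ℂ := cfc (sp s) H

lemma mpow_eq_spow {s : ℝ} (hs : s ≠ 0) (H : Matrix n n ℂ) : mpow H s = spow H s := by
  unfold mpow spow
  congr 1
  funext x
  rw [sp_eq_rpow hs]

lemma spow_eq_fc {H : Matrix n n ℂ} (hH : H.IsHermitian) (s : ℝ) :
    spow H s = fc hH (fun x => (sp s x : ℂ)) := cfc_eq_fc hH _

lemma spow_posSemidef {H : Matrix n n ℂ} (hH : H.PosSemidef) (s : ℝ) :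
    (spow H s).PosSemidef := by
  rw [spow_eq_fc hH.1]
  exact fc_posSemidef _ fun i => by exact_mod_cast sp_nonneg (hH.eigenvalues_nonneg i)

lemma spow_isHermitian {H : Matrix n n ℂ} (hH : H.PosSemidef) (s : ℝ) :
    (spow H s).IsHermitian := (spow_posSemidef hH s).1

lemma spow_mul {H : Matrix n n ℂ} (hH : H.PosSemidef) (s r : ℝ) :
    spow H s * spow H r = spow H (s + r) := by
  rw [spow_eq_fc hH.1, spow_eq_fc hH.1, spow_eq_fc hH.1, fc_mul]
  refine fc_congr _ fun i => ?_
  rw [← sp_mul (hH.eigenvalues_nonneg i)]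
  push_cast
  rfl

lemma spow_mul_assoc {H : Matrix n n ℂ} (hH : H.PosSemidef) (s r : ℝ) (M : Matrix n m ℂ) :
    spow H s * (spow H r * M) = spow H (s + r) * M := by
  rw [← Matrix.mul_assoc, spow_mul hH]

lemma spow_one {H : Matrix n n ℂ} (hH : H.PosSemidef) : spow H 1 = H := by
  rw [spow_eq_fc hH.1]
  simp only [sp_one]
  exact fc_id hH.1

lemma finite_continuousOn (H : Matrix n n ℂ) (f : ℝ → ℝ) : ContinuousOn f (spectrum ℝ H) :=
  (Matrix.finite_real_spectrum).continuousOn f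

lemma spow_spow {H : Matrix n n ℂ} (hH : H.PosSemidef) (s r : ℝ) :
    spow (spow H s) r = spow H (s * r) := by
  unfold spow
  refine (cfc_comp (sp r) (sp s) H hH.1
    (((Matrix.finite_real_spectrum).image _).continuousOn _) (finite_continuousOn _ _)).symm.trans ?_
  refine cfc_congr fun x hx => ?_
  rw [hH.1.spectrum_real_eq_range_eigenvalues] at hx
  obtain ⟨i, rfl⟩ := hx
  exact sp_sp (hH.eigenvalues_nonneg i)

lemma spow_smul {H : Matrix n n ℂ} (hH : H.PosSemidef) {c : ℝ} (hc : 0 < c) (s : ℝ) :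
    spow (c • H) s = c ^ s • spow H s := by
  unfold spow
  rw [← cfc_smul (c ^ s) (sp s) H (finite_continuousOn _ _)]
  refine (cfc_comp_const_mul c (sp s) H
    (((Matrix.finite_real_spectrum).image _).continuousOn _) hH.1).symm.trans ?_
  refine cfc_congr fun x hx => ?_
  rw [hH.1.spectrum_real_eq_range_eigenvalues] at hx
  obtain ⟨i, rfl⟩ := hx
  exact mul_sp hc (hH.eigenvalues_nonneg i)

/-- All support powers of `H`, including exponent 0, have the same kernel. This lets exponents be
exchanged in support arguments. -/
lemma spow_mul_eq_zero {H : Matrix n n ℂ} (hH : H.PosSemidef) {M : Matrix n m ℂ} {s : ℝ}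
    (r : ℝ) (h : spow H s * M = 0) : spow H r * M = 0 := by
  have := spow_mul_assoc hH (r - s) s M
  rw [h, sub_add_cancel, Matrix.mul_zero] at this
  exact this.symm

lemma mul_spow_eq_zero {H : Matrix n n ℂ} (hH : H.PosSemidef) {M : Matrix m n ℂ} {s : ℝ}
    (r : ℝ) (h : M * spow H s = 0) : M * spow H r = 0 := by
  rw [← sub_add_cancel r s, add_comm, ← spow_mul hH, ← Matrix.mul_assoc, h, Matrix.zero_mul]

lemma dominates_iff {σ : Matrix n n ℂ} (hσ : σ.PosSemidef) (ρ : Matrix n n ℂ) :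
    Dominates σ ρ ↔ ρ * spow σ 0 = ρ := by
  constructor
  · intro h
    have h1 : σ * (1 - spow σ 0) = 0 := by
      conv_lhs => rw [← spow_one hσ, Matrix.mul_sub, spow_spow hσ, mul_zero, spow_mul hσ]
      simp
    have h2 : ρ * (1 - spow σ 0) = 0 := by
      ext i j
      have h3 := h (fun k => (1 - spow σ 0) k j) (by
        ext k; exact congrFun (congrFun h1 k) j)
      exact congrFun h3 i
    rw [Matrix.mul_sub, Matrix.mul_one, sub_eq_zero] at h2
    exact h2.symm
  · intro h v hv
    rw [← h, ← Matrix.mulVec_mulVec]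
    have : spow σ 0 *ᵥ v = 0 := by
      rw [← neg_add_cancel (1 : ℝ), ← spow_mul hσ, spow_one hσ, ← Matrix.mulVec_mulVec, hv,
        Matrix.mulVec_zero]
    rw [this, Matrix.mulVec_zero]

/-- The trace of a power of a positive semi-definite matrix. -/
def trpow (H : Matrix n n ℂ) (p : ℝ) : ℝ := (spow H p).trace.re

lemma trpow_eq_sum {H : Matrix n n ℂ} (hH : H.IsHermitian) (p : ℝ) :
    trpow H p = ∑ i, sp p (hH.eigenvalues i) := by
  rw [trpow, spow_eq_fc hH, fc_trace, ← Complex.ofReal_sum, Complex.ofReal_re]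

lemma spow_trace {H : Matrix n n ℂ} (hH : H.IsHermitian) (p : ℝ) :
    (spow H p).trace = (trpow H p : ℂ) := by
  rw [trpow_eq_sum hH, spow_eq_fc hH, fc_trace, ← Complex.ofReal_sum]

lemma trpow_nonneg {H : Matrix n n ℂ} (hH : H.PosSemidef) (p : ℝ) : 0 ≤ trpow H p := by
  rw [trpow_eq_sum hH.1]
  exact Finset.sum_nonneg fun i _ => sp_nonneg (hH.eigenvalues_nonneg i)

lemma trpow_one {H : Matrix n n ℂ} (hH : H.PosSemidef) : trpow H 1 = H.trace.re := by
  rw [trpow, spow_one hH]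

lemma trpow_pos {H : Matrix n n ℂ} (hH : H.PosSemidef) (h0 : H ≠ 0) (p : ℝ) :
    0 < trpow H p := by
  refine lt_of_le_of_ne (trpow_nonneg hH p) fun h => h0 ?_
  rw [trpow_eq_sum hH.1, eq_comm,
    Finset.sum_eq_zero_iff_of_nonneg fun i _ => sp_nonneg (hH.eigenvalues_nonneg i)] at h
  rw [← hH.1.eigenvalues_eq_zero_iff]
  funext i
  by_contra hi
  exact (sp_pos (lt_of_le_of_ne (hH.eigenvalues_nonneg i) (Ne.symm hi))).ne'
    (h i (Finset.mem_univ _))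

lemma trpow_zero_matrix (p : ℝ) : trpow (0 : Matrix n n ℂ) p = 0 := by
  have h : (0 : Matrix n n ℂ).PosSemidef := PosSemidef.zero
  rw [trpow_eq_sum h.1]
  refine Finset.sum_eq_zero fun i _ => ?_
  rw [h.1.eigenvalues_eq_zero_iff.2 rfl, Pi.zero_apply, sp_zero]

lemma trpow_spow {H : Matrix n n ℂ} (hH : H.PosSemidef) (s p : ℝ) :
    trpow (spow H s) p = trpow H (s * p) := by
  rw [trpow, spow_spow hH, trpow]

lemma spow_intertwine {H : Matrix n n ℂ} {K : Matrix m m ℂ} (hH : H.IsHermitian)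
    (hK : K.IsHermitian) {M : Matrix n m ℂ} (h : H * M = M * K) (s : ℝ) :
    spow H s * M = M * spow K s := cfc_intertwine hH hK h _

/-- `M` intertwines M M† with M†M, hence also their powers; one factor is then moved around the
trace. -/
lemma trpow_mul_conjTranspose (M : Matrix n m ℂ) (p : ℝ) :
    trpow (M * Mᴴ) p = trpow (Mᴴ * M) p := by
  have h1 := posSemidef_self_mul_conjTranspose M
  have h2 := posSemidef_conjTranspose_mul_self M
  have h3 := spow_intertwine h1.1 h2.1 (M := M) (by rw [Matrix.mul_assoc]) (p - 1)
  unfold trpow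
  congr 1
  calc (spow (M * Mᴴ) p).trace = (spow (M * Mᴴ) (p - 1) * (M * Mᴴ)).trace := by
        nth_rw 3 [← spow_one h1]
        rw [spow_mul h1, sub_add_cancel]
    _ = (spow (Mᴴ * M) (p - 1) * (Mᴴ * M)).trace := by
        rw [← Matrix.mul_assoc, h3, trace_mul_comm, ← Matrix.mul_assoc, trace_mul_comm]
    _ = _ := by
        nth_rw 2 [← spow_one h2]
        rw [spow_mul h2, sub_add_cancel]

/-- The embedding v ↦ e_j ⊗ v intertwines 1 ⊗ H with H, hence also their functions; comparing matrix
entries for every j gives the result. -/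
lemma cfc_one_kronecker (f : ℝ → ℝ) {H : Matrix n n ℂ} (hH : H.IsHermitian) :
    cfc f ((1 : Matrix m m ℂ) ⊗ₖ H) = (1 : Matrix m m ℂ) ⊗ₖ cfc f H := by
  have hK : ((1 : Matrix m m ℂ) ⊗ₖ H).IsHermitian := by
    rw [IsHermitian, conjTranspose_kronecker, conjTranspose_one, hH.eq]
  ext ⟨i, k⟩ ⟨j, l⟩
  have h := cfc_intertwine hK hH
    (M := Matrix.of fun (x : m × n) (y : n) => if x = (j, y) then (1 : ℂ) else 0) (by
      ext ⟨x1, x2⟩ y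
      simp [mul_apply, Fintype.sum_prod_type, one_apply, Prod.ext_iff, ite_and]) f
  have h1 := congrFun (congrFun h (i, k)) l
  simp only [mul_apply, Matrix.of_apply] at h1
  simp only [mul_ite, mul_one, mul_zero, Finset.sum_ite_eq', Finset.mem_univ, if_true] at h1
  rw [h1]
  by_cases hij : i = j
  · subst hij
    simp
  · simp [hij, one_apply]

lemma cfc_submatrix (f : ℝ → ℝ) {H : Matrix n n ℂ} (hH : H.IsHermitian) (e : m ≃ n) :
    cfc f (H.submatrix e e) = (cfc f H).submatrix e e := by
  have h := cfc_intertwine (hH.submatrix e) hH (M := (1 : Matrix n n ℂ).submatrix e id) (by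
    ext i j
    simp only [mul_apply, submatrix_apply, one_apply, id, mul_ite, mul_one, mul_zero, ite_mul,
      one_mul, zero_mul, Finset.sum_ite_eq, Finset.mem_univ, if_true]
    rw [e.sum_comp (fun k => if k = j then H (e i) k else 0)]
    simp) f
  ext i j
  have h1 := congrFun (congrFun h i) (e j)
  simpa [mul_apply, one_apply] using h1

lemma spow_one_kronecker {H : Matrix n n ℂ} (hH : H.IsHermitian) (s : ℝ) :
    spow ((1 : Matrix m m ℂ) ⊗ₖ H) s = (1 : Matrix m m ℂ) ⊗ₖ spow H s :=
  cfc_one_kronecker _ hH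

end SupportPowers

/-! ### Hölder inequalities, contractions and Schatten norms. -/

section Holder

variable {n m l : Type*} [Fintype n] [DecidableEq n] [Fintype m] [DecidableEq m]
  [Fintype l] [DecidableEq l]

/-- Weighted Hölder inequality for finite sums, with the exponent `0` allowed. -/
lemma weighted_holder {ι : Type*} [Fintype ι] {c F G : ι → ℝ} (hc : ∀ i, 0 ≤ c i)
    (hF : ∀ i, 0 ≤ F i) (hG : ∀ i, 0 ≤ G i) {s : ℝ} (hs0 : 0 ≤ s) (hs1 : s < 1) :
    ∑ i, c i * F i ^ s * G i ≤
      (∑ i, c i * F i) ^ s * (∑ i, c i * G i ^ (1 / (1 - s))) ^ (1 - s) := by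
  rcases hs0.eq_or_lt with h | h
  · subst h
    simp
  have h1s : 0 < 1 - s := by linarith
  have hpq : (1 / s).HolderConjugate (1 / (1 - s)) := by
    rw [Real.holderConjugate_iff]
    refine ⟨by rw [lt_div_iff₀ h]; linarith, by simp⟩
  have := Real.inner_le_Lp_mul_Lq_of_nonneg Finset.univ hpq (f := fun i => (c i * F i) ^ s)
    (g := fun i => c i ^ (1 - s) * G i) (fun i _ => Real.rpow_nonneg (mul_nonneg (hc i) (hF i)) _)
    (fun i _ => mul_nonneg (Real.rpow_nonneg (hc i) _) (hG i))
  refine le_trans (le_of_eq ?_) (this.trans (le_of_eq ?_))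
  · refine Finset.sum_congr rfl fun i _ => ?_
    rw [Real.mul_rpow (hc i) (hF i)]
    rcases (hc i).eq_or_lt with h0 | h0
    · rw [← h0, Real.zero_rpow h.ne']; ring
    · have : c i = c i ^ s * c i ^ (1 - s) := by
        rw [← Real.rpow_add h0]; simp
      nth_rw 1 [this]
      ring
  · rw [one_div_one_div, one_div_one_div]
    congr 2
    · refine Finset.sum_congr rfl fun i _ => ?_
      rw [← Real.rpow_mul (mul_nonneg (hc i) (hF i)), mul_one_div_cancel h.ne', Real.rpow_one]
    · refine Finset.sum_congr rfl fun i _ => ?_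
      rw [Real.mul_rpow (Real.rpow_nonneg (hc i) _) (hG i), ← Real.rpow_mul (hc i),
        mul_one_div_cancel h1s.ne', Real.rpow_one]

/-- Contractions, as matrices `A` with `Aᴴ A ≤ 1` and `A Aᴴ ≤ 1`. -/
def IsContr (A : Matrix m n ℂ) : Prop :=
  (1 - Aᴴ * A).PosSemidef ∧ (1 - A * Aᴴ).PosSemidef

lemma IsContr.conjTranspose {A : Matrix m n ℂ} (hA : IsContr A) : IsContr Aᴴ := by
  refine ⟨?_, ?_⟩
  · rw [conjTranspose_conjTranspose]; exact hA.2
  · rw [conjTranspose_conjTranspose]; exact hA.1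

lemma IsContr.mul {A : Matrix m n ℂ} {B : Matrix n l ℂ} (hA : IsContr A) (hB : IsContr B) :
    IsContr (A * B) := by
  refine ⟨?_, ?_⟩
  · have := hB.1.add (hA.1.conjTranspose_mul_mul_same B)
    convert this using 1
    rw [conjTranspose_mul, Matrix.mul_sub, Matrix.sub_mul, Matrix.mul_one]
    simp only [Matrix.mul_assoc]
    abel
  · have := hA.2.add (hB.2.mul_mul_conjTranspose_same A)
    convert this using 1
    rw [conjTranspose_mul, Matrix.mul_sub, Matrix.sub_mul, Matrix.mul_one]
    simp only [Matrix.mul_assoc]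
    abel

lemma isContr_of_unitary {A : Matrix n n ℂ} (h1 : star A * A = 1) (h2 : A * star A = 1) :
    IsContr A := by
  rw [star_eq_conjTranspose] at h1 h2
  exact ⟨by rw [h1, sub_self]; exact PosSemidef.zero, by rw [h2, sub_self]; exact PosSemidef.zero⟩

lemma isContr_one : IsContr (1 : Matrix n n ℂ) := isContr_of_unitary (by simp) (by simp)

lemma isContr_fc {H : Matrix n n ℂ} (hH : H.IsHermitian) {f : ℝ → ℂ}
    (hf : ∀ i, ‖f (hH.eigenvalues i)‖ ≤ 1) : IsContr (fc hH f) := by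
  have key : ∀ i, (0 : ℂ) ≤ 1 - star (f (hH.eigenvalues i)) * f (hH.eigenvalues i) := by
    intro i
    have : star (f (hH.eigenvalues i)) * f (hH.eigenvalues i)
        = ((‖f (hH.eigenvalues i)‖ ^ 2 : ℝ) : ℂ) := by
      push_cast
      exact Complex.conj_mul' _
    rw [this]
    have h2 : ‖f (hH.eigenvalues i)‖ ^ 2 ≤ 1 := pow_le_one₀ (norm_nonneg _) (hf i)
    have : (0 : ℝ) ≤ 1 - ‖f (hH.eigenvalues i)‖ ^ 2 := by linarith
    exact_mod_cast this
  have sub : ∀ g h : ℝ → ℂ, fc hH g - fc hH h = fc hH (fun x => g x - h x) := by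
    intro g h
    unfold fc
    rw [← Matrix.sub_mul, ← Matrix.mul_sub, diagonal_sub]
  refine ⟨?_, ?_⟩
  · rw [fc_conjTranspose, fc_mul, ← fc_one hH, sub]
    exact fc_posSemidef _ key
  · rw [fc_conjTranspose, fc_mul, ← fc_one hH, sub]
    refine fc_posSemidef _ fun i => ?_
    rw [mul_comm]
    exact key i

lemma isContr_spow_zero {H : Matrix n n ℂ} (hH : H.PosSemidef) : IsContr (spow H 0) := by
  rw [spow_eq_fc hH.1]
  refine isContr_fc _ fun i => ?_
  unfold sp
  split_ifs <;> simp

lemma IsContr.sum_col {A : Matrix m n ℂ} (hA : IsContr A) (k : n) : ∑ j, ‖A j k‖ ^ 2 ≤ 1 := by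
  have h := hA.1.diag_nonneg (i := k)
  rw [Matrix.sub_apply, one_apply_eq, mul_apply, sub_nonneg] at h
  have : ((∑ j, ‖A j k‖ ^ 2 : ℝ) : ℂ) ≤ 1 := by
    refine le_trans (le_of_eq ?_) h
    push_cast
    refine Finset.sum_congr rfl fun j _ => ?_
    rw [conjTranspose_apply, ← Complex.conj_mul']
    rfl
  exact_mod_cast this

lemma IsContr.sum_row {A : Matrix m n ℂ} (hA : IsContr A) (j : m) : ∑ k, ‖A j k‖ ^ 2 ≤ 1 := by
  have := hA.conjTranspose.sum_col j
  simpa [conjTranspose_apply, norm_star] using this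

lemma sum_norm_mul_le_one {ι : Type*} [Fintype ι] {x y : ι → ℂ} (hx : ∑ i, ‖x i‖ ^ 2 ≤ 1)
    (hy : ∑ i, ‖y i‖ ^ 2 ≤ 1) : ∑ i, ‖x i‖ * ‖y i‖ ≤ 1 := by
  have : ∀ i ∈ Finset.univ, ‖x i‖ * ‖y i‖ ≤ (‖x i‖ ^ 2 + ‖y i‖ ^ 2) / 2 := fun i _ => by
    nlinarith [sq_nonneg (‖x i‖ - ‖y i‖)]
  refine (Finset.sum_le_sum this).trans ?_
  rw [← Finset.sum_div, Finset.sum_add_distrib]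
  linarith

/-- Hölder's inequality for the trace of a product of two contractions and two functions of
Hermitian matrices. -/
lemma norm_trace_contr_le {A : Matrix m n ℂ} {B : Matrix n m ℂ} (hA : IsContr A) (hB : IsContr B)
    {R : Matrix n n ℂ} {K : Matrix m m ℂ} (hR : R.IsHermitian) (hK : K.IsHermitian)
    (f g : ℝ → ℂ) {F : n → ℝ} (hF : ∀ k, 0 ≤ F k) {p : ℝ} (hp : 1 ≤ p)
    (hf : ∀ k, ‖f (hR.eigenvalues k)‖ ≤ F k ^ (1 - 1 / p)) :
    ‖(A * fc hR f * B * fc hK g).trace‖ ≤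
      (∑ k, F k) ^ (1 - 1 / p) * (∑ j, ‖g (hK.eigenvalues j)‖ ^ p) ^ (1 / p) := by
  set U := (hR.eigenvectorUnitary : Matrix n n ℂ) with hU
  set V := (hK.eigenvectorUnitary : Matrix m m ℂ) with hV
  have hUc : IsContr U := isContr_of_unitary (eigU_star_mul hR) (eigU_mul_star hR)
  have hVc : IsContr V := isContr_of_unitary (eigU_star_mul hK) (eigU_mul_star hK)
  have hA' : IsContr (star V * A * U) := (hVc.conjTranspose.mul hA).mul hUc
  have hB' : IsContr (star U * B * V) := (hUc.conjTranspose.mul hB).mul hVc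
  set A' := star V * A * U
  set B' := star U * B * V
  have e : (A * fc hR f * B * fc hK g).trace =
      (A' * diagonal (fun i => f (hR.eigenvalues i)) * (B' *
        diagonal (fun i => g (hK.eigenvalues i)))).trace := by
    simp only [fc, ← hU, ← hV, A', B']
    simp only [Matrix.mul_assoc]
    rw [trace_mul_comm (star V)]
    simp only [Matrix.mul_assoc]
  have hp0 : 0 < p := by linarith
  have hs0 : 0 ≤ 1 - 1 / p := by
    rw [sub_nonneg, div_le_one hp0]; exact hp
  have hs1 : 1 - 1 / p < 1 := by
    have : 0 < 1 / p := by positivity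
    linarith
  have e1 : ‖(A * fc hR f * B * fc hK g).trace‖ ≤ ∑ x : m × n,
      (‖A' x.1 x.2‖ * ‖B' x.2 x.1‖) * F x.2 ^ (1 - 1 / p) * ‖g (hK.eigenvalues x.1)‖ := by
    rw [e, Fintype.sum_prod_type]
    refine (norm_sum_le _ _).trans (Finset.sum_le_sum fun j _ => ?_)
    rw [diag_apply, mul_apply]
    refine (norm_sum_le _ _).trans (Finset.sum_le_sum fun k _ => ?_)
    rw [mul_diagonal, mul_diagonal, norm_mul, norm_mul, norm_mul]
    have := mul_le_mul_of_nonneg_left (hf k)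
      (show 0 ≤ ‖A' j k‖ * ‖B' k j‖ * ‖g (hK.eigenvalues j)‖ by positivity)
    nlinarith [this]
  refine e1.trans ((weighted_holder (c := fun x : m × n => ‖A' x.1 x.2‖ * ‖B' x.2 x.1‖)
    (F := fun x => F x.2) (G := fun x => ‖g (hK.eigenvalues x.1)‖) (fun x => by positivity)
    (fun x => hF _) (fun x => norm_nonneg _) hs0 hs1).trans ?_)
  rw [sub_sub_cancel, one_div_one_div]
  -- The weights |A'_jk| |B'_kj| have row and column sums at most 1, since rows and columns of
  -- contractions are subnormalized. Each factor of the scalar Hölder bound therefore collapses to a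
  -- sum over a single spectrum.
  have b1 : ∑ x : m × n, ‖A' x.1 x.2‖ * ‖B' x.2 x.1‖ * F x.2 ≤ ∑ k, F k := by
    rw [Fintype.sum_prod_type_right]
    refine Finset.sum_le_sum fun k _ => ?_
    dsimp only
    rw [← Finset.sum_mul]
    exact mul_le_of_le_one_left (hF k) (sum_norm_mul_le_one (hA'.sum_col k) (hB'.sum_row k))
  have b2 : ∑ x : m × n, ‖A' x.1 x.2‖ * ‖B' x.2 x.1‖ * ‖g (hK.eigenvalues x.1)‖ ^ p ≤
      ∑ j, ‖g (hK.eigenvalues j)‖ ^ p := by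
    rw [Fintype.sum_prod_type]
    refine Finset.sum_le_sum fun j _ => ?_
    dsimp only
    rw [← Finset.sum_mul]
    exact mul_le_of_le_one_left (by positivity)
      (sum_norm_mul_le_one (hA'.sum_row j) (hB'.sum_col j))
  have n1 : 0 ≤ ∑ x : m × n, ‖A' x.1 x.2‖ * ‖B' x.2 x.1‖ * F x.2 :=
    Finset.sum_nonneg fun x _ => mul_nonneg (by positivity) (hF _)
  have n2 : 0 ≤ ∑ x : m × n, ‖A' x.1 x.2‖ * ‖B' x.2 x.1‖ * ‖g (hK.eigenvalues x.1)‖ ^ p :=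
    Finset.sum_nonneg fun x _ => by positivity
  gcongr
  exact Real.rpow_nonneg (n1.trans b1) _

/-- The Schatten `p`-norm. -/
def snorm (p : ℝ) (M : Matrix n m ℂ) : ℝ := trpow (M * Mᴴ) (p / 2) ^ (1 / p)

lemma snorm_nonneg (p : ℝ) (M : Matrix n m ℂ) : 0 ≤ snorm p M :=
  Real.rpow_nonneg (trpow_nonneg (posSemidef_self_mul_conjTranspose M) _) _

/-- M|M|^{-1}, with the inverse on the support, is the partial isometry of the polar decomposition:
its two Gram matrices are the support projections of M†M and M M†. -/
lemma isContr_polar (M : Matrix n m ℂ) : IsContr (M * spow (Mᴴ * M) (-1 / 2)) := by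
  have h1 := posSemidef_self_mul_conjTranspose M
  have h2 := posSemidef_conjTranspose_mul_self M
  refine ⟨?_, ?_⟩
  · have : (M * spow (Mᴴ * M) (-1 / 2))ᴴ * (M * spow (Mᴴ * M) (-1 / 2)) = spow (Mᴴ * M) 0 := by
      rw [conjTranspose_mul, (spow_isHermitian h2 _).eq]
      calc _ = spow (Mᴴ * M) (-1 / 2) * (Mᴴ * M) * spow (Mᴴ * M) (-1 / 2) := by
            simp only [Matrix.mul_assoc]
        _ = spow (Mᴴ * M) (-1 / 2) * spow (Mᴴ * M) 1 * spow (Mᴴ * M) (-1 / 2) := by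
            rw [spow_one h2]
        _ = _ := by rw [spow_mul h2, spow_mul h2]; norm_num
    rw [this]
    have := (isContr_spow_zero h2).1
    rwa [(spow_isHermitian h2 _).eq, spow_mul h2, add_zero] at this
  · have : (M * spow (Mᴴ * M) (-1 / 2)) * (M * spow (Mᴴ * M) (-1 / 2))ᴴ = spow (M * Mᴴ) 0 := by
      rw [conjTranspose_mul, (spow_isHermitian h2 _).eq]
      calc _ = M * (spow (Mᴴ * M) (-1 / 2) * spow (Mᴴ * M) (-1 / 2)) * Mᴴ := by
            simp only [Matrix.mul_assoc]
        _ = spow (M * Mᴴ) (-1) * (M * Mᴴ) := by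
            rw [spow_mul h2, ← spow_intertwine h1.1 h2.1 (M := M) (by rw [Matrix.mul_assoc])]
            norm_num [Matrix.mul_assoc]
        _ = spow (M * Mᴴ) (-1) * spow (M * Mᴴ) 1 := by rw [spow_one h1]
        _ = _ := by rw [spow_mul h1]; norm_num
    rw [this]
    have := (isContr_spow_zero h1).1
    rwa [(spow_isHermitian h1 _).eq, spow_mul h1, add_zero] at this

lemma polar_mul (M : Matrix n m ℂ) :
    M * spow (Mᴴ * M) (-1 / 2) * spow (Mᴴ * M) (1 / 2) = M := by
  have h2 := posSemidef_conjTranspose_mul_self M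
  rw [Matrix.mul_assoc, spow_mul h2]
  have h : M * (1 - spow (Mᴴ * M) 0) = 0 := by
    rw [← conjTranspose_mul_self_eq_zero, conjTranspose_mul]
    have : Mᴴ * M * (1 - spow (Mᴴ * M) 0) = 0 := by
      rw [Matrix.mul_sub]
      nth_rw 2 [← spow_one h2]
      rw [spow_mul h2, add_zero, spow_one h2, Matrix.mul_one, sub_self]
    rw [Matrix.mul_assoc, ← Matrix.mul_assoc Mᴴ, this, Matrix.mul_zero]
  rw [Matrix.mul_sub, Matrix.mul_one, sub_eq_zero] at h
  norm_num
  exact h.symm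

/-- Duality bound for Schatten norms. -/
lemma norm_trace_le_snorm {A : Matrix m n ℂ} {B : Matrix n n ℂ} (hA : IsContr A) (hB : IsContr B)
    {R : Matrix n n ℂ} (hR : R.IsHermitian) (f : ℝ → ℂ) {F : n → ℝ} (hF : ∀ k, 0 ≤ F k)
    {p : ℝ} (hp : 1 ≤ p) (hf : ∀ k, ‖f (hR.eigenvalues k)‖ ≤ F k ^ (1 - 1 / p))
    (M : Matrix n m ℂ) :
    ‖(A * fc hR f * B * M).trace‖ ≤ (∑ k, F k) ^ (1 - 1 / p) * snorm p M := by
  have h2 := posSemidef_conjTranspose_mul_self M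
  have h := norm_trace_contr_le hA (hB.mul (isContr_polar M)) hR h2.1 f
    (fun x => (sp (1 / 2) x : ℂ)) hF hp hf
  rw [← spow_eq_fc, ← Matrix.mul_assoc (A * fc hR f), Matrix.mul_assoc (A * fc hR f * B),
    polar_mul] at h
  refine h.trans (le_of_eq ?_)
  rw [snorm, trpow_mul_conjTranspose, trpow_eq_sum h2.1]
  congr 2
  refine Finset.sum_congr rfl fun j _ => ?_
  have hj := h2.eigenvalues_nonneg j
  rw [Complex.norm_real, Real.norm_of_nonneg (sp_nonneg hj),
    ← sp_eq_rpow (by linarith : p ≠ 0), sp_sp hj]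
  ring_nf

/-- The norming functional of a matrix for the Schatten `p`-norm. -/
lemma trace_norming (M : Matrix n m ℂ) (p : ℝ) :
    (Mᴴ * spow (M * Mᴴ) (-1 / 2) * spow (M * Mᴴ) ((p - 1) / 2) * M).trace =
      (trpow (M * Mᴴ) (p / 2) : ℂ) := by
  have h1 := posSemidef_self_mul_conjTranspose M
  rw [← spow_trace h1.1, Matrix.mul_assoc Mᴴ, spow_mul h1, Matrix.mul_assoc, trace_mul_comm,
    Matrix.mul_assoc]
  nth_rw 2 [← spow_one h1]
  rw [spow_mul h1]
  ring_nf

/-- Closes duality arguments: testing a matrix against its own norming functional puts S = ‖·‖_p^p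
on both sides, and a power of S cancels. -/
lemma rpow_inv_le_of_le {S c p : ℝ} (hS : 0 ≤ S) (hc : 0 ≤ c) (hp : 0 < p)
    (h : S ≤ S ^ (1 - 1 / p) * c) : S ^ (1 / p) ≤ c := by
  rcases hS.eq_or_lt with h0 | h0
  · rw [← h0, Real.zero_rpow (by positivity)]; exact hc
  · rw [Real.rpow_sub h0, Real.rpow_one, div_mul_eq_mul_div, le_div_iff₀ (by positivity)] at h
    exact le_of_mul_le_mul_left h h0

lemma isContr_norming (M : Matrix n m ℂ) : IsContr (Mᴴ * spow (M * Mᴴ) (-1 / 2)) := by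
  have := isContr_polar Mᴴ
  rwa [conjTranspose_conjTranspose] at this

/-- Schatten norms do not increase under multiplication by contractions. -/
lemma snorm_contr_le {A : Matrix n n ℂ} {B : Matrix m m ℂ} (hA : IsContr A) (hB : IsContr B)
    (M : Matrix n m ℂ) {p : ℝ} (hp : 1 ≤ p) : snorm p (A * M * B) ≤ snorm p M := by
  set N := A * M * B with hN
  have hp0 : 0 < p := by linarith
  have h1 := posSemidef_self_mul_conjTranspose N
  -- The product N = AMB is tested against its own norming functional; cyclicity attaches A and B to
  -- that functional, leaving M alone in the norm.
  have h := norm_trace_le_snorm (hB.mul (isContr_norming N)) hA h1.1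
    (fun x => (sp ((p - 1) / 2) x : ℂ)) (F := fun k => sp (p / 2) (h1.1.eigenvalues k))
    (fun k => sp_nonneg (h1.eigenvalues_nonneg k)) hp (fun k => by
      have hk := h1.eigenvalues_nonneg k
      rw [Complex.norm_real, Real.norm_of_nonneg (sp_nonneg hk)]
      rcases hk.eq_or_lt with h0 | h0
      · rw [← h0, sp_zero, sp_zero]; positivity
      · rw [sp_of_ne h0.ne', sp_of_ne h0.ne', ← Real.rpow_mul hk]
        apply le_of_eq
        congr 1
        field_simp) M
  rw [← spow_eq_fc, ← trpow_eq_sum] at h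
  have e : (B * (Nᴴ * spow (N * Nᴴ) (-1 / 2)) * spow (N * Nᴴ) ((p - 1) / 2) * A * M).trace =
      (trpow (N * Nᴴ) (p / 2) : ℂ) := by
    rw [← trace_norming]
    simp only [Matrix.mul_assoc]
    rw [trace_mul_comm]
    simp only [Matrix.mul_assoc, hN]
  rw [e, Complex.norm_real, Real.norm_of_nonneg (trpow_nonneg h1 _)] at h
  exact rpow_inv_le_of_le (trpow_nonneg h1 _) (snorm_nonneg _ _) hp0 h

end Holder

/-! ### Complex powers and interpolation of Schatten norms by the three lines theorem. -/

section Interpolation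

variable {n m l : Type*} [Fintype n] [DecidableEq n] [Fintype m] [DecidableEq m]
  [Fintype l] [DecidableEq l]

/-- Complex powers with value `0` at `0`. -/
def cp (z : ℂ) (x : ℝ) : ℂ := if x = 0 then 0 else (x : ℂ) ^ z

lemma cp_zero (z : ℂ) : cp z 0 = 0 := if_pos rfl

lemma cp_of_ne (z : ℂ) {x : ℝ} (hx : x ≠ 0) : cp z x = (x : ℂ) ^ z := if_neg hx

lemma cp_mul (z w : ℂ) (x : ℝ) : cp z x * cp w x = cp (z + w) x := by
  by_cases h : x = 0
  · simp [h, cp_zero]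
  · rw [cp_of_ne _ h, cp_of_ne _ h, cp_of_ne _ h, Complex.cpow_add _ _ (by exact_mod_cast h)]

lemma cp_ofReal (s : ℝ) {x : ℝ} (hx : 0 ≤ x) : cp (s : ℂ) x = (sp s x : ℂ) := by
  by_cases h : x = 0
  · simp [h, cp_zero, sp_zero]
  · rw [cp_of_ne _ h, sp_of_ne h, Complex.ofReal_cpow hx]

lemma norm_cp (z : ℂ) {x : ℝ} (hx : 0 ≤ x) : ‖cp z x‖ = sp z.re x := by
  rcases hx.eq_or_lt with h | h
  · simp [← h, cp_zero, sp_zero]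
  · rw [cp_of_ne _ h.ne', sp_of_ne h.ne', Complex.norm_cpow_eq_rpow_re_of_pos h]

lemma differentiable_cp {e : ℂ → ℂ} (he : Differentiable ℂ e) (x : ℝ) :
    Differentiable ℂ fun z => cp (e z) x := by
  by_cases h : x = 0
  · simp [h, cp_zero]
  · simp only [cp_of_ne _ h]
    intro z
    exact (he z).const_cpow (Or.inl (by exact_mod_cast h))

/-- Matrix valued functions whose entries are entire and bounded on the closed unit strip. -/
def StripRegular (M : ℂ → Matrix n m ℂ) : Prop :=
  ∀ i j, Differentiable ℂ (fun z => M z i j) ∧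
    ∃ C : ℝ, ∀ z : ℂ, z.re ∈ Set.Icc (0 : ℝ) 1 → ‖M z i j‖ ≤ C

lemma StripRegular.const (M : Matrix n m ℂ) : StripRegular fun _ => M :=
  fun i j => ⟨differentiable_const _, ‖M i j‖, fun _ _ => le_rfl⟩

lemma StripRegular.mul {M : ℂ → Matrix n m ℂ} {N : ℂ → Matrix m l ℂ} (hM : StripRegular M)
    (hN : StripRegular N) : StripRegular fun z => M z * N z := by
  intro i j
  refine ⟨?_, ?_⟩
  · simp only [mul_apply]
    exact Differentiable.fun_sum fun k _ => (hM i k).1.mul (hN k j).1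
  · choose C hC using fun k => (hM i k).2
    choose D hD using fun k => (hN k j).2
    refine ⟨∑ k, C k * D k, fun z hz => ?_⟩
    dsimp only
    rw [mul_apply]
    refine (norm_sum_le _ _).trans (Finset.sum_le_sum fun k _ => ?_)
    rw [norm_mul]
    exact mul_le_mul (hC k z hz) (hD k z hz) (norm_nonneg _) ((norm_nonneg _).trans (hC k z hz))

lemma stripRegular_fc_cp {H : Matrix n n ℂ} (hH : H.PosSemidef) (u v : ℝ) :
    StripRegular fun z => fc hH.1 (cp (u + v * z)) := by
  unfold fc
  refine ((StripRegular.const _).mul ?_).mul (StripRegular.const _)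
  intro i j
  by_cases h : i = j
  · subst h
    simp only [diagonal_apply_eq]
    refine ⟨differentiable_cp (by fun_prop) _, ?_⟩
    have hx := hH.eigenvalues_nonneg i
    set x := hH.1.eigenvalues i
    by_cases h0 : x = 0
    · exact ⟨0, fun z _ => by rw [h0, cp_zero, norm_zero]⟩
    · obtain ⟨C, hC⟩ := isCompact_Icc.exists_bound_of_continuousOn (s := Set.Icc (0 : ℝ) 1)
        (f := fun t => x ^ (u + v * t)) (by
          apply Continuous.continuousOn
          exact Continuous.rpow continuous_const (by fun_prop) fun _ => Or.inl h0)
      refine ⟨C, fun z hz => ?_⟩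
      rw [norm_cp _ hx, sp_of_ne h0]
      have := hC z.re hz
      simp only [Complex.add_re, Complex.ofReal_re, Complex.mul_re, Complex.ofReal_im, zero_mul,
        sub_zero]
      exact (le_abs_self _).trans this
  · simp only [diagonal_apply_ne _ h]
    exact ⟨differentiable_const _, 0, fun _ _ => by simp⟩

lemma StripRegular.trace {M : ℂ → Matrix n n ℂ} (hM : StripRegular M) :
    Differentiable ℂ (fun z => (M z).trace) ∧
      ∃ C : ℝ, ∀ z : ℂ, z.re ∈ Set.Icc (0 : ℝ) 1 → ‖(M z).trace‖ ≤ C := by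
  refine ⟨?_, ?_⟩
  · unfold Matrix.trace
    exact Differentiable.fun_sum fun k _ => (hM k k).1
  · choose C hC using fun k => (hM k k).2
    refine ⟨∑ k, C k, fun z hz => ?_⟩
    exact (norm_sum_le _ _).trans (Finset.sum_le_sum fun k _ => hC k z hz)

lemma fc_cp_add {H : Matrix n n ℂ} (hH : H.IsHermitian) (z w : ℂ) :
    fc hH (cp (z + w)) = fc hH (cp z) * fc hH (cp w) := by
  rw [fc_mul]
  exact fc_congr _ fun i => (cp_mul _ _ _).symm

lemma fc_cp_ofReal {H : Matrix n n ℂ} (hH : H.PosSemidef) (s : ℝ) :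
    fc hH.1 (cp (s : ℂ)) = spow H s := by
  rw [spow_eq_fc hH.1]
  exact fc_congr _ fun i => cp_ofReal _ (hH.eigenvalues_nonneg i)

lemma isContr_fc_cp {H : Matrix n n ℂ} (hH : H.PosSemidef) {z : ℂ} (hz : z.re = 0) :
    IsContr (fc hH.1 (cp z)) := by
  refine isContr_fc _ fun i => ?_
  rw [norm_cp _ (hH.eigenvalues_nonneg i), hz]
  unfold sp
  split_ifs <;> simp

/-- Complex interpolation of Schatten norms. -/
theorem snorm_interp {P : Matrix n n ℂ} {Q : Matrix m m ℂ} (hP : P.PosSemidef)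
    (hQ : Q.PosSemidef) (X : Matrix n m ℂ) {p p₀ p₁ t : ℝ} (hp : 1 ≤ p) (hp₀ : 1 ≤ p₀)
    (hp₁ : 1 ≤ p₁) (ht0 : 0 ≤ t) (ht1 : t ≤ 1) (hpt : 1 / p = (1 - t) / p₀ + t / p₁) :
    snorm p (spow P t * X * spow Q t) ≤
      snorm p₀ X ^ (1 - t) * snorm p₁ (P * X * Q) ^ t := by
  set F := spow P t * X * spow Q t with hF
  have hpp : 0 < p := by linarith
  have hpp₀ : 0 < p₀ := by linarith
  have hpp₁ : 0 < p₁ := by linarith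
  have hR := posSemidef_self_mul_conjTranspose F
  set S := trpow (F * Fᴴ) (p / 2) with hS
  have hS0 : 0 ≤ S := trpow_nonneg hR _
  -- The affine exponent u + vz has real part (p/2)(1 - 1/p₀) on Re z = 0 and (p/2)(1 - 1/p₁) on Re
  -- z = 1, the norming exponents dual to p₀ and p₁. At z = t it equals (p - 1)/2, the norming
  -- exponent of F itself.
  set u := p / 2 * (1 - 1 / p₀) with hu
  set v := p / 2 * (1 / p₀ - 1 / p₁) with hv
  set V := Fᴴ * spow (F * Fᴴ) (-1 / 2) with hV
  have hVc : IsContr V := isContr_norming F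
  set G : ℂ → Matrix m m ℂ := fun z =>
    V * fc hR.1 (cp (u + v * z)) * fc hP.1 (cp z) * X * fc hQ.1 (cp z) with hG
  have hreg : StripRegular G := by
    have hQr : StripRegular fun z => fc hQ.1 (cp z) := by
      simpa using stripRegular_fc_cp hQ 0 1
    have hPr : StripRegular fun z => fc hP.1 (cp z) := by
      simpa using stripRegular_fc_cp hP 0 1
    exact ((((StripRegular.const V).mul (stripRegular_fc_cp hR u v)).mul hPr).mul
      (StripRegular.const X)).mul hQr
  obtain ⟨hd, C, hC⟩ := hreg.trace
  have edge : ∀ (z : ℂ) (q : ℝ), 1 ≤ q → (u + v * z).re = p / 2 * (1 - 1 / q) →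
      ∀ k, ‖cp (u + v * z) (hR.1.eigenvalues k)‖ ≤
        sp (p / 2) (hR.1.eigenvalues k) ^ (1 - 1 / q) := by
    intro z q hq hz k
    have hk := hR.eigenvalues_nonneg k
    rw [norm_cp _ hk, hz]
    rcases hk.eq_or_lt with h0 | h0
    · rw [← h0, sp_zero, sp_zero]; positivity
    · rw [sp_of_ne h0.ne', sp_of_ne h0.ne', ← Real.rpow_mul hk]
  have hF0 : ∀ k, 0 ≤ sp (p / 2) (hR.1.eigenvalues k) :=
    fun k => sp_nonneg (hR.eigenvalues_nonneg k)
  have ha : ∀ z ∈ Complex.re ⁻¹' {(0 : ℝ)}, ‖(G z).trace‖ ≤ S ^ (1 - 1 / p₀) * snorm p₀ X := by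
    intro z hz
    have hz' : z.re = 0 := hz
    have h := norm_trace_le_snorm ((isContr_fc_cp hQ hz').mul hVc) (isContr_fc_cp hP hz') hR.1
      (cp (u + v * z)) hF0 hp₀ (edge z p₀ hp₀ (by simp [hz', hu])) X
    rw [← trpow_eq_sum, ← hS] at h
    convert h using 2
    simp only [hG, Matrix.mul_assoc]
    rw [trace_mul_comm (fc _ (cp z))]
    simp only [Matrix.mul_assoc]
  have hb : ∀ z ∈ Complex.re ⁻¹' {(1 : ℝ)},
      ‖(G z).trace‖ ≤ S ^ (1 - 1 / p₁) * snorm p₁ (P * X * Q) := by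
    intro z hz
    have hz' : z.re = 1 := hz
    have hz1 : (z - 1).re = 0 := by simp [hz']
    have h := norm_trace_le_snorm ((isContr_fc_cp hQ hz1).mul hVc) (isContr_fc_cp hP hz1) hR.1
      (cp (u + v * z)) hF0 hp₁ (edge z p₁ hp₁ (by simp [hz', hu, hv]; ring)) (P * X * Q)
    rw [← trpow_eq_sum, ← hS] at h
    convert h using 2
    -- On Re z = 1 one full power of P and Q is split off to form PXQ; the remaining powers have
    -- exponent of real part 0 and are contractions even when P or Q is singular.
    have eP : fc hP.1 (cp z) = fc hP.1 (cp (z - 1)) * P := by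
      have e : fc hP.1 (cp (1 : ℝ)) = P := (fc_cp_ofReal hP 1).trans (spow_one hP)
      calc fc hP.1 (cp z) = fc hP.1 (cp (z - 1 + (1 : ℝ))) := by simp
        _ = _ := by rw [fc_cp_add, e]
    have eQ : fc hQ.1 (cp z) = Q * fc hQ.1 (cp (z - 1)) := by
      have e : fc hQ.1 (cp (1 : ℝ)) = Q := (fc_cp_ofReal hQ 1).trans (spow_one hQ)
      calc fc hQ.1 (cp z) = fc hQ.1 (cp ((1 : ℝ) + (z - 1))) := by simp
        _ = _ := by rw [fc_cp_add, e]
    simp only [hG]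
    rw [eP, eQ]
    simp only [Matrix.mul_assoc]
    rw [trace_mul_comm (fc hQ.1 (cp (z - 1)))]
    simp only [Matrix.mul_assoc]
  have h3 := Complex.HadamardThreeLines.norm_le_interp_of_mem_verticalClosedStrip₀₁'
    (fun z => (G z).trace) (z := (t : ℂ)) (a := S ^ (1 - 1 / p₀) * snorm p₀ X)
    (b := S ^ (1 - 1 / p₁) * snorm p₁ (P * X * Q))
    (by simpa [Complex.HadamardThreeLines.verticalClosedStrip] using ⟨ht0, ht1⟩)
    hd.diffContOnCl
    ⟨C, by
      rintro _ ⟨z, hz, rfl⟩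
      exact hC z hz⟩ ha hb
  have hGt : (G t).trace = (S : ℂ) := by
    have e1 : (u + v * (t : ℂ)) = (((p - 1) / 2 : ℝ) : ℂ) := by
      have : u + v * t = (p - 1) / 2 := by
        have h1 : u + v * t = p / 2 * (1 - 1 / p) := by rw [hpt, hu, hv]; ring
        rw [h1]; field_simp
      rw [← this]; push_cast; rfl
    simp only [hG]
    rw [e1, fc_cp_ofReal hR, fc_cp_ofReal hP, fc_cp_ofReal hQ, hS, ← trace_norming]
    simp only [hV, hF, Matrix.mul_assoc]
  simp only [hGt, Complex.norm_real, Real.norm_of_nonneg hS0, Complex.ofReal_re] at h3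
  refine rpow_inv_le_of_le hS0 (by
    have := snorm_nonneg p₀ X
    have := snorm_nonneg p₁ (P * X * Q)
    positivity) hpp (h3.trans (le_of_eq ?_))
  have hz : ∀ q : ℝ, 1 ≤ q → 0 ≤ 1 - 1 / q := fun q hq => by
    rw [sub_nonneg, div_le_one (by linarith)]; exact hq
  rw [Real.mul_rpow (by positivity) (snorm_nonneg _ _),
    Real.mul_rpow (by positivity) (snorm_nonneg _ _), ← Real.rpow_mul hS0, ← Real.rpow_mul hS0]
  have : S ^ (1 - 1 / p) = S ^ ((1 - 1 / p₀) * (1 - t)) * S ^ ((1 - 1 / p₁) * t) := by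
    rw [← Real.rpow_add_of_nonneg hS0 (mul_nonneg (hz _ hp₀) (by linarith))
      (mul_nonneg (hz _ hp₁) ht0), hpt]
    congr 1; ring
  rw [this]; ring

end Interpolation

/-! ### Variational formulas for traces of powers. -/

section Variational

variable {n m : Type*} [Fintype n] [DecidableEq n] [Fintype m] [DecidableEq m]

lemma trace_fc_mul {K T : Matrix n n ℂ} (hK : K.IsHermitian) (hT : T.IsHermitian) (f : ℝ → ℝ) :
    (fc hK (fun x => (f x : ℂ)) * T).trace.re = ∑ x : n × n,
      overlap hK hT 1 x.1 x.2 * f (hK.eigenvalues x.1) * hT.eigenvalues x.2 := by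
  have h := trace_fc_mul_fc hK hT 1 (fun x => (f x : ℂ)) (fun x => (x : ℂ))
  rw [fc_id, Matrix.mul_one, conjTranspose_one, Matrix.mul_one] at h
  rw [h, ← Fintype.sum_prod_type']
  rw [Complex.re_sum]
  refine Finset.sum_congr rfl fun x _ => ?_
  rw [← Complex.ofReal_mul, ← Complex.ofReal_mul, Complex.ofReal_re]
  ring

lemma trace_spow_mul {K T : Matrix n n ℂ} (hK : K.IsHermitian) (hT : T.IsHermitian) (s : ℝ) :
    (spow K s * T).trace.re = ∑ x : n × n,
      overlap hK hT 1 x.1 x.2 * sp s (hK.eigenvalues x.1) * hT.eigenvalues x.2 := by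
  rw [spow_eq_fc hK, trace_fc_mul]

lemma sum_overlap_fst {K T : Matrix n n ℂ} (hK : K.IsHermitian) (hT : T.IsHermitian) (F : n → ℝ) :
    ∑ x : n × n, overlap hK hT 1 x.1 x.2 * F x.1 = ∑ i, F i := by
  rw [Fintype.sum_prod_type]
  refine Finset.sum_congr rfl fun i _ => ?_
  dsimp only
  rw [← Finset.sum_mul, overlap_sum_right hK hT (by simp), one_mul]

lemma sum_overlap_snd {K T : Matrix n n ℂ} (hK : K.IsHermitian) (hT : T.IsHermitian) (F : n → ℝ) :
    ∑ x : n × n, overlap hK hT 1 x.1 x.2 * F x.2 = ∑ i, F i := by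
  rw [Fintype.sum_prod_type_right]
  refine Finset.sum_congr rfl fun i _ => ?_
  dsimp only
  rw [← Finset.sum_mul, overlap_sum_left hK hT (by simp), one_mul]

lemma re_trace_eq_sum {K : Matrix n n ℂ} (hK : K.PosSemidef) :
    K.trace.re = ∑ i, hK.1.eigenvalues i := by
  rw [← trpow_one hK, trpow_eq_sum hK.1]
  simp only [sp_one]

/-- Hölder's inequality in variational form, exponents `0 < s < 1`. -/
lemma trace_spow_mul_le {K T : Matrix n n ℂ} (hK : K.PosSemidef) (hT : T.PosSemidef)
    (hK1 : K.trace.re ≤ 1) {s : ℝ} (hs0 : 0 < s) (hs1 : s < 1) :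
    (spow K s * T).trace.re ≤ trpow T (1 / (1 - s)) ^ (1 - s) := by
  have hp : 1 / (1 - s) ≠ 0 := by
    have : 0 < 1 - s := by linarith
    positivity
  have h := weighted_holder (c := fun x : n × n => overlap hK.1 hT.1 1 x.1 x.2)
    (F := fun x => hK.1.eigenvalues x.1) (G := fun x => hT.1.eigenvalues x.2)
    (fun x => overlap_nonneg _ _ _ _ _) (fun x => hK.eigenvalues_nonneg _)
    (fun x => hT.eigenvalues_nonneg _) hs0.le hs1
  rw [sum_overlap_fst hK.1 hT.1 hK.1.eigenvalues,
    sum_overlap_snd hK.1 hT.1 (fun j => hT.1.eigenvalues j ^ (1 / (1 - s))),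
    ← re_trace_eq_sum hK] at h
  rw [trace_spow_mul hK.1 hT.1, trpow_eq_sum hT.1]
  simp only [sp_eq_rpow hs0.ne', sp_eq_rpow hp]
  refine h.trans (mul_le_of_le_one_left (Real.rpow_nonneg ?_ _) (Real.rpow_le_one ?_ hK1 hs0.le))
  · exact Finset.sum_nonneg fun i _ => Real.rpow_nonneg (hT.eigenvalues_nonneg i) _
  · rw [re_trace_eq_sum hK]; exact Finset.sum_nonneg fun i _ => hK.eigenvalues_nonneg i

/-- With T supported inside K, tr T - tr(K^0 T) is zero and is also a sum of nonnegative overlap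
terms, so each term vanishes. -/
lemma overlap_mul_eq_zero {K T : Matrix n n ℂ} (hK : K.PosSemidef) (hT : T.PosSemidef)
    (hKT : T * spow K 0 = T) {x : n × n} (hx : hK.1.eigenvalues x.1 = 0) :
    overlap hK.1 hT.1 1 x.1 x.2 * hT.1.eigenvalues x.2 = 0 := by
  have hKT' : spow K 0 * T = T := by
    have := congrArg conjTranspose hKT
    rwa [conjTranspose_mul, hT.1.eq, (spow_isHermitian hK 0).eq] at this
  have h1 := trace_spow_mul hK.1 hT.1 0
  rw [hKT', re_trace_eq_sum hT, ← sum_overlap_snd hK.1 hT.1 hT.1.eigenvalues, ← sub_eq_zero,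
    ← Finset.sum_sub_distrib] at h1
  have h2 : ∀ y : n × n, overlap hK.1 hT.1 1 y.1 y.2 * hT.1.eigenvalues y.2 -
      overlap hK.1 hT.1 1 y.1 y.2 * sp 0 (hK.1.eigenvalues y.1) * hT.1.eigenvalues y.2 =
      overlap hK.1 hT.1 1 y.1 y.2 * hT.1.eigenvalues y.2 *
        (1 - sp 0 (hK.1.eigenvalues y.1)) := fun y => by ring
  simp only [h2] at h1
  rw [Finset.sum_eq_zero_iff_of_nonneg] at h1
  · simpa [hx, sp_zero] using h1 x (Finset.mem_univ _)
  · intro y _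
    refine mul_nonneg (mul_nonneg (overlap_nonneg _ _ _ _ _) (hT.eigenvalues_nonneg _)) ?_
    unfold sp
    split_ifs <;> simp

/-- The reverse Hölder inequality in variational form, exponents `s < 0`. -/
lemma le_trace_spow_mul {K T : Matrix n n ℂ} (hK : K.PosSemidef) (hT : T.PosSemidef)
    (hK1 : K.trace.re ≤ 1) (hKT : T * spow K 0 = T) {s : ℝ} (hs : s < 0) :
    trpow T (1 / (1 - s)) ^ (1 - s) ≤ (spow K s * T).trace.re := by
  have h1s : 0 < 1 - s := by linarith
  set q := 1 / (1 - s) with hq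
  have hq0 : 0 < q := by positivity
  have hq1 : q < 1 := by rw [hq, div_lt_one h1s]; linarith
  have hqs : q * (1 - s) = 1 := by rw [hq]; field_simp
  have hW0 : ∀ x : n × n, 0 ≤ sp s (hK.1.eigenvalues x.1) * hT.1.eigenvalues x.2 :=
    fun x => mul_nonneg (sp_nonneg (hK.eigenvalues_nonneg _)) (hT.eigenvalues_nonneg _)
  -- With k, t the eigenvalues of K and T, Hölder is applied to t^q = k^{1-q} (k^s t)^q, valid for k
  -- > 0 because 1 - q + sq = 0. The support hypothesis handles k = 0.
  have h := weighted_holder (c := fun x : n × n => overlap hK.1 hT.1 1 x.1 x.2)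
    (F := fun x => hK.1.eigenvalues x.1)
    (G := fun x => (sp s (hK.1.eigenvalues x.1) * hT.1.eigenvalues x.2) ^ q)
    (fun x => overlap_nonneg _ _ _ _ _) (fun x => hK.eigenvalues_nonneg _)
    (fun x => Real.rpow_nonneg (hW0 x) _) (s := 1 - q) (by linarith) (by linarith)
  rw [sum_overlap_fst hK.1 hT.1 hK.1.eigenvalues, ← re_trace_eq_sum hK, sub_sub_cancel] at h
  have e1 : ∑ x : n × n, overlap hK.1 hT.1 1 x.1 x.2 *
      ((sp s (hK.1.eigenvalues x.1) * hT.1.eigenvalues x.2) ^ q) ^ (1 / q) =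
      (spow K s * T).trace.re := by
    rw [trace_spow_mul hK.1 hT.1]
    refine Finset.sum_congr rfl fun x _ => ?_
    rw [← Real.rpow_mul (hW0 x), mul_one_div_cancel hq0.ne', Real.rpow_one, mul_assoc]
  have e2 : ∑ x : n × n, overlap hK.1 hT.1 1 x.1 x.2 * hK.1.eigenvalues x.1 ^ (1 - q) *
      (sp s (hK.1.eigenvalues x.1) * hT.1.eigenvalues x.2) ^ q = trpow T q := by
    rw [trpow_eq_sum hT.1, ← sum_overlap_snd hK.1 hT.1]
    refine Finset.sum_congr rfl fun x _ => ?_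
    have hk := hK.eigenvalues_nonneg x.1
    have ht := hT.eigenvalues_nonneg x.2
    rw [sp_eq_rpow hq0.ne']
    rcases hk.eq_or_lt with h0 | h0
    · have := overlap_mul_eq_zero hK hT hKT h0.symm
      rcases mul_eq_zero.1 this with h3 | h3
      · rw [h3]; ring
      · rw [h3, mul_zero, Real.zero_rpow hq0.ne']; ring
    · rw [sp_of_ne h0.ne', Real.mul_rpow (Real.rpow_nonneg hk _) ht, ← Real.rpow_mul hk]
      have : hK.1.eigenvalues x.1 ^ (1 - q) * hK.1.eigenvalues x.1 ^ (s * q) = 1 := by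
        rw [← Real.rpow_add h0, show 1 - q + s * q = 0 by linarith, Real.rpow_zero]
      calc _ = overlap hK.1 hT.1 1 x.1 x.2 * (hK.1.eigenvalues x.1 ^ (1 - q) *
          hK.1.eigenvalues x.1 ^ (s * q)) * hT.1.eigenvalues x.2 ^ q := by ring
        _ = _ := by rw [this, mul_one]
  rw [e1, e2] at h
  have hWt : 0 ≤ (spow K s * T).trace.re := by
    rw [← e1]
    exact Finset.sum_nonneg fun x _ => mul_nonneg (overlap_nonneg _ _ _ _ _)
      (Real.rpow_nonneg (Real.rpow_nonneg (hW0 x) _) _)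
  have hKn : 0 ≤ K.trace.re := by
    rw [re_trace_eq_sum hK]; exact Finset.sum_nonneg fun i _ => hK.eigenvalues_nonneg i
  have h2 : trpow T q ≤ (spow K s * T).trace.re ^ q :=
    h.trans (mul_le_of_le_one_left (Real.rpow_nonneg hWt _)
      (Real.rpow_le_one hKn hK1 (by linarith)))
  calc trpow T q ^ (1 - s) ≤ ((spow K s * T).trace.re ^ q) ^ (1 - s) :=
        Real.rpow_le_rpow (trpow_nonneg hT _) h2 h1s.le
    _ = _ := by rw [← Real.rpow_mul hWt, hqs, Real.rpow_one]

/-- The variational inequality for exponents `s > 1`. -/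
lemma one_le_mul_trace_spow_mul {K Z : Matrix n n ℂ} (hK : K.PosSemidef) (hZ : Z.PosSemidef)
    (hK1 : K.trace.re = 1) (hZ0 : ∀ i, 0 < hZ.1.eigenvalues i) {s : ℝ} (hs : 1 < s) :
    1 ≤ trpow Z (-1 / (s - 1)) ^ (s - 1) * (spow K s * Z).trace.re := by
  have hs0 : 0 < s := by linarith
  have hs1 : 0 < s - 1 := by linarith
  set q := 1 / s with hq
  have hq0 : 0 < q := by positivity
  have hqs : q * s = 1 := by rw [hq]; field_simp
  have hq1 : q < 1 := by rw [hq, div_lt_one hs0]; exact hs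
  -- The powers of the eigenvalue of Z are chosen to cancel in F^{1-q} G, leaving the eigenvalue of
  -- K, whose weighted sum is tr K = 1.
  set F : n × n → ℝ := fun x => sp (-1 / (s - 1)) (hZ.1.eigenvalues x.2) with hF
  set G : n × n → ℝ := fun x => hK.1.eigenvalues x.1 * hZ.1.eigenvalues x.2 ^ q with hG
  have hG0 : ∀ x, 0 ≤ G x := fun x => mul_nonneg (hK.eigenvalues_nonneg _)
    (Real.rpow_nonneg (hZ0 _).le _)
  have h := weighted_holder (c := fun x : n × n => overlap hK.1 hZ.1 1 x.1 x.2)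
    (F := F) (G := G) (fun x => overlap_nonneg _ _ _ _ _) (fun x => sp_nonneg (hZ0 _).le)
    hG0 (s := 1 - q) (by linarith) (by linarith)
  rw [sum_overlap_snd hK.1 hZ.1 (fun j => sp (-1 / (s - 1)) (hZ.1.eigenvalues j)),
    ← trpow_eq_sum, sub_sub_cancel] at h
  have e1 : ∑ x : n × n, overlap hK.1 hZ.1 1 x.1 x.2 * G x ^ (1 / q) =
      (spow K s * Z).trace.re := by
    rw [trace_spow_mul hK.1 hZ.1]
    refine Finset.sum_congr rfl fun x _ => ?_
    rw [hG, Real.mul_rpow (hK.eigenvalues_nonneg _) (Real.rpow_nonneg (hZ0 _).le _),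
      ← Real.rpow_mul (hZ0 _).le, mul_one_div_cancel hq0.ne', Real.rpow_one, sp_eq_rpow hs0.ne',
      hq, one_div_one_div, mul_assoc]
  have e2 : ∑ x : n × n, overlap hK.1 hZ.1 1 x.1 x.2 * F x ^ (1 - q) * G x = 1 := by
    refine Eq.trans ?_ ((sum_overlap_fst hK.1 hZ.1 hK.1.eigenvalues).trans
      ((re_trace_eq_sum hK).symm.trans hK1))
    refine Finset.sum_congr rfl fun x _ => ?_
    have hz := hZ0 x.2
    rw [hF, hG]
    dsimp only
    rw [sp_of_ne hz.ne']
    rw [← Real.rpow_mul hz.le]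
    have : hZ.1.eigenvalues x.2 ^ (-1 / (s - 1) * (1 - q)) * hZ.1.eigenvalues x.2 ^ q = 1 := by
      rw [← Real.rpow_add hz]
      have : -1 / (s - 1) * (1 - q) + q = 0 := by rw [hq]; field_simp; ring
      rw [this, Real.rpow_zero]
    calc _ = overlap hK.1 hZ.1 1 x.1 x.2 * hK.1.eigenvalues x.1 *
        (hZ.1.eigenvalues x.2 ^ (-1 / (s - 1) * (1 - q)) * hZ.1.eigenvalues x.2 ^ q) := by ring
      _ = _ := by rw [this, mul_one]
  rw [e1, e2] at h
  have hWt : 0 ≤ (spow K s * Z).trace.re := by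
    rw [← e1]
    exact Finset.sum_nonneg fun x _ => mul_nonneg (overlap_nonneg _ _ _ _ _)
      (Real.rpow_nonneg (hG0 x) _)
  have hN := trpow_nonneg hZ (-1 / (s - 1))
  have h2 := Real.one_le_rpow h hs0.le
  rw [Real.mul_rpow (Real.rpow_nonneg hN _) (Real.rpow_nonneg hWt _), ← Real.rpow_mul hN,
    ← Real.rpow_mul hWt, hqs, Real.rpow_one, show (1 - q) * s = s - 1 by linarith] at h2
  exact h2

/-- The optimizer of the variational expressions for `trpow`. -/
def optimizer (T : Matrix n n ℂ) (p : ℝ) : Matrix n n ℂ := (trpow T p)⁻¹ • spow T p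

lemma optimizer_posSemidef {T : Matrix n n ℂ} (hT : T.PosSemidef) (p : ℝ) :
    (optimizer T p).PosSemidef :=
  (spow_posSemidef hT p).smul (inv_nonneg.2 (trpow_nonneg hT p))

lemma optimizer_trace {T : Matrix n n ℂ} (hT : T.PosSemidef) (h0 : T ≠ 0) (p : ℝ) :
    (optimizer T p).trace = 1 := by
  rw [optimizer, trace_smul, spow_trace hT.1, Complex.real_smul, ← Complex.ofReal_mul,
    inv_mul_cancel₀ (trpow_pos hT h0 p).ne', Complex.ofReal_one]

lemma optimizer_isDensity {T : Matrix n n ℂ} (hT : T.PosSemidef) (h0 : T ≠ 0) (p : ℝ) :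
    IsDensity (optimizer T p) := ⟨optimizer_posSemidef hT p, optimizer_trace hT h0 p⟩

lemma spow_optimizer {T : Matrix n n ℂ} (hT : T.PosSemidef) (h0 : T ≠ 0) (p s : ℝ) :
    spow (optimizer T p) s = ((trpow T p)⁻¹) ^ s • spow T (p * s) := by
  rw [optimizer, spow_smul (spow_posSemidef hT p) (inv_pos.2 (trpow_pos hT h0 p)), spow_spow hT]

lemma spow_zero_optimizer {T : Matrix n n ℂ} (hT : T.PosSemidef) (h0 : T ≠ 0) (p : ℝ) :
    spow (optimizer T p) 0 = spow T 0 := by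
  rw [spow_optimizer hT h0, Real.rpow_zero, one_smul, mul_zero]

lemma trace_spow_optimizer {T : Matrix n n ℂ} (hT : T.PosSemidef) (h0 : T ≠ 0) {s : ℝ}
    (hs : s ≠ 1) : (spow (optimizer T (1 / (1 - s))) s * T).trace.re =
      trpow T (1 / (1 - s)) ^ (1 - s) := by
  have h1s : 1 - s ≠ 0 := sub_ne_zero.2 hs.symm
  have hN := trpow_pos hT h0 (1 / (1 - s))
  rw [spow_optimizer hT h0]
  nth_rw 3 [← spow_one hT]
  rw [Matrix.smul_mul, spow_mul hT, trace_smul, Complex.smul_re, ← trpow, smul_eq_mul,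
    show 1 / (1 - s) * s + 1 = 1 / (1 - s) by field_simp; ring, Real.inv_rpow hN.le,
    ← Real.rpow_neg hN.le, ← Real.rpow_add_one hN.ne', sub_eq_neg_add]

/-- The reverse Hölder inequality is almost attained by densities of full support. -/
lemma exists_full_trace_spow_mul_lt [Nonempty n] {T : Matrix n n ℂ} (hT : T.PosSemidef) {s v : ℝ}
    (hs : s < 0) (hv : trpow T (1 / (1 - s)) ^ (1 - s) < v) :
    ∃ K : Matrix n n ℂ, IsDensity K ∧ spow K 0 = 1 ∧ (spow K s * T).trace.re < v := by
  have h1s : 0 < 1 - s := by linarith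
  set p := 1 / (1 - s) with hp
  have hps : p * s + 1 = p := by rw [hp]; field_simp; ring
  set N := trpow T p with hN
  have hN0 : 0 ≤ N := trpow_nonneg hT p
  set d : ℝ := ((Fintype.card n : ℕ) : ℝ) with hd
  have hd0 : 0 < d := by rw [hd]; exact_mod_cast Fintype.card_pos
  have hlim : Filter.Tendsto (fun δ : ℝ => (N + d * δ) ^ (-s) * N) (nhdsWithin 0 (Set.Ioi 0))
      (nhds (N ^ (1 - s))) := by
    have hc : Continuous fun δ : ℝ => (N + d * δ) ^ (-s) * N :=
      (Continuous.rpow_const (by fun_prop) fun _ => Or.inr (by linarith)).mul continuous_const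
    have h0 := hc.tendsto 0
    have e : (N + d * 0) ^ (-s) * N = N ^ (1 - s) := by
      rw [mul_zero, add_zero, show 1 - s = -s + 1 by ring,
        Real.rpow_add_of_nonneg hN0 (by linarith) zero_le_one, Real.rpow_one]
    rw [e] at h0
    exact h0.mono_left nhdsWithin_le_nhds
  obtain ⟨δ, hδv, hδ⟩ := ((hlim.eventually (gt_mem_nhds hv)).and self_mem_nhdsWithin).exists
  have hδ : 0 < δ := hδ
  set c : ℝ := N + d * δ with hc
  have hc0 : 0 < c := by positivity
  -- The density is (T^p + δ)/c with c = tr T^p + dδ, a full-rank perturbation of the optimizer T^p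
  -- / tr T^p. Since s < 0, dropping δ from the numerator only increases the s-th power, and letting
  -- δ → 0 recovers the bound.
  set f : ℝ → ℝ := fun x => (sp p x + δ) / c with hf
  have hfpos : ∀ i, 0 < f (hT.1.eigenvalues i) := fun i => by
    have := sp_nonneg (s := p) (hT.eigenvalues_nonneg i)
    rw [hf]; positivity
  have hK : cfc f T = fc hT.1 (fun x => (f x : ℂ)) := cfc_eq_fc hT.1 f
  have hcomp : ∀ r, spow (cfc f T) r = fc hT.1 (fun x => ((sp r (f x) : ℝ) : ℂ)) := fun r => by
    rw [← cfc_eq_fc hT.1 (fun x => sp r (f x))]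
    exact (cfc_comp (sp r) f T hT.1
      (((Matrix.finite_real_spectrum).image _).continuousOn _) (finite_continuousOn _ _)).symm
  refine ⟨cfc f T, ⟨?_, ?_⟩, ?_, ?_⟩
  · rw [hK]
    exact fc_posSemidef _ fun i => by exact_mod_cast (hfpos i).le
  · rw [hK, fc_trace, ← Complex.ofReal_sum, hf]
    have : ∑ i, (sp p (hT.1.eigenvalues i) + δ) / c = 1 := by
      rw [← Finset.sum_div, Finset.sum_add_distrib, ← trpow_eq_sum hT.1, ← hN, Finset.sum_const,
        nsmul_eq_mul, Finset.card_univ, ← hd, ← hc, div_self hc0.ne']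
    rw [this, Complex.ofReal_one]
  · rw [hcomp, ← fc_one hT.1]
    refine fc_congr _ fun i => ?_
    rw [sp_of_ne (hfpos i).ne', Real.rpow_zero, Complex.ofReal_one]
  · refine lt_of_le_of_lt ?_ hδv
    have e : spow (cfc f T) s * T = fc hT.1 (fun x => ((sp s (f x) * x : ℝ) : ℂ)) := by
      rw [hcomp]
      calc _ = fc hT.1 (fun x => ((sp s (f x) : ℝ) : ℂ)) * fc hT.1 (fun x => (x : ℂ)) := by
            rw [fc_id]
        _ = _ := by
            rw [fc_mul]
            refine fc_congr _ fun i => ?_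
            push_cast
            rfl
    rw [e, fc_trace, ← Complex.ofReal_sum, Complex.ofReal_re, hN, trpow_eq_sum hT.1,
      Finset.mul_sum]
    refine Finset.sum_le_sum fun i _ => ?_
    have hi := hT.eigenvalues_nonneg i
    rcases hi.eq_or_lt with h0 | h0
    · rw [← h0, mul_zero, sp_zero, mul_zero]
    · rw [sp_of_ne (hfpos i).ne', sp_of_ne h0.ne']
      set t := hT.1.eigenvalues i
      have h1 : f t ^ s ≤ (t ^ p / c) ^ s := by
        refine Real.rpow_le_rpow_of_nonpos (by positivity) ?_ hs.le
        rw [hf]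
        dsimp only
        rw [sp_of_ne h0.ne']
        gcongr
        linarith
      have h2 : (t ^ p / c) ^ s * t = c ^ (-s) * t ^ p := by
        rw [Real.div_rpow (by positivity) hc0.le, ← Real.rpow_mul hi, Real.rpow_neg hc0.le]
        have h3 : t ^ p = t ^ (p * s) * t := by rw [← Real.rpow_add_one h0.ne', hps]
        rw [h3]
        ring
      rw [← h2]
      gcongr

end Variational

/-! ### Convex sets of matrix powers and the minimax theorem. -/

section Minimax

variable {n m : Type*} [Fintype n] [DecidableEq n] [Fintype m] [DecidableEq m]

/-- The set of powers `K ^ r`, `0 < r < 1`, of subnormalized `K`, in dual form. -/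
def powBall (n : Type*) [Fintype n] [DecidableEq n] (r : ℝ) : Set (Matrix n n ℂ) :=
  {Y | Y.PosSemidef ∧ ∀ K, IsDensity K → (spow K (1 - r) * Y).trace.re ≤ 1}

/-- The set of powers `K ^ (-r)`, `0 < r < 1`, of subnormalized `K` of full support, in dual
form. -/
def negPowSet (n : Type*) [Fintype n] [DecidableEq n] (r : ℝ) : Set (Matrix n n ℂ) :=
  {Z | Z.PosSemidef ∧ ∀ K, IsDensity K → 1 ≤ (spow K (1 + r) * Z).trace.re}

lemma re_trace_mul_combo (A Y Z : Matrix n n ℂ) (u v : ℝ) :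
    (A * (u • Y + v • Z)).trace.re = u * (A * Y).trace.re + v * (A * Z).trace.re := by
  simp only [Matrix.mul_add, Matrix.mul_smul, trace_add, trace_smul, Complex.add_re,
    Complex.smul_re, smul_eq_mul]

/-- The dual description makes the set an intersection of half-spaces with the positive cone, so
convexity needs no concavity property of the matrix power. -/
lemma convex_powBall (r : ℝ) : Convex ℝ (powBall n r) := by
  intro Y hY Z hZ u v hu hv huv
  refine ⟨(hY.1.smul hu).add (hZ.1.smul hv), fun K hK => ?_⟩
  rw [re_trace_mul_combo]
  nlinarith [hY.2 K hK, hZ.2 K hK]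

lemma convex_negPowSet (r : ℝ) : Convex ℝ (negPowSet n r) := by
  intro Y hY Z hZ u v hu hv huv
  refine ⟨(hY.1.smul hu).add (hZ.1.smul hv), fun K hK => ?_⟩
  rw [re_trace_mul_combo]
  nlinarith [hY.2 K hK, hZ.2 K hK]

lemma isClosed_posSemidef : IsClosed {Y : Matrix n n ℂ | Y.PosSemidef} := by
  have : {Y : Matrix n n ℂ | Y.PosSemidef} =
      {Y | Yᴴ = Y} ∩ ⋂ x : n → ℂ, {Y | 0 ≤ star x ⬝ᵥ (Y *ᵥ x)} := by
    ext Y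
    simp only [Set.mem_inter_iff, Set.mem_iInter, Set.mem_ofPred_eq,
      posSemidef_iff_dotProduct_mulVec]
    rfl
  rw [this]
  refine (isClosed_eq (by fun_prop) continuous_id).inter (isClosed_iInter fun x => ?_)
  exact isClosed_le continuous_const (by fun_prop)

/-- When the trace is nonzero, Y / tr Y has eigenvalues in [0, 1] and is a contraction, whose
entries have modulus at most 1. -/
lemma norm_entry_le_trace {Y : Matrix n n ℂ} (hY : Y.PosSemidef) (i j : n) :
    ‖Y i j‖ ≤ Y.trace.re := by
  have ht : Y.trace.re = ∑ i, hY.1.eigenvalues i := re_trace_eq_sum hY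
  have ht0 : 0 ≤ Y.trace.re := by
    rw [ht]; exact Finset.sum_nonneg fun i _ => hY.eigenvalues_nonneg i
  rcases ht0.eq_or_lt with h0 | h0
  · have : Y = 0 := by
      rw [← hY.trace_eq_zero_iff]
      have h1 := spow_trace hY.1 1
      rw [spow_one hY] at h1
      rw [h1, trpow_one hY, ← h0, Complex.ofReal_zero]
    simp [this]
  · have hc : IsContr (fc hY.1 (fun x => ((x / Y.trace.re : ℝ) : ℂ))) := by
      refine isContr_fc _ fun k => ?_
      have hk := hY.eigenvalues_nonneg k
      rw [Complex.norm_real, Real.norm_of_nonneg (by positivity), div_le_one h0, ht]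
      exact Finset.single_le_sum (f := hY.1.eigenvalues)
        (fun i _ => hY.eigenvalues_nonneg i) (Finset.mem_univ k)
    have e : Y = (Y.trace.re : ℂ) • fc hY.1 (fun x => ((x / Y.trace.re : ℝ) : ℂ)) := by
      have h1 : (Y.trace.re : ℂ) • fc hY.1 (fun x => ((x / Y.trace.re : ℝ) : ℂ)) =
          fc hY.1 (fun _ => (Y.trace.re : ℂ)) * fc hY.1 (fun x => ((x / Y.trace.re : ℝ) : ℂ)) := by
        have : fc hY.1 (fun _ => (Y.trace.re : ℂ)) = (Y.trace.re : ℂ) • (1 : Matrix n n ℂ) := by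
          rw [← fc_one hY.1]
          unfold fc
          have : diagonal (fun _ : n => (Y.trace.re : ℂ)) =
              (Y.trace.re : ℂ) • diagonal (fun _ : n => (1 : ℂ)) := by
            rw [← diagonal_smul]; congr 1; ext; simp
          rw [this, Matrix.mul_smul, Matrix.smul_mul]
        rw [this, Matrix.smul_mul, Matrix.one_mul]
      rw [h1, fc_mul]
      nth_rw 1 [← fc_id hY.1]
      refine fc_congr _ fun i => ?_
      rw [← Complex.ofReal_mul, mul_div_cancel₀ _ h0.ne']
    have h2 : ‖fc hY.1 (fun x => ((x / Y.trace.re : ℝ) : ℂ)) i j‖ ≤ 1 := by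
      have h3 := hc.sum_row i
      have h4 := Finset.single_le_sum
        (f := fun k => ‖fc hY.1 (fun x => ((x / Y.trace.re : ℝ) : ℂ)) i k‖ ^ 2)
        (fun k _ => by positivity) (Finset.mem_univ j)
      have h5 : ‖fc hY.1 (fun x => ((x / Y.trace.re : ℝ) : ℂ)) i j‖ ^ 2 ≤ 1 := h4.trans h3
      have h6 := norm_nonneg (fc hY.1 (fun x => ((x / Y.trace.re : ℝ) : ℂ)) i j)
      nlinarith
    have h7 : ‖Y i j‖ = Y.trace.re * ‖fc hY.1 (fun x => ((x / Y.trace.re : ℝ) : ℂ)) i j‖ := by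
      conv_lhs => rw [e, Matrix.smul_apply, smul_eq_mul, norm_mul, Complex.norm_real,
        Real.norm_of_nonneg ht0]
    rw [h7]
    nlinarith

lemma isDensity_maxMixed (n : Type*) [Fintype n] [DecidableEq n] [Nonempty n] :
    IsDensity ((Fintype.card n : ℝ)⁻¹ • (1 : Matrix n n ℂ)) := by
  have hd : (0 : ℝ) < Fintype.card n := by exact_mod_cast Fintype.card_pos
  refine ⟨PosSemidef.one.smul (by positivity), ?_⟩
  rw [trace_smul, trace_one, Complex.real_smul, Complex.ofReal_inv]
  have : ((Fintype.card n : ℝ) : ℂ) ≠ 0 := by exact_mod_cast hd.ne'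
  exact inv_mul_cancel₀ this

lemma spow_one_matrix (s : ℝ) : spow (1 : Matrix n n ℂ) s = 1 := by
  have h1 : (1 : Matrix n n ℂ).PosSemidef := PosSemidef.one
  have h0 : spow (1 : Matrix n n ℂ) 0 = 1 := by
    have := spow_mul h1 0 1
    rwa [spow_one h1, Matrix.mul_one, zero_add, spow_one h1] at this
  have h := spow_spow h1 0 s
  rwa [zero_mul, h0] at h

/-- Testing against the maximally mixed state bounds the trace by d^{1-r}, and the trace bounds
every entry. -/
lemma isCompact_powBall [Nonempty n] (r : ℝ) : IsCompact (powBall n r) := by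
  have hcl : IsClosed (powBall n r) := by
    have : powBall n r = {Y | Y.PosSemidef} ∩ ⋂ K : Matrix n n ℂ, ⋂ _ : IsDensity K,
        {Y | (spow K (1 - r) * Y).trace.re ≤ 1} := by
      ext Y
      simp [powBall]
    rw [this]
    refine isClosed_posSemidef.inter (isClosed_iInter fun K => isClosed_iInter fun _ => ?_)
    refine isClosed_le ?_ continuous_const
    refine Complex.continuous_re.comp ?_
    fun_prop
  set d : ℝ := ((Fintype.card n : ℕ) : ℝ) with hd
  have hd0 : 0 < d := by rw [hd]; exact_mod_cast Fintype.card_pos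
  set C := d ^ (1 - r)
  have hsub : powBall n r ⊆ Set.pi Set.univ fun _ : n => Set.pi Set.univ fun _ : n =>
      Metric.closedBall (0 : ℂ) C := by
    intro Y hY i _ j _
    rw [mem_closedBall_zero_iff]
    refine (norm_entry_le_trace hY.1 i j).trans ?_
    have h := hY.2 _ (isDensity_maxMixed n)
    rw [spow_smul PosSemidef.one (inv_pos.2 hd0), spow_one_matrix, Matrix.smul_mul,
      Matrix.one_mul, trace_smul, Complex.smul_re, smul_eq_mul, Real.inv_rpow hd0.le,
      inv_mul_le_iff₀ (by positivity), mul_one] at h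
    exact h
  refine IsCompact.of_isClosed_subset ?_ hcl hsub
  exact isCompact_univ_pi fun _ => isCompact_univ_pi fun _ => isCompact_closedBall _ _

lemma spow_mem_powBall {K : Matrix n n ℂ} (hK : IsDensity K) {r : ℝ} (hr0 : 0 < r) (hr1 : r < 1) :
    spow K r ∈ powBall n r := by
  refine ⟨spow_posSemidef hK.1 r, fun L hL => ?_⟩
  have h := trace_spow_mul_le hL.1 (spow_posSemidef hK.1 r) (by rw [hL.2]; simp) (s := 1 - r)
    (by linarith) (by linarith)
  rwa [sub_sub_cancel, trpow_spow hK.1, mul_one_div_cancel hr0.ne', trpow_one hK.1, hK.2,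
    Complex.one_re, Real.one_rpow] at h

/-- Testing Y against its own optimizer attains equality in Hölder, so the dual constraint gives tr
Y^{1/r} ≤ 1. -/
lemma exists_of_mem_powBall {Y : Matrix n n ℂ} {r : ℝ} (hr0 : 0 < r) (hY : Y ∈ powBall n r) :
    ∃ K : Matrix n n ℂ, K.PosSemidef ∧ K.trace.re ≤ 1 ∧ spow K r = Y := by
  have hY1 := hY.1
  refine ⟨spow Y (1 / r), spow_posSemidef hY1 _, ?_, ?_⟩
  · by_cases h0 : Y = 0
    · have := trpow_zero_matrix (n := n) (1 / r)
      rw [h0, ← trpow, this]; norm_num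
    · have h := hY.2 _ (optimizer_isDensity hY1 h0 (1 / (1 - (1 - r))))
      rw [trace_spow_optimizer hY1 h0 (by linarith), sub_sub_cancel] at h
      have hN := trpow_nonneg hY1 (1 / r)
      rw [← trpow]
      calc trpow Y (1 / r) = (trpow Y (1 / r) ^ r) ^ (1 / r) := by
            rw [← Real.rpow_mul hN, mul_one_div_cancel hr0.ne', Real.rpow_one]
        _ ≤ 1 := Real.rpow_le_one (Real.rpow_nonneg hN _) h (by positivity)
  · rw [spow_spow hY1, one_div_mul_cancel hr0.ne', spow_one hY1]

lemma spow_mem_negPowSet {K : Matrix n n ℂ} (hK : IsDensity K) (hK0 : spow K 0 = 1) {r : ℝ}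
    (hr0 : 0 < r) : spow K (-r) ∈ negPowSet n r := by
  refine ⟨spow_posSemidef hK.1 _, fun L hL => ?_⟩
  have hZ := spow_posSemidef hK.1 (-r)
  have h := one_le_mul_trace_spow_mul hL.1 hZ (by rw [hL.2]; simp) ?_ (s := 1 + r) (by linarith)
  · rwa [add_sub_cancel_left, trpow_spow hK.1, show -r * (-1 / r) = 1 by field_simp,
      trpow_one hK.1, hK.2, Complex.one_re, Real.one_rpow, one_mul] at h
  · intro i
    have hpd : (spow K (-r)).PosDef := by
      rw [hZ.posDef_iff_isUnit]
      refine IsUnit.of_mul_eq_one (spow K r) ?_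
      rw [spow_mul hK.1, neg_add_cancel, hK0]
    exact hpd.eigenvalues_pos i

lemma exists_of_mem_negPowSet [Nonempty n] {Z : Matrix n n ℂ} {r : ℝ} (hr0 : 0 < r)
    (hZ : Z ∈ negPowSet n r) :
    ∃ K : Matrix n n ℂ, K.PosSemidef ∧ K.trace.re ≤ 1 ∧ spow K 0 = 1 ∧ spow K (-r) = Z := by
  have hZ1 := hZ.1
  -- Were Z singular, a density supported on its kernel would give trace 0, against the lower bound
  -- 1.
  have hfull : spow Z 0 = 1 := by
    by_contra hne
    set E := 1 - spow Z 0 with hE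
    have hE0 : E ≠ 0 := fun h => hne (sub_eq_zero.1 h).symm
    have hEp : E.PosSemidef := by
      have := (isContr_spow_zero hZ1).1
      rwa [(spow_isHermitian hZ1 _).eq, spow_mul hZ1, add_zero] at this
    have hEZ : spow E 1 * Z = 0 := by
      rw [spow_one hEp, hE, Matrix.sub_mul, Matrix.one_mul]
      nth_rw 3 [← spow_one hZ1]
      rw [spow_mul hZ1, zero_add, spow_one hZ1, sub_self]
    have h := hZ.2 _ (optimizer_isDensity hEp hE0 1)
    rw [spow_optimizer hEp hE0, Matrix.smul_mul, spow_mul_eq_zero hEp _ hEZ] at h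
    norm_num at h
  have hZne : Z ≠ 0 := by
    rintro rfl
    have := spow_mul hZ1 0 1
    rw [hfull, zero_add, spow_one hZ1] at this
    have h := hZ.2 _ (isDensity_maxMixed n)
    norm_num at h
  refine ⟨spow Z (-1 / r), spow_posSemidef hZ1 _, ?_, ?_, ?_⟩
  · have h := hZ.2 _ (optimizer_isDensity hZ1 hZne (1 / (1 - (1 + r))))
    have hN := trpow_pos hZ1 hZne (-1 / r)
    rw [trace_spow_optimizer hZ1 hZne (by linarith),
      show 1 / (1 - (1 + r)) = -1 / r by rw [sub_add_cancel_left]; field_simp,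
      sub_add_cancel_left] at h
    rw [← trpow]
    by_contra hlt
    push Not at hlt
    exact absurd h (not_le.2 (Real.rpow_lt_one_of_one_lt_of_neg hlt (by linarith)))
  · rw [spow_spow hZ1, mul_zero, hfull]
  · rw [spow_spow hZ1, show -1 / r * -r = 1 by field_simp, spow_one hZ1]

/-- A consequence of Sion's minimax theorem for bilinear forms. -/
lemma exists_forall_lt_of_forall_exists_lt {E F : Type*} [TopologicalSpace E] [AddCommGroup E]
    [Module ℝ E] [IsTopologicalAddGroup E] [ContinuousSMul ℝ E] [TopologicalSpace F]
    [AddCommGroup F] [Module ℝ F] [IsTopologicalAddGroup F] [ContinuousSMul ℝ F]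
    (g : E →ₗ[ℝ] F →ₗ[ℝ] ℝ) (hg1 : ∀ y, Continuous fun x => g x y)
    (hg2 : ∀ x, Continuous fun y => g x y) {X : Set E} {Y : Set F} (hX : IsCompact X)
    (hXne : X.Nonempty) (hXc : Convex ℝ X) (hYc : Convex ℝ Y) {v : ℝ}
    (h : ∀ x ∈ X, ∃ y ∈ Y, g x y < v) : ∃ y ∈ Y, ∀ x ∈ X, g x y < v := by
  have hlsc : ∀ y ∈ Y, LowerSemicontinuousOn (fun x => -g x y) X := fun y _ =>
    (hg1 y).neg.continuousOn.lowerSemicontinuousOn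
  -- Compactness of X leaves finitely many y to consider, as required by the finite form of Sion's
  -- theorem; the sign of g is reversed to match it.
  have hfin : ∃ s : Set F, s.Finite ∧ s ⊆ Y ∧ ∀ x ∈ X, ∃ y ∈ s, -v < -g x y := by
    obtain ⟨t, ht⟩ := hX.elim_finite_subcover (fun y : Y => {x | g x y < v})
      (fun y => isOpen_lt (hg1 y) continuous_const) (fun x hx => by
        obtain ⟨y, hy, hxy⟩ := h x hx
        exact Set.mem_iUnion.2 ⟨⟨y, hy⟩, hxy⟩)
    refine ⟨Subtype.val '' (t : Set Y), t.finite_toSet.image _, by simp, fun x hx => ?_⟩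
    obtain ⟨y, hy, hxy⟩ := Set.mem_iUnion₂.1 (ht hx)
    exact ⟨y, ⟨y, hy, rfl⟩, neg_lt_neg hxy⟩
  obtain ⟨s, hs, hsY, hst⟩ := hfin
  obtain ⟨y, hy, hxy⟩ := Sion.exists_lt_iInf_of_lt_iInf_of_finite (f := fun x y => -g x y)
    hXne hX hlsc
    (fun y _ => ((-(g.flip y)).convexOn hXc).quasiconvexOn) hYc
    (fun x _ => (hg2 x).neg.continuousOn.upperSemicontinuousOn)
    (fun x _ => ((-(g x)).concaveOn hYc).quasiconcaveOn) hXc hs hsY hst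
  exact ⟨y, hy, fun x hx => neg_lt_neg_iff.1 (hxy x hx)⟩

end Minimax

/-! ### Reshaping, marginals, and the interpolating family. -/

section Reshape

variable {A Y D : Type*} [Fintype A] [DecidableEq A] [Fintype Y] [DecidableEq Y]
  [Fintype D] [DecidableEq D]

/-- An operator from `D` to `A ⊗ Y` regarded as an operator from `A ⊗ D` to `Y`. -/
def reshape (X : Matrix (A × Y) D ℂ) : Matrix Y (A × D) ℂ :=
  Matrix.of fun y p => X (p.1, y) p.2

lemma reshape_one_kronecker_mul (L : Matrix Y Y ℂ) (X : Matrix (A × Y) D ℂ) :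
    reshape (((1 : Matrix A A ℂ) ⊗ₖ L) * X) = L * reshape X := by
  ext y p
  simp [reshape, mul_apply, Fintype.sum_prod_type, one_apply]

lemma reshape_mul (X : Matrix (A × Y) D ℂ) (K : Matrix D D ℂ) :
    reshape (X * K) = reshape X * ((1 : Matrix A A ℂ) ⊗ₖ K) := by
  ext y p
  simp [reshape, mul_apply, Fintype.sum_prod_type, one_apply]

/-- Partial traces become Gram matrices of one operator, so norms of marginals become Schatten norms
to which interpolation applies. -/
lemma reshape_mul_conjTranspose (X : Matrix (A × Y) D ℂ) :
    reshape X * (reshape X)ᴴ = traceFst (X * Xᴴ) := by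
  ext i j
  simp [reshape, traceFst, mul_apply, Fintype.sum_prod_type, conjTranspose_apply]

lemma trace_traceFst (N : Matrix (A × Y) (A × Y) ℂ) : (traceFst N).trace = N.trace := by
  simp only [trace, traceFst, diag_apply]
  rw [Fintype.sum_prod_type_right]

lemma traceFst_one_kronecker_mul (L : Matrix Y Y ℂ) (N : Matrix (A × Y) (A × Y) ℂ) :
    traceFst (((1 : Matrix A A ℂ) ⊗ₖ L) * N) = L * traceFst N := by
  ext i j
  have h : ∀ x, (((1 : Matrix A A ℂ) ⊗ₖ L) * N) (x, i) (x, j) = ∑ k, L i k * N (x, k) (x, j) := by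
    intro x
    simp [mul_apply, Fintype.sum_prod_type, one_apply]
  simp only [traceFst, h]
  rw [Finset.sum_comm, mul_apply]
  exact Finset.sum_congr rfl fun k _ => (Finset.mul_sum _ _ _).symm

lemma traceFst_mul_one_kronecker (L : Matrix Y Y ℂ) (N : Matrix (A × Y) (A × Y) ℂ) :
    traceFst (N * ((1 : Matrix A A ℂ) ⊗ₖ L)) = traceFst N * L := by
  ext i j
  have h : ∀ x, (N * ((1 : Matrix A A ℂ) ⊗ₖ L)) (x, i) (x, j) = ∑ k, N (x, i) (x, k) * L k j := by
    intro x
    simp [mul_apply, Fintype.sum_prod_type, one_apply]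
  simp only [traceFst, h]
  rw [Finset.sum_comm, mul_apply]
  exact Finset.sum_congr rfl fun k _ => (Finset.sum_mul _ _ _).symm

lemma traceFst_posSemidef {N : Matrix (A × Y) (A × Y) ℂ} (hN : N.PosSemidef) :
    (traceFst N).PosSemidef := by
  have h : N = spow N (1 / 2) * (spow N (1 / 2))ᴴ := by
    rw [(spow_isHermitian hN _).eq, spow_mul hN]
    norm_num
    exact (spow_one hN).symm
  rw [h, ← reshape_mul_conjTranspose]
  exact posSemidef_self_mul_conjTranspose _

lemma one_kronecker_posSemidef {T : Matrix Y Y ℂ} (hT : T.PosSemidef) :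
    ((1 : Matrix A A ℂ) ⊗ₖ T).PosSemidef := PosSemidef.one.kronecker hT

/-- The marginal on `Y` of `X κ^b Xᴴ`. -/
def margin (X : Matrix (A × Y) D ℂ) (κ : Matrix D D ℂ) (b : ℝ) : Matrix Y Y ℂ :=
  traceFst (X * spow κ b * Xᴴ)

/-- The operator on `D` obtained by compressing `1 ⊗ σ ^ (-a)`. -/
def compress (X : Matrix (A × Y) D ℂ) (σ : Matrix Y Y ℂ) (a : ℝ) : Matrix D D ℂ :=
  Xᴴ * ((1 : Matrix A A ℂ) ⊗ₖ spow σ (-a)) * X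

lemma margin_eq {κ : Matrix D D ℂ} (hκ : κ.PosSemidef) (X : Matrix (A × Y) D ℂ) (b : ℝ) :
    margin X κ b = (reshape X * ((1 : Matrix A A ℂ) ⊗ₖ spow κ (b / 2))) *
      (reshape X * ((1 : Matrix A A ℂ) ⊗ₖ spow κ (b / 2)))ᴴ := by
  rw [← reshape_mul, reshape_mul_conjTranspose, conjTranspose_mul, (spow_isHermitian hκ _).eq,
    Matrix.mul_assoc, ← Matrix.mul_assoc (spow κ (b / 2)), spow_mul hκ, add_halves,
    ← Matrix.mul_assoc, margin]

lemma margin_posSemidef {κ : Matrix D D ℂ} (hκ : κ.PosSemidef) (X : Matrix (A × Y) D ℂ) (b : ℝ) :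
    (margin X κ b).PosSemidef := by
  rw [margin_eq hκ]; exact posSemidef_self_mul_conjTranspose _

lemma compress_eq {σ : Matrix Y Y ℂ} (hσ : σ.PosSemidef) (X : Matrix (A × Y) D ℂ) (a : ℝ) :
    compress X σ a = (spow ((1 : Matrix A A ℂ) ⊗ₖ σ) (-a / 2) * X)ᴴ *
      (spow ((1 : Matrix A A ℂ) ⊗ₖ σ) (-a / 2) * X) := by
  have h1 := one_kronecker_posSemidef (A := A) hσ
  rw [conjTranspose_mul, (spow_isHermitian h1 _).eq, Matrix.mul_assoc, spow_mul_assoc h1,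
    add_halves, ← Matrix.mul_assoc, spow_one_kronecker hσ.1, compress]

lemma compress_posSemidef {σ : Matrix Y Y ℂ} (hσ : σ.PosSemidef) (X : Matrix (A × Y) D ℂ) (a : ℝ) :
    (compress X σ a).PosSemidef := by
  rw [compress_eq hσ]; exact posSemidef_conjTranspose_mul_self _

/-- The duality between D and Y: one number is linear in an operator on D and linear in an operator
on Y, so Hölder can be applied on either side. -/
lemma trace_mul_compress (X : Matrix (A × Y) D ℂ) (L : Matrix Y Y ℂ) (K : Matrix D D ℂ) :
    (K * (Xᴴ * ((1 : Matrix A A ℂ) ⊗ₖ L) * X)).trace = (L * traceFst (X * K * Xᴴ)).trace := by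
  rw [← traceFst_one_kronecker_mul, trace_traceFst, trace_mul_comm, Matrix.mul_assoc,
    Matrix.mul_assoc, trace_mul_comm]
  simp only [Matrix.mul_assoc]

lemma trace_spow_compress (X : Matrix (A × Y) D ℂ) (σ : Matrix Y Y ℂ) (κ : Matrix D D ℂ) (b : ℝ) :
    (spow κ b * compress X σ b).trace = (spow σ (-b) * margin X κ b).trace :=
  trace_mul_compress X _ _

/-- The base of the sandwiched Rényi divergence, in terms of `a = (α - 1) / α`. -/
def sandwich {n : Type*} [Fintype n] [DecidableEq n] (a : ℝ) (ρ σ : Matrix n n ℂ) : ℝ :=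
  trpow (spow σ (-a / 2) * ρ * spow σ (-a / 2)) (1 / (1 - a)) ^ (1 - a)

lemma mul_spow_zero_conjTranspose_mul {n m : Type*} [Fintype n] [DecidableEq n] [Fintype m]
    [DecidableEq m] (M : Matrix n m ℂ) : M * spow (Mᴴ * M) 0 = M := by
  have h2 := posSemidef_conjTranspose_mul_self M
  nth_rw 1 [← polar_mul M]
  rw [Matrix.mul_assoc, spow_mul h2, add_zero, polar_mul]

/-- With M = (1 ⊗ σ)^{-a/2} X, M M† is the sandwich on AY and M†M its compression to D; these have
equal traces of powers. -/
lemma sandwich_eq_compress {X : Matrix (A × Y) D ℂ} {σ : Matrix Y Y ℂ} (hσ : σ.PosSemidef)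
    (a : ℝ) : sandwich a (X * Xᴴ) ((1 : Matrix A A ℂ) ⊗ₖ σ) =
      trpow (compress X σ a) (1 / (1 - a)) ^ (1 - a) := by
  have h1 := one_kronecker_posSemidef (A := A) hσ
  rw [sandwich, compress_eq hσ, ← trpow_mul_conjTranspose, conjTranspose_mul,
    (spow_isHermitian h1 _).eq]
  simp only [Matrix.mul_assoc]

/-- The interpolating family of operators. -/
def interpFamily (X : Matrix (A × Y) D ℂ) (T : Matrix Y Y ℂ) (κ : Matrix D D ℂ) (b c x : ℝ) :
    Matrix Y (A × D) ℂ :=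
  spow T (-(c * (1 - x)) / 2) * reshape X * ((1 : Matrix A A ℂ) ⊗ₖ spow κ (b * x / 2))

/-- Both exponents in the family are affine in x, so moving from x₀ to x₁ multiplies by fixed powers
of T and κ, which are the P and Q of `snorm_interp`. The points x₀ and x₁ are arbitrary reals, so
the same bound covers every ordering of 0, 1, a/b. -/
lemma snorm_interpFamily_le (X : Matrix (A × Y) D ℂ) {T : Matrix Y Y ℂ} {κ : Matrix D D ℂ}
    (hT : T.PosSemidef) (hκ : κ.PosSemidef) (b c : ℝ) {x₀ x₁ x t e₀ e₁ e : ℝ} (ht0 : 0 ≤ t)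
    (ht1 : t ≤ 1) (hx : x = (1 - t) * x₀ + t * x₁) (he : e = (1 - t) * e₀ + t * e₁)
    (h0 : 0 < e₀) (h0' : e₀ ≤ 1) (h1 : 0 < e₁) (h1' : e₁ ≤ 1) :
    snorm (1 / e) (interpFamily X T κ b c x) ≤ snorm (1 / e₀) (interpFamily X T κ b c x₀) ^ (1 - t) *
      snorm (1 / e₁) (interpFamily X T κ b c x₁) ^ t := by
  have hpos : 0 < e := by
    rw [he]
    rcases ht0.eq_or_lt with h | h
    · rw [← h]; simpa using h0
    · have := mul_pos h h1
      have := mul_nonneg (sub_nonneg.2 ht1) h0.le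
      linarith
  have hle : e ≤ 1 := by rw [he]; nlinarith
  have hκ1 := one_kronecker_posSemidef (A := A) hκ
  have h := snorm_interp (spow_posSemidef hT (c * (x₁ - x₀) / 2))
    (spow_posSemidef hκ1 (b * (x₁ - x₀) / 2)) (interpFamily X T κ b c x₀)
    (p := 1 / e) (p₀ := 1 / e₀) (p₁ := 1 / e₁) (t := t)
    (by rwa [le_div_iff₀ hpos, one_mul]) (by rwa [le_div_iff₀ h0, one_mul])
    (by rwa [le_div_iff₀ h1, one_mul]) ht0 ht1 (by rw [he]; field_simp)
  have key : ∀ u v : ℝ, spow T u * interpFamily X T κ b c x₀ * spow ((1 : Matrix A A ℂ) ⊗ₖ κ) v =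
      spow T (u + -(c * (1 - x₀)) / 2) * reshape X *
        ((1 : Matrix A A ℂ) ⊗ₖ spow κ (b * x₀ / 2 + v)) := by
    intro u v
    rw [interpFamily, ← spow_one_kronecker hκ.1, ← spow_one_kronecker hκ.1, ← spow_mul hT,
      ← spow_mul hκ1]
    simp only [Matrix.mul_assoc]
  rw [spow_spow hT, spow_spow hκ1, key, key] at h
  convert h using 2
  · rw [interpFamily, hx]
    congr 3 <;> ring_nf
  · rw [interpFamily]
    congr 4 <;> ring_nf

lemma snorm_sq {n m : Type*} [Fintype n] [DecidableEq n] [Fintype m] [DecidableEq m] {e : ℝ}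
    (M : Matrix n m ℂ) : snorm (1 / (e / 2)) M ^ 2 = trpow (M * Mᴴ) (1 / e) ^ e := by
  have h := trpow_nonneg (posSemidef_self_mul_conjTranspose M) (1 / e)
  rw [snorm, ← Real.rpow_natCast, show 1 / (e / 2) / 2 = 1 / e by rw [one_div_div]; ring,
    ← Real.rpow_mul h]
  congr 1
  rw [one_div_one_div]
  push_cast
  ring

/-- Here both exponents equal a, and p = 2 turns the squared norm into an ordinary trace. -/
lemma snorm_interpFamily_theta (X : Matrix (A × Y) D ℂ) {T : Matrix Y Y ℂ} {κ : Matrix D D ℂ}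
    (hT : T.PosSemidef) (hκ : κ.PosSemidef) {a b c x : ℝ} (h1 : b * x = a)
    (h2 : c * (1 - x) = a) : snorm (1 / (1 / 2)) (interpFamily X T κ b c x) ^ 2 =
      (spow κ a * compress X T a).trace.re := by
  have hκ1 := one_kronecker_posSemidef (A := A) hκ
  have e : (interpFamily X T κ b c x) * (interpFamily X T κ b c x)ᴴ =
      spow T (-a / 2) * (margin X κ a * spow T (-a / 2)) := by
    rw [margin_eq hκ, interpFamily, h1, h2, Matrix.mul_assoc (spow T _)]
    generalize reshape X * ((1 : Matrix A A ℂ) ⊗ₖ spow κ (a / 2)) = R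
    rw [conjTranspose_mul, (spow_isHermitian hT _).eq]
    simp only [Matrix.mul_assoc]
  rw [snorm_sq, Real.rpow_one, one_div_one, trpow_one (posSemidef_self_mul_conjTranspose _), e,
    trace_mul_comm, Matrix.mul_assoc, spow_mul hT, add_halves, trace_mul_comm,
    trace_spow_compress]

/-- At x = 0 the only trace of κ is its support projection, a contraction, whence an inequality.
Equality requires that this projection can be absorbed; the roles at x = 1 are analogous with the
support of T. -/
lemma snorm_interpFamily_zero_le (X : Matrix (A × Y) D ℂ) {T : Matrix Y Y ℂ} {κ : Matrix D D ℂ}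
    (hT : T.PosSemidef) (hκ : κ.PosSemidef) (b : ℝ) {c : ℝ} (hc : -1 ≤ c) (hc1 : c < 1) :
    snorm (1 / ((1 - c) / 2)) (interpFamily X T κ b c 0) ^ 2 ≤ sandwich c (traceFst (X * Xᴴ)) T := by
  have hκ1 := one_kronecker_posSemidef (A := A) hκ
  have hp : 1 ≤ 1 / ((1 - c) / 2) := by rw [le_div_iff₀ (by linarith)]; linarith
  have h := snorm_contr_le (A := 1) (B := spow ((1 : Matrix A A ℂ) ⊗ₖ κ) 0) isContr_one
    (isContr_spow_zero hκ1) (spow T (-c / 2) * reshape X) hp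
  have e : interpFamily X T κ b c 0 =
      (1 : Matrix Y Y ℂ) * (spow T (-c / 2) * reshape X) * spow ((1 : Matrix A A ℂ) ⊗ₖ κ) 0 := by
    rw [interpFamily, Matrix.one_mul, spow_one_kronecker hκ.1]
    ring_nf
  rw [e]
  refine (pow_le_pow_left₀ (snorm_nonneg _ _) h 2).trans (le_of_eq ?_)
  rw [snorm_sq, sandwich, conjTranspose_mul, (spow_isHermitian hT _).eq,
    ← reshape_mul_conjTranspose]
  simp only [Matrix.mul_assoc]

lemma snorm_interpFamily_zero {X : Matrix (A × Y) D ℂ} {T : Matrix Y Y ℂ} {κ : Matrix D D ℂ}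
    (hT : T.PosSemidef) (b : ℝ) {c : ℝ}
    (h : spow ((1 : Matrix A A ℂ) ⊗ₖ T) (-c / 2) * X * spow κ 0 =
      spow ((1 : Matrix A A ℂ) ⊗ₖ T) (-c / 2) * X) :
    snorm (1 / ((1 - c) / 2)) (interpFamily X T κ b c 0) ^ 2 = sandwich c (traceFst (X * Xᴴ)) T := by
  have e : interpFamily X T κ b c 0 = spow T (-c / 2) * reshape X := by
    have h' := congrArg reshape h
    rw [spow_one_kronecker hT.1, reshape_mul, reshape_one_kronecker_mul] at h'
    rw [interpFamily, ← h']
    ring_nf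
  rw [e, snorm_sq, sandwich, conjTranspose_mul, (spow_isHermitian hT _).eq,
    ← reshape_mul_conjTranspose]
  simp only [Matrix.mul_assoc]

lemma snorm_interpFamily_one_le (X : Matrix (A × Y) D ℂ) {T : Matrix Y Y ℂ} {κ : Matrix D D ℂ}
    (hT : T.PosSemidef) (hκ : κ.PosSemidef) {b : ℝ} (c : ℝ) (hb : -1 < b) (hb1 : b ≤ 1) :
    snorm (1 / ((1 + b) / 2)) (interpFamily X T κ b c 1) ^ 2 ≤
      trpow (margin X κ b) (1 / (1 + b)) ^ (1 + b) := by
  have hp : 1 ≤ 1 / ((1 + b) / 2) := by rw [le_div_iff₀ (by linarith)]; linarith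
  have h := snorm_contr_le (A := spow T 0) (B := 1) (isContr_spow_zero hT) isContr_one
    (reshape X * ((1 : Matrix A A ℂ) ⊗ₖ spow κ (b / 2))) hp
  have e : interpFamily X T κ b c 1 =
      spow T 0 * (reshape X * ((1 : Matrix A A ℂ) ⊗ₖ spow κ (b / 2))) *
        (1 : Matrix (A × D) (A × D) ℂ) := by
    rw [interpFamily, Matrix.mul_one, Matrix.mul_assoc]
    ring_nf
  rw [e]
  refine (pow_le_pow_left₀ (snorm_nonneg _ _) h 2).trans (le_of_eq ?_)
  rw [snorm_sq, margin_eq hκ]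

lemma snorm_interpFamily_one {X : Matrix (A × Y) D ℂ} {T : Matrix Y Y ℂ} {κ : Matrix D D ℂ}
    (hT : T.PosSemidef) (hκ : κ.PosSemidef) (b c : ℝ)
    (h : spow ((1 : Matrix A A ℂ) ⊗ₖ T) 0 * X = X) :
    snorm (1 / ((1 + b) / 2)) (interpFamily X T κ b c 1) ^ 2 =
      trpow (margin X κ b) (1 / (1 + b)) ^ (1 + b) := by
  have e : interpFamily X T κ b c 1 = reshape X * ((1 : Matrix A A ℂ) ⊗ₖ spow κ (b / 2)) := by
    rw [spow_one_kronecker hT.1] at h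
    have h' := congrArg reshape h
    rw [reshape_one_kronecker_mul] at h'
    rw [interpFamily]
    nth_rw 2 [← h']
    ring_nf
  rw [e, snorm_sq, margin_eq hκ]

end Reshape

/-! ### Existence of near-optimal operators κ by minimax. -/

section Optimizers

variable {A Y D : Type*} [Fintype A] [DecidableEq A] [Fintype Y] [DecidableEq Y]
  [Fintype D] [DecidableEq D]

lemma mul_one_kronecker_eq_zero {X : Matrix (A × Y) D ℂ} {σ : Matrix Y Y ℂ}
    (hσ : σ.PosSemidef) {a : ℝ} (h : compress X σ a = 0) :
    X * Xᴴ * ((1 : Matrix A A ℂ) ⊗ₖ σ) = 0 := by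
  have h1 := one_kronecker_posSemidef (A := A) hσ
  rw [compress_eq hσ, conjTranspose_mul_self_eq_zero] at h
  have h2 := spow_mul_eq_zero h1 1 h
  rw [spow_one h1] at h2
  have h3 := congrArg conjTranspose h2
  rw [conjTranspose_mul, h1.1.eq, conjTranspose_zero] at h3
  rw [Matrix.mul_assoc, h3, Matrix.mul_zero]

lemma compress_smul {σ : Matrix Y Y ℂ} (hσ : σ.PosSemidef) (X : Matrix (A × Y) D ℂ) {t : ℝ}
    (ht : 0 < t) (a : ℝ) : compress X (t • σ) a = t ^ (-a) • compress X σ a := by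
  rw [compress, spow_smul hσ ht, kronecker_smul, Matrix.mul_smul, Matrix.smul_mul, compress]

lemma margin_ne_zero {X : Matrix (A × Y) D ℂ} (hX : X ≠ 0) {κ : Matrix D D ℂ} (hκ : κ.PosSemidef)
    (hκ0 : spow κ 0 = 1) (b : ℝ) : margin X κ b ≠ 0 := by
  intro h
  rw [margin_eq hκ, self_mul_conjTranspose_eq_zero, ← reshape_mul] at h
  have h1 : X * spow κ (b / 2) = 0 := by
    ext p d
    exact congrFun (congrFun h p.2) (p.1, d)
  have h2 := mul_spow_eq_zero hκ 0 h1
  rw [hκ0, Matrix.mul_one] at h2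
  exact hX h2

lemma re_trace_pos {σ : Matrix Y Y ℂ} (hσ : σ.PosSemidef) (h0 : σ ≠ 0) : 0 < σ.trace.re := by
  rw [← trpow_one hσ]; exact trpow_pos hσ h0 1

lemma isDensity_normalize {σ : Matrix Y Y ℂ} (hσ : σ.PosSemidef) (h0 : σ ≠ 0) :
    IsDensity (σ.trace.re⁻¹ • σ) := by
  have h := re_trace_pos hσ h0
  refine ⟨hσ.smul (inv_nonneg.2 h.le), ?_⟩
  have ht : σ.trace = (σ.trace.re : ℂ) := by
    have := spow_trace hσ.1 1
    rwa [spow_one hσ, trpow_one hσ] at this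
  rw [trace_smul, Complex.real_smul, ht, ← Complex.ofReal_mul, Complex.ofReal_re,
    inv_mul_cancel₀ h.ne', Complex.ofReal_one]

/-- The pairing of operators on `Y` and on `D` induced by `X`. -/
def pairing (X : Matrix (A × Y) D ℂ) : Matrix Y Y ℂ →ₗ[ℝ] Matrix D D ℂ →ₗ[ℝ] ℝ :=
  LinearMap.mk₂ ℝ (fun y z => (z * (Xᴴ * ((1 : Matrix A A ℂ) ⊗ₖ y) * X)).trace.re)
    (fun y y' z => by
      simp only [kronecker_add, Matrix.mul_add, Matrix.add_mul, trace_add, Complex.add_re])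
    (fun c y z => by
      simp only [kronecker_smul, Matrix.mul_smul, Matrix.smul_mul, trace_smul, Complex.smul_re])
    (fun y z z' => by simp only [Matrix.add_mul, trace_add, Complex.add_re])
    (fun c y z => by simp only [Matrix.smul_mul, trace_smul, Complex.smul_re])

lemma pairing_spow (X : Matrix (A × Y) D ℂ) (σ : Matrix Y Y ℂ) (κ : Matrix D D ℂ) (b : ℝ) :
    pairing X (spow σ (-b)) (spow κ b) = (spow κ b * compress X σ b).trace.re := rfl

lemma pairing_spow' (X : Matrix (A × Y) D ℂ) (σ : Matrix Y Y ℂ) (κ : Matrix D D ℂ) (b : ℝ) :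
    pairing X (spow σ (-b)) (spow κ b) = (spow σ (-b) * margin X κ b).trace.re := by
  rw [pairing_spow, trace_spow_compress]

/-- The states that contribute to the optimization over `σ`. -/
def Admissible (X : Matrix (A × Y) D ℂ) (b : ℝ) (σ : Matrix Y Y ℂ) : Prop :=
  IsDensity σ ∧ X * Xᴴ * ((1 : Matrix A A ℂ) ⊗ₖ σ) ≠ 0 ∧
    (Dominates ((1 : Matrix A A ℂ) ⊗ₖ σ) (X * Xᴴ) ∨ b < 0)

/-- The minimax exchange for b < 0: σ^{-b} ranges over a compact convex set and κ^b over a convex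
set of negative powers. The single κ obtained beats v against all σ, in particular against the
optimizer of its own marginal, which attains N(κ). -/
lemma exists_optimizer_of_neg {X : Matrix (A × Y) D ℂ} (hX : X ≠ 0) {b v : ℝ} (hb : b < 0)
    (hb1 : -1 < b) (hv : 0 < v)
    (h : ∀ σ, Admissible X b σ → sandwich b (X * Xᴴ) ((1 : Matrix A A ℂ) ⊗ₖ σ) < v) :
    ∃ κ : Matrix D D ℂ, κ.PosSemidef ∧ κ.trace.re ≤ 1 ∧ spow κ 0 = 1 ∧
      trpow (margin X κ b) (1 / (1 + b)) ^ (1 + b) < v := by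
  have hne : Nonempty D ∧ Nonempty Y := by
    refine ⟨?_, ?_⟩
    · by_contra hD
      rw [not_nonempty_iff] at hD
      exact hX (Matrix.ext fun i j => hD.elim j)
    · by_contra hD
      rw [not_nonempty_iff] at hD
      exact hX (Matrix.ext fun i j => hD.elim i.2)
  obtain ⟨hD, hY⟩ := hne
  have key : ∀ y ∈ powBall Y (-b), ∃ z ∈ negPowSet D (-b), pairing X y z < v := by
    intro y hy
    obtain ⟨σ, hσ, hσ1, rfl⟩ := exists_of_mem_powBall (by linarith) hy
    by_cases h0 : compress X σ b = 0
    -- The pairing vanishes here, so any full-rank density will do; the matrix 0 and exponent -1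
    -- serve only to produce one.
    · obtain ⟨K, hK, hK0, -⟩ := exists_full_trace_spow_mul_lt (T := (0 : Matrix D D ℂ))
        (s := -1) (v := trpow (0 : Matrix D D ℂ) (1 / (1 - -1)) ^ ((1 : ℝ) - -1) + 1)
        PosSemidef.zero (by norm_num) (by linarith)
      refine ⟨_, spow_mem_negPowSet hK hK0 (r := -b) (by linarith), ?_⟩
      rw [neg_neg, pairing_spow, h0]
      simpa using hv
    · have hσ0 : σ ≠ 0 := by
        rintro rfl
        apply h0
        have : spow (0 : Matrix Y Y ℂ) (-b) = 0 := by
          have h1 : (0 : Matrix Y Y ℂ).PosSemidef := PosSemidef.zero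
          have := spow_mul_eq_zero h1 (M := (1 : Matrix Y Y ℂ)) (s := 1) (-b)
            (by rw [spow_one h1, Matrix.zero_mul])
          rwa [Matrix.mul_one] at this
        rw [compress, this]; simp
      set t := σ.trace.re with ht
      have ht0 : 0 < t := re_trace_pos hσ hσ0
      set σ' := t⁻¹ • σ with hσ'
      have hd : IsDensity σ' := isDensity_normalize hσ hσ0
      have hσt : σ = t • σ' := by rw [hσ', smul_smul, mul_inv_cancel₀ ht0.ne', one_smul]
      have hc : compress X σ b = t ^ (-b) • compress X σ' b := by
        rw [hσt, compress_smul hd.1 X ht0]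
      have hadm : Admissible X b σ' := by
        refine ⟨hd, fun h1 => h0 ?_, Or.inr hb⟩
        have h2 : ((1 : Matrix A A ℂ) ⊗ₖ σ') * (X * Xᴴ) = 0 := by
          have := congrArg conjTranspose h1
          rwa [conjTranspose_mul, (one_kronecker_posSemidef hd.1).1.eq, conjTranspose_mul,
            conjTranspose_conjTranspose, conjTranspose_zero] at this
        have h3 : ((1 : Matrix A A ℂ) ⊗ₖ σ') * X = 0 := by
          rw [← self_mul_conjTranspose_eq_zero, conjTranspose_mul, Matrix.mul_assoc,
            ← Matrix.mul_assoc X, ← Matrix.mul_assoc, h2, Matrix.zero_mul]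
        have h4 := one_kronecker_posSemidef (A := A) hd.1
        rw [hc, compress_eq hd.1, spow_mul_eq_zero h4 (s := 1) (-b / 2) (by rwa [spow_one h4])]
        simp
      have hlt := h σ' hadm
      rw [sandwich_eq_compress hd.1] at hlt
      obtain ⟨K, hK, hK0, hKv⟩ := exists_full_trace_spow_mul_lt (compress_posSemidef hd.1 X b) hb hlt
      refine ⟨_, spow_mem_negPowSet hK hK0 (r := -b) (by linarith), ?_⟩
      rw [neg_neg, pairing_spow, hc, Matrix.mul_smul, trace_smul, Complex.smul_re, smul_eq_mul]
      -- Subnormalization of σ costs the factor t^{-b}, which is at most 1 because b < 0 and t ≤ 1,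
      -- so the bound for the normalized state persists.
      have ht1 : t ^ (-b) ≤ 1 := Real.rpow_le_one ht0.le hσ1 (by linarith)
      have ht2 : 0 < t ^ (-b) := by positivity
      nlinarith
  obtain ⟨z, hz, hzv⟩ := exists_forall_lt_of_forall_exists_lt (pairing X)
    (fun z => LinearMap.continuous_of_finiteDimensional ((pairing X).flip z))
    (fun y => LinearMap.continuous_of_finiteDimensional (pairing X y))
    (isCompact_powBall (-b)) ⟨_, spow_mem_powBall (isDensity_maxMixed Y) (r := -b) (by linarith)
      (by linarith)⟩ (convex_powBall _) (convex_negPowSet _) key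
  obtain ⟨K, hK, hK1, hK0, rfl⟩ := exists_of_mem_negPowSet (by linarith) hz
  refine ⟨K, hK, hK1, hK0, ?_⟩
  have hN := margin_posSemidef hK X b
  have hN0 := margin_ne_zero hX hK hK0 b
  have h1 := hzv _ (spow_mem_powBall (optimizer_isDensity hN hN0 (1 / (1 - -b))) (r := -b)
    (by linarith) (by linarith))
  rwa [neg_neg, pairing_spow', trace_spow_optimizer hN hN0 (by linarith), sub_neg_eq_add] at h1

/-- For b > 0 the roles are exchanged: κ^b lies in the compact set and σ^{-b} among the negative
powers. If every κ failed, minimax would give one full-rank σ good against all κ, hence against the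
optimizer attaining `sandwich b` at that σ, contradicting the hypothesis. -/
lemma exists_optimizer_of_pos {X : Matrix (A × Y) D ℂ} (hX : X ≠ 0) {b v : ℝ} (hb : 0 < b)
    (hb1 : b < 1)
    (h : ∀ σ, Admissible X b σ → v < sandwich b (X * Xᴴ) ((1 : Matrix A A ℂ) ⊗ₖ σ)) :
    ∃ κ : Matrix D D ℂ, κ.PosSemidef ∧ κ.trace.re ≤ 1 ∧
      v ≤ trpow (margin X κ b) (1 / (1 + b)) ^ (1 + b) := by
  have hne : Nonempty D ∧ Nonempty Y := by
    refine ⟨?_, ?_⟩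
    · by_contra hD
      rw [not_nonempty_iff] at hD
      exact hX (Matrix.ext fun i j => hD.elim j)
    · by_contra hD
      rw [not_nonempty_iff] at hD
      exact hX (Matrix.ext fun i j => hD.elim i.2)
  obtain ⟨hD, hY⟩ := hne
  by_contra hcon
  push Not at hcon
  have key : ∀ y ∈ powBall D b, ∃ z ∈ negPowSet Y b, (pairing X).flip y z < v := by
    intro y hy
    obtain ⟨κ, hκ, hκ1, rfl⟩ := exists_of_mem_powBall hb hy
    have hlt := hcon κ hκ hκ1
    obtain ⟨K, hK, hK0, hKv⟩ := exists_full_trace_spow_mul_lt (margin_posSemidef hκ X b) (s := -b)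
      (by linarith) (by rwa [sub_neg_eq_add])
    refine ⟨_, spow_mem_negPowSet hK hK0 hb, ?_⟩
    rw [LinearMap.flip_apply, pairing_spow']
    exact hKv
  obtain ⟨z, hz, hzv⟩ := exists_forall_lt_of_forall_exists_lt (pairing X).flip
    (fun y => LinearMap.continuous_of_finiteDimensional (pairing X y))
    (fun z => LinearMap.continuous_of_finiteDimensional ((pairing X).flip z))
    (isCompact_powBall b) ⟨_, spow_mem_powBall (isDensity_maxMixed D) hb hb1⟩
    (convex_powBall _) (convex_negPowSet _) key
  obtain ⟨σ, hσ, hσ1, hσ0, rfl⟩ := exists_of_mem_negPowSet hb hz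
  have hσne : σ ≠ 0 := by
    rintro rfl
    have h1 := spow_mul hσ 0 1
    rw [spow_one hσ, Matrix.mul_zero, zero_add, spow_one hσ] at h1
    have : spow (0 : Matrix Y Y ℂ) 0 = 0 := by
      have := spow_mul_eq_zero hσ (M := (1 : Matrix Y Y ℂ)) (s := 1) 0
        (by rw [spow_one hσ, Matrix.zero_mul])
      rwa [Matrix.mul_one] at this
    rw [this] at hσ0
    exact zero_ne_one hσ0
  set t := σ.trace.re with ht
  have ht0 : 0 < t := re_trace_pos hσ hσne
  set σ' := t⁻¹ • σ with hσ'
  have hd : IsDensity σ' := isDensity_normalize hσ hσne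
  have hσt : σ = t • σ' := by rw [hσ', smul_smul, mul_inv_cancel₀ ht0.ne', one_smul]
  have hc : compress X σ b = t ^ (-b) • compress X σ' b := by
    rw [hσt, compress_smul hd.1 X ht0]
  have hfull : spow ((1 : Matrix A A ℂ) ⊗ₖ σ') 0 = 1 := by
    rw [spow_one_kronecker hd.1.1, hσ', spow_smul hσ (inv_pos.2 ht0), Real.rpow_zero, one_smul,
      hσ0, one_kronecker_one]
  have h4 := one_kronecker_posSemidef (A := A) hd.1
  have hne0 : X * Xᴴ * ((1 : Matrix A A ℂ) ⊗ₖ σ') ≠ 0 := by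
    intro h5
    have h6 := mul_spow_eq_zero h4 (s := 1) 0 (M := X * Xᴴ) (by rwa [spow_one h4])
    rw [hfull, Matrix.mul_one, self_mul_conjTranspose_eq_zero] at h6
    exact hX h6
  have hQ := h σ' ⟨hd, hne0, Or.inl ((dominates_iff h4 _).2 (by rw [hfull, Matrix.mul_one]))⟩
  have hCp := compress_posSemidef hd.1 X b
  have hC0 : compress X σ' b ≠ 0 := fun h5 => hne0 (mul_one_kronecker_eq_zero hd.1 h5)
  rw [sandwich_eq_compress hd.1, ← trace_spow_optimizer hCp hC0 hb1.ne] at hQ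
  have h6 := hzv _ (spow_mem_powBall (optimizer_isDensity hCp hC0 (1 / (1 - b))) hb hb1)
  rw [LinearMap.flip_apply, pairing_spow, hc, Matrix.mul_smul, trace_smul, Complex.smul_re,
    smul_eq_mul] at h6
  have ht1 : 1 ≤ t ^ (-b) := Real.one_le_rpow_of_pos_of_le_one_of_nonpos ht0 hσ1 (by linarith)
  have hpos : 0 < (spow (optimizer (compress X σ' b) (1 / (1 - b))) b * compress X σ' b).trace.re := by
    rw [trace_spow_optimizer hCp hC0 hb1.ne]
    exact Real.rpow_pos_of_pos (trpow_pos hCp hC0 _) _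
  nlinarith

end Optimizers

/-! ### The chain inequality for fixed κ, by the relative order of 0, 1 and a/b. -/

section Chain

variable {A Y D : Type*} [Fintype A] [DecidableEq A] [Fintype Y] [DecidableEq Y]
  [Fintype D] [DecidableEq D]

lemma sq_le_rpow_mul_rpow {x u v p q : ℝ} (hx : 0 ≤ x) (hu : 0 ≤ u) (hv : 0 ≤ v)
    (h : x ≤ u ^ p * v ^ q) : x ^ 2 ≤ (u ^ 2) ^ p * (v ^ 2) ^ q := by
  have h2 := pow_le_pow_left₀ hx h 2
  rwa [mul_pow, Real.rpow_pow_comm hu, Real.rpow_pow_comm hv] at h2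

lemma logb_le_of_le_rpow_mul_rpow {x u v p q : ℝ} (hx : 0 < x) (hu : 0 < u) (hv : 0 < v)
    (h : x ≤ u ^ p * v ^ q) : Real.logb 2 x ≤ p * Real.logb 2 u + q * Real.logb 2 v := by
  have h2 := Real.logb_le_logb_of_le one_lt_two hx h
  rwa [Real.logb_mul (by positivity) (by positivity), Real.logb_rpow_eq_mul_logb_of_pos hu,
    Real.logb_rpow_eq_mul_logb_of_pos hv] at h2

lemma sandwich_pos {n : Type*} [Fintype n] [DecidableEq n] {ρ σ : Matrix n n ℂ}
    (hρ : ρ.PosSemidef) (hσ : σ.PosSemidef) (h : ρ * σ ≠ 0) (a : ℝ) : 0 < sandwich a ρ σ := by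
  have hp : (spow σ (-a / 2) * ρ * spow σ (-a / 2)).PosSemidef := by
    have := hρ.mul_mul_conjTranspose_same (spow σ (-a / 2))
    rwa [(spow_isHermitian hσ _).eq] at this
  refine Real.rpow_pos_of_pos (trpow_pos hp (fun h0 => h ?_) _) _
  set R := spow ρ (1 / 2) with hR
  have hRR : R * R = ρ := by rw [hR, spow_mul hρ, add_halves, spow_one hρ]
  have hRh : Rᴴ = R := (spow_isHermitian hρ _).eq
  have h1 : (R * spow σ (-a / 2))ᴴ * (R * spow σ (-a / 2)) = 0 := by
    rw [conjTranspose_mul, hRh, (spow_isHermitian hσ _).eq, ← h0, ← hRR]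
    simp only [Matrix.mul_assoc]
  rw [conjTranspose_mul_self_eq_zero] at h1
  have h2 := mul_spow_eq_zero hσ 1 h1
  rw [spow_one hσ] at h2
  rw [← hRR, Matrix.mul_assoc, h2, Matrix.mul_zero]

/-- tr[ρ(1 ⊗ T)] = tr[ρ_Y T], and the left side is the trace of the Gram matrix of (1 ⊗ T)^{1/2} X,
so its vanishing forces orthogonality on AY. -/
lemma traceFst_mul_ne_zero {X : Matrix (A × Y) D ℂ} {T : Matrix Y Y ℂ} (hT : T.PosSemidef)
    (h : X * Xᴴ * ((1 : Matrix A A ℂ) ⊗ₖ T) ≠ 0) : traceFst (X * Xᴴ) * T ≠ 0 := by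
  intro h0
  apply h
  set M := spow ((1 : Matrix A A ℂ) ⊗ₖ T) (1 / 2) * X with hM
  have h1 := one_kronecker_posSemidef (A := A) hT
  have h2 : M * Mᴴ = 0 := by
    rw [← (posSemidef_self_mul_conjTranspose M).trace_eq_zero_iff, hM, conjTranspose_mul,
      (spow_isHermitian h1 _).eq, trace_mul_comm, Matrix.mul_assoc, spow_mul_assoc h1, add_halves,
      spow_one h1, trace_mul_comm, Matrix.mul_assoc, trace_mul_comm, ← trace_traceFst,
      traceFst_mul_one_kronecker, h0, trace_zero]
  rw [self_mul_conjTranspose_eq_zero, hM] at h2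
  have h3 := spow_mul_eq_zero h1 1 h2
  rw [spow_one h1] at h3
  have h4 := congrArg conjTranspose h3
  rw [conjTranspose_mul, h1.1.eq, conjTranspose_zero] at h4
  rw [Matrix.mul_assoc, h4, Matrix.mul_zero]

lemma trace_spow_compress_nonneg {X : Matrix (A × Y) D ℂ} {T : Matrix Y Y ℂ} {κ : Matrix D D ℂ}
    (hT : T.PosSemidef) (hκ : κ.PosSemidef) (a : ℝ) : 0 ≤ (spow κ a * compress X T a).trace.re := by
  have hC := compress_posSemidef hT X a
  rw [trace_spow_mul hκ.1 hC.1]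
  exact Finset.sum_nonneg fun x _ => mul_nonneg (mul_nonneg (overlap_nonneg _ _ _ _ _)
    (sp_nonneg (hκ.eigenvalues_nonneg _))) (hC.eigenvalues_nonneg _)

lemma div_pos_of_mul_eq {a b c : ℝ} (habc : a * (b + c) = b * c) (ha0 : a ≠ 0)
    (h : 0 < (b * c) * (c * (b + c))) : 0 < c / a := by
  have h2 : 0 < c * a := by
    have e : c * a * (b + c) ^ 2 = (b * c) * (c * (b + c)) := by rw [← habc]; ring
    rw [← e] at h
    exact pos_of_mul_pos_left h (sq_nonneg _)
  rw [show c / a = c * a / a ^ 2 by field_simp]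
  positivity

/-- The signs give a/b = c/(b + c) < 0, so x = 0 lies between a/b and 1, with weights c/a and -c/b.
The norm at 0 is the one being bounded, so it must be identified exactly, whereas upper bounds
suffice elsewhere. -/
lemma logb_chain_zero {X : Matrix (A × Y) D ℂ} {T : Matrix Y Y ℂ} {κ : Matrix D D ℂ}
    (hT : T.PosSemidef) (hκ : κ.PosSemidef) {a b c : ℝ} (habc : a * (b + c) = b * c)
    (ha0 : a ≠ 0) (hb0 : b ≠ 0) (hc0 : c ≠ 0)
    (hb : -1 < b) (hb1 : b < 1) (hneg : b * c < 0) (hcs : c * (b + c) < 0)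
    (hC : 0 < sandwich c (traceFst (X * Xᴴ)) T)
    (hN : 0 < trpow (margin X κ b) (1 / (1 + b)) ^ (1 + b))
    (h : spow ((1 : Matrix A A ℂ) ⊗ₖ T) (-c / 2) * X * spow κ 0 =
      spow ((1 : Matrix A A ℂ) ⊗ₖ T) (-c / 2) * X) :
    0 ≤ c * (1 / a * Real.logb 2 (spow κ a * compress X T a).trace.re -
      1 / b * Real.logb 2 (trpow (margin X κ b) (1 / (1 + b)) ^ (1 + b)) -
      1 / c * Real.logb 2 (sandwich c (traceFst (X * Xᴴ)) T)) := by
  have hca : c / a = 1 + c / b := by field_simp; linarith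
  have hab : a / b + a / c = 1 := by field_simp; linarith
  have hcap : 0 < c / a := div_pos_of_mul_eq habc ha0 (mul_pos_of_neg_of_neg hneg hcs)
  have hcb : c / b < 0 := by
    rw [show c / b = b * c / b ^ 2 by field_simp]
    exact div_neg_of_neg_of_pos hneg (by positivity)
  have hL0 := trace_spow_compress_nonneg (X := X) hT hκ a
  have hθ := snorm_interpFamily_theta X hT hκ (a := a) (b := b) (c := c) (x := a / b)
    (by field_simp) (by
      rw [show 1 - a / b = a / c by linarith]; field_simp)
  have hC' := snorm_interpFamily_zero (κ := κ) hT b h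
  have hN' := snorm_interpFamily_one_le X hT hκ c hb hb1.le
  have hint := snorm_interpFamily_le X hT hκ b c (x₀ := a / b) (x₁ := 1) (x := 0)
    (t := -(c / b)) (e₀ := 1 / 2) (e₁ := (1 + b) / 2) (e := (1 - c) / 2) (by linarith)
    (by linarith) (by rw [sub_neg_eq_add, ← hca]; field_simp; ring) (by field_simp; ring)
    (by norm_num) (by norm_num) (by linarith) (by linarith)
  have hsq := sq_le_rpow_mul_rpow (snorm_nonneg _ _) (snorm_nonneg _ _) (snorm_nonneg _ _) hint
  rw [hθ, hC', sub_neg_eq_add, ← hca] at hsq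
  have hn0 := sq_nonneg (snorm (1 / ((1 + b) / 2)) (interpFamily X T κ b c 1))
  generalize snorm (1 / ((1 + b) / 2)) (interpFamily X T κ b c 1) ^ 2 = n' at hN' hsq hn0
  generalize (spow κ a * compress X T a).trace.re = L at *
  generalize trpow (margin X κ b) (1 / (1 + b)) ^ (1 + b) = N at *
  generalize sandwich c (traceFst (X * Xᴴ)) T = C at *
  have hsq2 : C ≤ L ^ (c / a) * N ^ (-(c / b)) := by
    refine hsq.trans (mul_le_mul_of_nonneg_left ?_ (Real.rpow_nonneg hL0 _))
    exact Real.rpow_le_rpow hn0 hN' (by linarith)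
  -- If L vanished, the interpolation bound would force C = 0, as c/a > 0.
  have hLpos : 0 < L := by
    refine lt_of_le_of_ne hL0 fun hz => ?_
    rw [← hz, Real.zero_rpow hcap.ne', zero_mul] at hsq2
    exact absurd hC (not_lt.2 hsq2)
  have hlog := logb_le_of_le_rpow_mul_rpow hC hLpos hN hsq2
  generalize Real.logb 2 L = l at *
  generalize Real.logb 2 N = ν at *
  generalize Real.logb 2 C = γ at *
  have e1 : c * (1 / a * l - 1 / b * ν - 1 / c * γ) = c / a * l + -(c / b) * ν - γ := by
    field_simp; ring
  rw [e1]; linarith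

/-- Now a/b = c/(b + c) > 1, so x = 1 lies between 0 and a/b, with weights -b/c and b/a. Exactness
is required at 1, hence the support condition on T. -/
lemma logb_chain_one {X : Matrix (A × Y) D ℂ} {T : Matrix Y Y ℂ} {κ : Matrix D D ℂ}
    (hT : T.PosSemidef) (hκ : κ.PosSemidef) {a b c : ℝ} (habc : a * (b + c) = b * c)
    (ha0 : a ≠ 0) (hb0 : b ≠ 0) (hc0 : c ≠ 0) (hc : -1 ≤ c) (hc1 : c < 1)
    (hneg : b * c < 0) (hbs : b * (b + c) < 0)
    (hC : 0 < sandwich c (traceFst (X * Xᴴ)) T)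
    (hN : 0 < trpow (margin X κ b) (1 / (1 + b)) ^ (1 + b))
    (h : spow ((1 : Matrix A A ℂ) ⊗ₖ T) 0 * X = X) :
    0 ≤ b * (1 / a * Real.logb 2 (spow κ a * compress X T a).trace.re -
      1 / b * Real.logb 2 (trpow (margin X κ b) (1 / (1 + b)) ^ (1 + b)) -
      1 / c * Real.logb 2 (sandwich c (traceFst (X * Xᴴ)) T)) := by
  have hba : b / a = 1 + b / c := by field_simp; linarith
  have hab : a / b + a / c = 1 := by field_simp; linarith
  have hbap : 0 < b / a := div_pos_of_mul_eq (b := c) (by linarith) ha0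
    (by rw [mul_comm c b, add_comm c b]; exact mul_pos_of_neg_of_neg hneg hbs)
  have hbcn : b / c < 0 := by
    rw [show b / c = b * c / c ^ 2 by field_simp]
    exact div_neg_of_neg_of_pos hneg (by positivity)
  have hL0 := trace_spow_compress_nonneg (X := X) hT hκ a
  have hθ := snorm_interpFamily_theta X hT hκ (a := a) (b := b) (c := c) (x := a / b)
    (by field_simp) (by
      rw [show 1 - a / b = a / c by linarith]; field_simp)
  have hC' := snorm_interpFamily_zero_le X hT hκ b hc hc1
  have hN' := snorm_interpFamily_one (κ := κ) hT hκ b c h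
  have hint := snorm_interpFamily_le X hT hκ b c (x₀ := 0) (x₁ := a / b) (x := 1)
    (t := b / a) (e₀ := (1 - c) / 2) (e₁ := 1 / 2) (e := (1 + b) / 2) hbap.le
    (by linarith) (by field_simp; ring) (by rw [hba]; field_simp; ring) (by linarith)
    (by linarith) (by norm_num) (by norm_num)
  have hsq := sq_le_rpow_mul_rpow (snorm_nonneg _ _) (snorm_nonneg _ _) (snorm_nonneg _ _) hint
  rw [hθ, hN', show 1 - b / a = -(b / c) by rw [hba]; ring] at hsq
  have hn0 := sq_nonneg (snorm (1 / ((1 - c) / 2)) (interpFamily X T κ b c 0))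
  generalize snorm (1 / ((1 - c) / 2)) (interpFamily X T κ b c 0) ^ 2 = n' at hC' hsq hn0
  generalize (spow κ a * compress X T a).trace.re = L at *
  generalize trpow (margin X κ b) (1 / (1 + b)) ^ (1 + b) = N at *
  generalize sandwich c (traceFst (X * Xᴴ)) T = C at *
  have hsq2 : N ≤ C ^ (-(b / c)) * L ^ (b / a) := by
    refine hsq.trans (mul_le_mul_of_nonneg_right ?_ (Real.rpow_nonneg hL0 _))
    exact Real.rpow_le_rpow hn0 hC' (by linarith)
  have hLpos : 0 < L := by
    refine lt_of_le_of_ne hL0 fun hz => ?_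
    rw [← hz, Real.zero_rpow hbap.ne', mul_zero] at hsq2
    exact absurd hN (not_lt.2 hsq2)
  have hlog := logb_le_of_le_rpow_mul_rpow hN hC hLpos hsq2
  generalize Real.logb 2 L = l at *
  generalize Real.logb 2 N = ν at *
  generalize Real.logb 2 C = γ at *
  have e1 : b * (1 / a * l - 1 / b * ν - 1 / c * γ) = -(b / c) * γ + b / a * l - ν := by
    field_simp; ring
  rw [e1]; linarith

/-- For b and c of equal sign 0 < a/b < 1, and the middle point carries L with weights a/c and a/b;
upper bounds suffice at both ends. -/
lemma logb_chain_theta {X : Matrix (A × Y) D ℂ} {T : Matrix Y Y ℂ} {κ : Matrix D D ℂ}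
    (hT : T.PosSemidef) (hκ : κ.PosSemidef) {a b c : ℝ} (habc : a * (b + c) = b * c)
    (ha0 : a ≠ 0) (hb0 : b ≠ 0) (hc0 : c ≠ 0) (hc : -1 ≤ c) (hc1 : c < 1)
    (hb : -1 < b) (hb1 : b < 1) (hpos : 0 < b * c)
    (hC : 0 < sandwich c (traceFst (X * Xᴴ)) T)
    (hN : 0 < trpow (margin X κ b) (1 / (1 + b)) ^ (1 + b))
    (hL : 0 < (spow κ a * compress X T a).trace.re) :
    0 ≤ a * (1 / b * Real.logb 2 (trpow (margin X κ b) (1 / (1 + b)) ^ (1 + b)) +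
      1 / c * Real.logb 2 (sandwich c (traceFst (X * Xᴴ)) T) -
      1 / a * Real.logb 2 (spow κ a * compress X T a).trace.re) := by
  have hab : a / b + a / c = 1 := by field_simp; linarith
  have hca : c / a = 1 + c / b := by field_simp; linarith
  have hba : b / a = 1 + b / c := by field_simp; linarith
  have hac' : 0 < a / c := by
    have h1 : 0 < c / b := by
      rw [show c / b = b * c / b ^ 2 by field_simp]; positivity
    rw [← inv_pos, inv_div, hca]; linarith
  have hab' : 0 < a / b := by
    have h1 : 0 < b / c := by
      rw [show b / c = b * c / c ^ 2 by field_simp]; positivity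
    rw [← inv_pos, inv_div, hba]; linarith
  have hθ := snorm_interpFamily_theta X hT hκ (a := a) (b := b) (c := c) (x := a / b)
    (by field_simp) (by
      rw [show 1 - a / b = a / c by linarith]; field_simp)
  have hC' := snorm_interpFamily_zero_le X hT hκ b hc hc1
  have hN' := snorm_interpFamily_one_le X hT hκ c hb hb1.le
  have hint := snorm_interpFamily_le X hT hκ b c (x₀ := 0) (x₁ := 1) (x := a / b)
    (t := a / b) (e₀ := (1 - c) / 2) (e₁ := (1 + b) / 2) (e := 1 / 2) hab'.le
    (by linarith) (by ring) (by
      rw [show 1 - a / b = a / c by linarith]; field_simp; linarith) (by linarith) (by linarith)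
    (by linarith) (by linarith)
  have hsq := sq_le_rpow_mul_rpow (snorm_nonneg _ _) (snorm_nonneg _ _) (snorm_nonneg _ _) hint
  rw [hθ, show 1 - a / b = a / c by linarith] at hsq
  have hn0 := sq_nonneg (snorm (1 / ((1 - c) / 2)) (interpFamily X T κ b c 0))
  have hn1 := sq_nonneg (snorm (1 / ((1 + b) / 2)) (interpFamily X T κ b c 1))
  generalize snorm (1 / ((1 - c) / 2)) (interpFamily X T κ b c 0) ^ 2 = n' at hC' hsq hn0
  generalize snorm (1 / ((1 + b) / 2)) (interpFamily X T κ b c 1) ^ 2 = m' at hN' hsq hn1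
  generalize (spow κ a * compress X T a).trace.re = L at *
  generalize trpow (margin X κ b) (1 / (1 + b)) ^ (1 + b) = N at *
  generalize sandwich c (traceFst (X * Xᴴ)) T = C at *
  have hsq2 : L ≤ C ^ (a / c) * N ^ (a / b) :=
    hsq.trans (mul_le_mul (Real.rpow_le_rpow hn0 hC' hac'.le) (Real.rpow_le_rpow hn1 hN' hab'.le)
      (Real.rpow_nonneg hn1 _) (Real.rpow_nonneg hC.le _))
  have hlog := logb_le_of_le_rpow_mul_rpow hL hC hN hsq2
  generalize Real.logb 2 L = l at *
  generalize Real.logb 2 N = ν at *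
  generalize Real.logb 2 C = γ at *
  have e1 : a * (1 / b * ν + 1 / c * γ - 1 / a * l) = a / c * γ + a / b * ν - l := by
    field_simp; ring
  rw [e1]; linarith

/-- The chain inequality for a fixed operator `κ` on the purifying system. -/
lemma chain_logb {X : Matrix (A × Y) D ℂ} {T : Matrix Y Y ℂ} {κ : Matrix D D ℂ}
    (hT : T.PosSemidef) (hκ : κ.PosSemidef) {a b c : ℝ} (habc : a * (b + c) = b * c)
    (hb0 : b ≠ 0) (hc0 : c ≠ 0) (hbc : b + c ≠ 0) (hc : -1 ≤ c) (hc1 : c < 1)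
    (hb : -1 < b) (hb1 : b < 1)
    (hC : 0 < sandwich c (traceFst (X * Xᴴ)) T)
    (hN : 0 < trpow (margin X κ b) (1 / (1 + b)) ^ (1 + b))
    (hL : 0 < b * c → 0 < (spow κ a * compress X T a).trace.re)
    (h1 : b * c < 0 → 0 < c * (b + c) → spow ((1 : Matrix A A ℂ) ⊗ₖ T) 0 * X = X)
    (h0 : b * c < 0 → c * (b + c) < 0 → spow ((1 : Matrix A A ℂ) ⊗ₖ T) (-c / 2) * X * spow κ 0 =
      spow ((1 : Matrix A A ℂ) ⊗ₖ T) (-c / 2) * X) :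
    (0 < b + c → -(1 / b) * Real.logb 2 (trpow (margin X κ b) (1 / (1 + b)) ^ (1 + b)) +
        -(1 / c) * Real.logb 2 (sandwich c (traceFst (X * Xᴴ)) T) ≤
        -(1 / a) * Real.logb 2 (spow κ a * compress X T a).trace.re) ∧
    (b + c < 0 → -(1 / a) * Real.logb 2 (spow κ a * compress X T a).trace.re ≤
      -(1 / b) * Real.logb 2 (trpow (margin X κ b) (1 / (1 + b)) ^ (1 + b)) +
        -(1 / c) * Real.logb 2 (sandwich c (traceFst (X * Xᴴ)) T)) := by
  have ha0 : a ≠ 0 := by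
    rintro rfl
    rw [zero_mul] at habc
    exact mul_ne_zero hb0 hc0 habc.symm
  -- Each interpolation bound carries the factor c, b or a of its middle point; dividing by it turns
  -- the sign of b + c into the direction of the inequality.
  rcases lt_or_gt_of_ne (mul_ne_zero hb0 hc0) with hneg | hpos
  · rcases lt_or_gt_of_ne (mul_ne_zero hc0 hbc) with hcs | hcs
    · have e2 := logb_chain_zero hT hκ habc ha0 hb0 hc0 hb hb1 hneg hcs hC hN (h0 hneg hcs)
      refine ⟨fun hs => ?_, fun hs => ?_⟩
      · have hcneg : c < 0 := by nlinarith
        have := nonpos_of_mul_nonneg_right e2 hcneg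
        linarith
      · have hcpos : 0 < c := by nlinarith
        have := nonneg_of_mul_nonneg_right e2 hcpos
        linarith
    · have hbs : b * (b + c) < 0 := by
        have h6 : (b * c) * (b + c) ^ 2 = (b * (b + c)) * (c * (b + c)) := by ring
        have h7 : (b * c) * (b + c) ^ 2 < 0 := mul_neg_of_neg_of_pos hneg (by positivity)
        rw [h6] at h7
        exact neg_of_mul_neg_left h7 hcs.le
      have e2 := logb_chain_one hT hκ habc ha0 hb0 hc0 hc hc1 hneg hbs hC hN (h1 hneg hcs)
      refine ⟨fun hs => ?_, fun hs => ?_⟩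
      · have hbneg : b < 0 := by nlinarith
        have := nonpos_of_mul_nonneg_right e2 hbneg
        linarith
      · have hbpos : 0 < b := by nlinarith
        have := nonneg_of_mul_nonneg_right e2 hbpos
        linarith
  · have e2 := logb_chain_theta hT hκ habc ha0 hb0 hc0 hc hc1 hb hb1 hpos hC hN (hL hpos)
    have e3 : 0 < a * (b + c) := by rw [habc]; exact hpos
    refine ⟨fun hs => ?_, fun hs => ?_⟩
    · have hapos : 0 < a := pos_of_mul_pos_left e3 hs.le
      have := nonneg_of_mul_nonneg_right e2 hapos
      linarith
    · have haneg : a < 0 := by nlinarith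
      have := nonpos_of_mul_nonneg_right e2 haneg
      linarith

end Chain

/-! ### The chain rule when neither β nor γ is one. -/

section GenericChain

variable {A Y D : Type*} [Fintype A] [DecidableEq A] [Fintype Y] [DecidableEq Y]
  [Fintype D] [DecidableEq D]

lemma mul_spow_eq_zero_of_margin {X : Matrix (A × Y) D ℂ} {κ : Matrix D D ℂ} (hκ : κ.PosSemidef)
    {b : ℝ} (h : margin X κ b = 0) (r : ℝ) : X * spow κ r = 0 := by
  rw [margin_eq hκ, self_mul_conjTranspose_eq_zero, ← reshape_mul] at h
  have h1 : X * spow κ (b / 2) = 0 := by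
    ext p d
    exact congrFun (congrFun h p.2) (p.1, d)
  exact mul_spow_eq_zero hκ r h1

lemma trace_spow_compress_pos {X : Matrix (A × Y) D ℂ} {T : Matrix Y Y ℂ} {κ : Matrix D D ℂ}
    (hT : T.PosSemidef) (hκ : κ.PosSemidef) {a : ℝ} (r s : ℝ)
    (h : spow ((1 : Matrix A A ℂ) ⊗ₖ T) r * X * spow κ s ≠ 0) :
    0 < (spow κ a * compress X T a).trace.re := by
  have h1 := one_kronecker_posSemidef (A := A) hT
  set M := spow ((1 : Matrix A A ℂ) ⊗ₖ T) (-a / 2) * X * spow κ (a / 2) with hM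
  have e : (spow κ a * compress X T a).trace = (Mᴴ * M).trace := by
    rw [hM, conjTranspose_mul _ (spow κ (a / 2)), (spow_isHermitian hκ _).eq, Matrix.mul_assoc,
      ← Matrix.mul_assoc _ _ (spow κ (a / 2)), ← compress_eq hT, trace_mul_comm (spow κ (a / 2)),
      Matrix.mul_assoc, spow_mul hκ, add_halves, trace_mul_comm]
  rw [e]
  refine re_trace_pos (posSemidef_conjTranspose_mul_self M) fun h0 => h ?_
  rw [conjTranspose_mul_self_eq_zero, hM] at h0
  have h2 := mul_spow_eq_zero hκ s h0
  rw [Matrix.mul_assoc] at h2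
  rw [Matrix.mul_assoc]
  exact spow_mul_eq_zero h1 r h2

lemma margin_mul_spow_zero {X : Matrix (A × Y) D ℂ} {σ : Matrix Y Y ℂ} {κ : Matrix D D ℂ}
    (hσ : σ.PosSemidef) (h : Dominates ((1 : Matrix A A ℂ) ⊗ₖ σ) (X * Xᴴ)) (b : ℝ) :
    margin X κ b * spow σ 0 = margin X κ b := by
  have h1 := one_kronecker_posSemidef (A := A) hσ
  rw [dominates_iff h1] at h
  have h2 : Xᴴ * spow ((1 : Matrix A A ℂ) ⊗ₖ σ) 0 = Xᴴ := by
    have h3 : X * Xᴴ * (spow ((1 : Matrix A A ℂ) ⊗ₖ σ) 0 - 1) = 0 := by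
      rw [Matrix.mul_sub, h, Matrix.mul_one, sub_self]
    have h4 := conjTranspose_mul_self_eq_zero.1
      (show (Xᴴ * (spow ((1 : Matrix A A ℂ) ⊗ₖ σ) 0 - 1))ᴴ *
        (Xᴴ * (spow ((1 : Matrix A A ℂ) ⊗ₖ σ) 0 - 1)) = 0 by
          rw [conjTranspose_mul, conjTranspose_conjTranspose, Matrix.mul_assoc,
            ← Matrix.mul_assoc X, h3, Matrix.mul_zero])
    rwa [Matrix.mul_sub, Matrix.mul_one, sub_eq_zero] at h4
  rw [margin, ← traceFst_mul_one_kronecker, ← spow_one_kronecker hσ.1, Matrix.mul_assoc, h2]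

lemma neg_one_div_mul_logb_le_of_pos {b x y : ℝ} (hb : 0 < b) (hx : 0 < x) (h : x ≤ y) :
    -(1 / b) * Real.logb 2 y ≤ -(1 / b) * Real.logb 2 x :=
  mul_le_mul_of_nonpos_left (Real.logb_le_logb_of_le one_lt_two hx h)
    (neg_nonpos.2 (by positivity))

lemma neg_one_div_mul_logb_le_of_neg {b x y : ℝ} (hb : b < 0) (hx : 0 < x) (h : x ≤ y) :
    -(1 / b) * Real.logb 2 x ≤ -(1 / b) * Real.logb 2 y :=
  mul_le_mul_of_nonneg_left (Real.logb_le_logb_of_le one_lt_two hx h)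
    (neg_nonneg.2 (one_div_nonpos.2 hb.le))

lemma compress_mul_spow_zero {X : Matrix (A × Y) D ℂ} {κ : Matrix D D ℂ}
    (h : X * spow κ 0 = X) (σ : Matrix Y Y ℂ) (b : ℝ) :
    compress X σ b * spow κ 0 = compress X σ b := by
  rw [compress, Matrix.mul_assoc, h]

/-- With κ the optimizer for `sandwich a`, the trace L equals `sandwich a` exactly. The term of
order b is then compared with N(κ) for the given σ by weak duality, so no minimax is needed. -/
lemma sandwich_chain_of_pos {X : Matrix (A × Y) D ℂ} {T σ : Matrix Y Y ℂ} (hT : T.PosSemidef)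
    {a b c : ℝ} (habc : a * (b + c) = b * c) (hb0 : b ≠ 0) (hc0 : c ≠ 0) (hbc : 0 < b + c)
    (ha1 : a < 1) (hc : -1 ≤ c) (hc1 : c < 1) (hb : -1 < b) (hb1 : b < 1)
    (hne : X * Xᴴ * ((1 : Matrix A A ℂ) ⊗ₖ T) ≠ 0)
    (hsupp : (a < 0 ∧ c < 0) ∨ spow ((1 : Matrix A A ℂ) ⊗ₖ T) 0 * X = X)
    (hσ : Admissible X b σ) :
    -(1 / b) * Real.logb 2 (sandwich b (X * Xᴴ) ((1 : Matrix A A ℂ) ⊗ₖ σ)) +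
        -(1 / c) * Real.logb 2 (sandwich c (traceFst (X * Xᴴ)) T) ≤
      -(1 / a) * Real.logb 2 (sandwich a (X * Xᴴ) ((1 : Matrix A A ℂ) ⊗ₖ T)) := by
  have h1 := one_kronecker_posSemidef (A := A) hT
  have hCp := compress_posSemidef hT X a
  have hC0 : compress X T a ≠ 0 := fun h => hne (mul_one_kronecker_eq_zero hT h)
  obtain ⟨hκ, hκ1⟩ := optimizer_isDensity hCp hC0 (1 / (1 - a))
  have hL := trace_spow_optimizer hCp hC0 ha1.ne
  have hκ0 := spow_zero_optimizer hCp hC0 (1 / (1 - a))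
  rw [← sandwich_eq_compress hT] at hL
  set κ := optimizer (compress X T a) (1 / (1 - a)) with hκdef
  have hκ1' : κ.trace.re ≤ 1 := by rw [hκ1, Complex.one_re]
  -- The optimizer has the support of X†(1 ⊗ T^{-a})X, which contains the range of the adjoint of (1
  -- ⊗ T)^{-a/2} X; the exponent is then exchanged for r.
  have hr : ∀ r, spow ((1 : Matrix A A ℂ) ⊗ₖ T) r * X * spow κ 0 =
      spow ((1 : Matrix A A ℂ) ⊗ₖ T) r * X := by
    intro r
    have h2 := mul_spow_zero_conjTranspose_mul (spow ((1 : Matrix A A ℂ) ⊗ₖ T) (-a / 2) * X)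
    rw [← compress_eq hT, ← hκ0] at h2
    have h3 : spow ((1 : Matrix A A ℂ) ⊗ₖ T) (-a / 2) * (X * spow κ 0 - X) = 0 := by
      rw [Matrix.mul_sub, ← Matrix.mul_assoc, h2, sub_self]
    have h4 := spow_mul_eq_zero h1 r h3
    rwa [Matrix.mul_sub, ← Matrix.mul_assoc, sub_eq_zero] at h4
  have hLpos := sandwich_pos (posSemidef_self_mul_conjTranspose X) h1 hne a
  have hXs : b * c < 0 → 0 < c → spow ((1 : Matrix A A ℂ) ⊗ₖ T) 0 * X = X := fun _ hcpos =>
    hsupp.resolve_left fun h => absurd h.2 hcpos.le.not_gt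
  have hN0 : margin X κ b ≠ 0 := by
    intro h
    have h2 := congrArg conjTranspose (mul_spow_eq_zero_of_margin hκ h a)
    rw [conjTranspose_mul, (spow_isHermitian hκ _).eq, conjTranspose_zero] at h2
    rw [← hL, compress, ← Matrix.mul_assoc, ← Matrix.mul_assoc, h2, Matrix.zero_mul,
      Matrix.zero_mul, trace_zero, Complex.zero_re] at hLpos
    exact lt_irrefl _ hLpos
  have hNp := margin_posSemidef hκ X b
  have hN : 0 < trpow (margin X κ b) (1 / (1 + b)) ^ (1 + b) :=
    Real.rpow_pos_of_pos (trpow_pos hNp hN0 _) _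
  have hC := sandwich_pos (traceFst_posSemidef (posSemidef_self_mul_conjTranspose X)) hT
    (traceFst_mul_ne_zero hT hne) c
  have hchain := (chain_logb hT hκ habc hb0 hc0 hbc.ne' hc hc1 hb hb1 hC hN
    (fun _ => hL ▸ hLpos) (fun h2 h3 => hXs h2 (pos_of_mul_pos_left h3 hbc.le))
    (fun _ _ => hr _)).1 hbc
  rw [hL] at hchain
  refine le_trans (add_le_add_left ?_ _) hchain
  obtain ⟨⟨hσp, hσ1⟩, hσne, hσd⟩ := hσ
  have hσ1' : σ.trace.re ≤ 1 := by rw [hσ1, Complex.one_re]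
  have hB := sandwich_pos (posSemidef_self_mul_conjTranspose X)
    (one_kronecker_posSemidef (A := A) hσp) hσne b
  rw [sandwich_eq_compress hσp] at hB ⊢
  have htr := congrArg Complex.re (trace_spow_compress X σ κ b)
  -- Weak duality uses two Hölder bounds, on D with κ and on Y with σ, joined by the common trace
  -- `htr`. For b > 0 one is direct and one reverse, giving N ≤ `sandwich b`; for b < 0 the
  -- inequality is reversed.
  rcases lt_or_gt_of_ne hb0 with hbn | hbp
  · have hcp : 0 < c := by linarith
    have hX0 : X * spow κ 0 = X := by
      have h2 := hr 0
      rwa [hXs (mul_neg_of_neg_of_pos hbn hcp) hcp] at h2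
    refine neg_one_div_mul_logb_le_of_neg hbn hB ?_
    refine (le_trace_spow_mul hκ (compress_posSemidef hσp X b) hκ1'
      (compress_mul_spow_zero hX0 σ b) hbn).trans ?_
    rw [htr]
    have h2 := trace_spow_mul_le hσp hNp hσ1' (s := -b) (by linarith) (by linarith)
    rwa [sub_neg_eq_add] at h2
  · refine neg_one_div_mul_logb_le_of_pos hbp hN ?_
    refine le_trans ?_ (trace_spow_mul_le hκ (compress_posSemidef hσp X b) hκ1' hbp hb1)
    rw [htr]
    have h2 := le_trace_spow_mul hσp hNp hσ1'
      (margin_mul_spow_zero hσp (hσd.resolve_right hbp.le.not_gt) b) (s := -b) (by linarith)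
    rwa [sub_neg_eq_add] at h2

/-- Unifies the two minimax lemmas: v = 2^{-bh'} solves -(1/b) log v = h', and the sign of b decides
whether v is an upper or a lower threshold. -/
lemma exists_optimizer_logb {X : Matrix (A × Y) D ℂ} (hX : X ≠ 0) {b h' : ℝ} (hb0 : b ≠ 0)
    (hb : -1 < b) (hb1 : b < 1)
    (h : ∀ σ, Admissible X b σ →
      -(1 / b) * Real.logb 2 (sandwich b (X * Xᴴ) ((1 : Matrix A A ℂ) ⊗ₖ σ)) < h') :
    ∃ κ : Matrix D D ℂ, κ.PosSemidef ∧ κ.trace.re ≤ 1 ∧ (b < 0 → spow κ 0 = 1) ∧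
      0 < trpow (margin X κ b) (1 / (1 + b)) ^ (1 + b) ∧
      -(1 / b) * Real.logb 2 (trpow (margin X κ b) (1 / (1 + b)) ^ (1 + b)) ≤ h' := by
  have hv : (0 : ℝ) < 2 ^ (-b * h') := by positivity
  have hlv : Real.logb 2 ((2 : ℝ) ^ (-b * h')) = -b * h' :=
    Real.logb_rpow zero_lt_two (by norm_num)
  have hbv : -(1 / b) * (-b * h') = h' := by field_simp
  have hB : ∀ σ, Admissible X b σ → 0 < sandwich b (X * Xᴴ) ((1 : Matrix A A ℂ) ⊗ₖ σ) :=
    fun σ hσ => sandwich_pos (posSemidef_self_mul_conjTranspose X)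
      (one_kronecker_posSemidef (A := A) hσ.1.1) hσ.2.1 b
  rcases lt_or_gt_of_ne hb0 with hbn | hbp
  · obtain ⟨κ, hκ, hκ1, hκ0, hN⟩ := exists_optimizer_of_neg hX hbn hb hv fun σ hσ => by
      by_contra hcon
      have h2 := neg_one_div_mul_logb_le_of_neg hbn hv (not_lt.1 hcon)
      rw [hlv, hbv] at h2
      exact absurd (h σ hσ) (not_lt.2 h2)
    have hN0 : 0 < trpow (margin X κ b) (1 / (1 + b)) ^ (1 + b) :=
      Real.rpow_pos_of_pos (trpow_pos (margin_posSemidef hκ X b) (margin_ne_zero hX hκ hκ0 b) _) _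
    refine ⟨κ, hκ, hκ1, fun _ => hκ0, hN0, ?_⟩
    have h2 := neg_one_div_mul_logb_le_of_neg hbn hN0 hN.le
    rwa [hlv, hbv] at h2
  · obtain ⟨κ, hκ, hκ1, hN⟩ := exists_optimizer_of_pos hX hbp hb1 (v := 2 ^ (-b * h'))
      fun σ hσ => by
        by_contra hcon
        have h2 := neg_one_div_mul_logb_le_of_pos hbp (hB σ hσ) (not_lt.1 hcon)
        rw [hlv, hbv] at h2
        exact absurd (h σ hσ) (not_lt.2 h2)
    refine ⟨κ, hκ, hκ1, fun hbn => absurd hbn hbp.le.not_gt, hv.trans_le hN, ?_⟩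
    have h2 := neg_one_div_mul_logb_le_of_pos hbp hv hN
    rwa [hlv, hbv] at h2

/-- A single κ from minimax makes the N-term at most h'. Hölder for this κ, which need not be
optimal at order a, gives the direction required between `sandwich a` and L. -/
lemma sandwich_chain_of_neg {X : Matrix (A × Y) D ℂ} {T : Matrix Y Y ℂ} (hT : T.PosSemidef)
    {a b c h' : ℝ} (habc : a * (b + c) = b * c) (hb0 : b ≠ 0) (hc0 : c ≠ 0) (hbc : b + c < 0)
    (ha1 : a < 1) (hc : -1 ≤ c) (hc1 : c < 1) (hb : -1 < b) (hb1 : b < 1)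
    (hne : X * Xᴴ * ((1 : Matrix A A ℂ) ⊗ₖ T) ≠ 0)
    (hsupp : (a < 0 ∧ c < 0) ∨ spow ((1 : Matrix A A ℂ) ⊗ₖ T) 0 * X = X)
    (h : ∀ σ, Admissible X b σ →
      -(1 / b) * Real.logb 2 (sandwich b (X * Xᴴ) ((1 : Matrix A A ℂ) ⊗ₖ σ)) < h') :
    -(1 / a) * Real.logb 2 (sandwich a (X * Xᴴ) ((1 : Matrix A A ℂ) ⊗ₖ T)) ≤
      h' + -(1 / c) * Real.logb 2 (sandwich c (traceFst (X * Xᴴ)) T) := by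
  have h1 := one_kronecker_posSemidef (A := A) hT
  have hX : X ≠ 0 := by rintro rfl; simp at hne
  obtain ⟨κ, hκ, hκ1, hκ0, hN, hNh⟩ := exists_optimizer_logb hX hb0 hb hb1 h
  have hCp := compress_posSemidef hT X a
  have hLpos := sandwich_pos (posSemidef_self_mul_conjTranspose X) h1 hne a
  have hC := sandwich_pos (traceFst_posSemidef (posSemidef_self_mul_conjTranspose X)) hT
    (traceFst_mul_ne_zero hT hne) c
  have hs : 0 < a → spow ((1 : Matrix A A ℂ) ⊗ₖ T) 0 * X = X := fun h2 =>
    hsupp.resolve_left fun h3 => absurd h3.1 h2.le.not_gt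
  have ha0 : a ≠ 0 := by
    rintro rfl
    rw [zero_mul] at habc
    exact mul_ne_zero hb0 hc0 habc.symm
  have hbneg : a < 0 → b < 0 := by
    intro h2
    have h3 : 0 < b * c := by rw [← habc]; exact mul_pos_of_neg_of_neg h2 hbc
    nlinarith
  have hle : a < 0 → sandwich a (X * Xᴴ) ((1 : Matrix A A ℂ) ⊗ₖ T) ≤
      (spow κ a * compress X T a).trace.re := by
    intro h2
    rw [sandwich_eq_compress hT]
    exact le_trace_spow_mul hκ hCp hκ1 (by rw [hκ0 (hbneg h2), Matrix.mul_one]) h2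
  have hsign : b * c < 0 → 0 < a := by
    intro h2
    rw [← habc] at h2
    exact pos_of_mul_neg_left h2 hbc.le
  have hL : 0 < (spow κ a * compress X T a).trace.re := by
    rcases lt_or_gt_of_ne ha0 with han | hap
    · exact hLpos.trans_le (hle han)
    · refine trace_spow_compress_pos hT hκ 0 0 ?_
      rw [hs hap]
      rcases lt_or_gt_of_ne hb0 with hbn | hbp
      · rwa [hκ0 hbn, Matrix.mul_one]
      · intro h2
        have h3 : margin X κ b = 0 := by
          rw [margin, mul_spow_eq_zero hκ b h2, Matrix.zero_mul]
          ext i j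
          simp [traceFst]
        rw [h3, trpow_zero_matrix, Real.zero_rpow (by linarith)] at hN
        exact lt_irrefl _ hN
  have hchain := (chain_logb hT hκ habc hb0 hc0 hbc.ne hc hc1 hb hb1 hC hN
    (fun _ => hL) (fun h2 _ => hs (hsign h2)) (fun h2 h3 => by
      have hcp : 0 < c := by nlinarith
      rw [hκ0 (by nlinarith), Matrix.mul_one])).2 hbc
  refine le_trans ?_ (hchain.trans (add_le_add_left hNh _))
  rcases lt_or_gt_of_ne ha0 with han | hap
  · exact neg_one_div_mul_logb_le_of_neg han hLpos (hle han)
  · refine neg_one_div_mul_logb_le_of_pos hap hL ?_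
    rw [sandwich_eq_compress hT]
    exact trace_spow_mul_le hκ hCp hκ1 hap ha1

end GenericChain

/-! ### Comparison of all orders with order one, by Jensen and Klein. -/

section OrderOne

lemma sum_mul_logb_le {ι : Type*} [Fintype ι] {w x : ι → ℝ} (hw : ∀ i, 0 ≤ w i)
    (hw1 : ∑ i, w i = 1) (hx : ∀ i, w i ≠ 0 → 0 < x i) :
    ∑ i, w i * Real.logb 2 (x i) ≤ Real.logb 2 (∑ i, w i * x i) := by
  -- Values with zero weight may be nonpositive; replacing them by 1 keeps all points in the domain
  -- of concavity without changing the sums.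
  have h := strictConcaveOn_log_Ioi.concaveOn.le_map_sum (t := Finset.univ) (w := w)
    (p := fun i => if w i = 0 then 1 else x i) (fun i _ => hw i) hw1 (fun i _ => by
      by_cases h0 : w i = 0
      · simp [h0]
      · simpa [h0] using hx i h0)
  have e1 : ∀ i, w i • Real.log (if w i = 0 then 1 else x i) = w i * Real.log (x i) := by
    intro i
    split_ifs with h0
    · simp [h0]
    · rfl
  have e2 : ∀ i, w i • (if w i = 0 then 1 else x i) = w i * x i := by
    intro i
    split_ifs with h0
    · simp [h0]
    · rfl
  simp only [e1, e2] at h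
  simp only [Real.logb, mul_div_assoc', ← Finset.sum_div]
  exact div_le_div_of_nonneg_right h (Real.log_pos one_lt_two).le

variable {n m : Type*} [Fintype n] [DecidableEq n] [Fintype m] [DecidableEq m]

lemma cfc_one_eq {H : Matrix n n ℂ} (hH : H.IsHermitian) : cfc (fun _ : ℝ => (1 : ℝ)) H = 1 := by
  rw [cfc_eq_fc hH]
  simp only [Complex.ofReal_one]
  exact fc_one hH

lemma re_trace_cfc_mul_cfc {H : Matrix n n ℂ} {K : Matrix m m ℂ} (hH : H.IsHermitian)
    (hK : K.IsHermitian) (M : Matrix n m ℂ) (f g : ℝ → ℝ) :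
    (cfc f H * M * cfc g K * Mᴴ).trace.re = ∑ x : n × m,
      overlap hH hK M x.1 x.2 * (f (hH.eigenvalues x.1) * g (hK.eigenvalues x.2)) := by
  rw [cfc_eq_fc hH, cfc_eq_fc hK, trace_fc_mul_fc, Fintype.sum_prod_type, Complex.re_sum]
  refine Finset.sum_congr rfl fun i _ => ?_
  rw [Complex.re_sum]
  refine Finset.sum_congr rfl fun j _ => ?_
  rw [← Complex.ofReal_mul, ← Complex.ofReal_mul, Complex.ofReal_re, mul_comm]

lemma overlap_eq_zero_right {H : Matrix n n ℂ} {K : Matrix m m ℂ} (hH : H.IsHermitian)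
    (hK : K.PosSemidef) {M : Matrix n m ℂ} (h : M * spow K 0 = M) (i : n) {j : m}
    (hj : hK.1.eigenvalues j = 0) : overlap hH hK.1 M i j = 0 := by
  have h1 := re_trace_cfc_mul_cfc hH hK.1 M (fun _ => 1) (fun _ => 1)
  have h2 := re_trace_cfc_mul_cfc hH hK.1 M (fun _ => 1) (sp 0)
  rw [cfc_one_eq hH, cfc_one_eq hK.1, Matrix.mul_one, Matrix.one_mul] at h1
  rw [cfc_one_eq hH, Matrix.one_mul, show cfc (sp 0) K = spow K 0 from rfl, h, h1,
    ← sub_eq_zero, ← Finset.sum_sub_distrib, Finset.sum_eq_zero_iff_of_nonneg] at h2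
  · have h3 := h2 (i, j) (Finset.mem_univ _)
    simpa [hj, sp_zero] using h3
  · intro x _
    rw [← mul_sub]
    refine mul_nonneg (overlap_nonneg _ _ _ _ _) ?_
    unfold sp
    split_ifs <;> simp

lemma overlap_conjTranspose {H : Matrix n n ℂ} {K : Matrix m m ℂ} (hH : H.IsHermitian)
    (hK : K.IsHermitian) (M : Matrix n m ℂ) (i : n) (j : m) :
    overlap hK hH Mᴴ j i = overlap hH hK M i j := by
  have e : star (hK.eigenvectorUnitary : Matrix m m ℂ) * Mᴴ *
      (hH.eigenvectorUnitary : Matrix n n ℂ) = (star (hH.eigenvectorUnitary : Matrix n n ℂ) * M *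
        (hK.eigenvectorUnitary : Matrix m m ℂ))ᴴ := by
    simp only [conjTranspose_mul, star_eq_conjTranspose, conjTranspose_conjTranspose,
      Matrix.mul_assoc]
  rw [overlap, overlap, e, conjTranspose_apply, norm_star]

lemma overlap_eq_zero_left {H : Matrix n n ℂ} {K : Matrix m m ℂ} (hH : H.PosSemidef)
    (hK : K.IsHermitian) {M : Matrix n m ℂ} (h : spow H 0 * M = M) {i : n} (j : m)
    (hi : hH.1.eigenvalues i = 0) : overlap hH.1 hK M i j = 0 := by
  rw [← overlap_conjTranspose]
  refine overlap_eq_zero_right hK hH ?_ j hi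
  have := congrArg conjTranspose h
  rwa [conjTranspose_mul, (spow_isHermitian hH _).eq] at this

/-- Jensen's inequality for the logarithm of an overlap of powers. -/
lemma trace_mlog_le_logb {κ : Matrix n n ℂ} {σ : Matrix m m ℂ} (hκ : κ.PosSemidef)
    (hσ : σ.PosSemidef) {M : Matrix n m ℂ} (hM : (M * Mᴴ).trace.re = 1)
    (h1 : spow κ 0 * M = M) (h2 : M * spow σ 0 = M) (c : ℝ) :
    c * ((mlog κ * (M * Mᴴ)).trace.re - (mlog σ * (Mᴴ * M)).trace.re) ≤
      Real.logb 2 (spow κ c * M * spow σ (-c) * Mᴴ).trace.re := by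
  have ew := re_trace_cfc_mul_cfc hκ.1 hσ.1 M (fun _ => 1) (fun _ => 1)
  have e1 := re_trace_cfc_mul_cfc hκ.1 hσ.1 M (Real.logb 2) (fun _ => 1)
  have e2 := re_trace_cfc_mul_cfc hκ.1 hσ.1 M (fun _ => 1) (Real.logb 2)
  have e3 := re_trace_cfc_mul_cfc hκ.1 hσ.1 M (sp c) (sp (-c))
  rw [cfc_one_eq hκ.1, cfc_one_eq hσ.1, Matrix.mul_one, Matrix.one_mul, hM] at ew
  rw [cfc_one_eq hσ.1, Matrix.mul_one, Matrix.mul_assoc] at e1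
  rw [cfc_one_eq hκ.1, Matrix.one_mul, Matrix.mul_assoc, trace_mul_comm, Matrix.mul_assoc] at e2
  simp only [mul_one, one_mul] at ew e1 e2
  have hpos : ∀ x : n × m, overlap hκ.1 hσ.1 M x.1 x.2 ≠ 0 →
      0 < hκ.1.eigenvalues x.1 ∧ 0 < hσ.1.eigenvalues x.2 := fun x hx =>
    ⟨lt_of_le_of_ne (hκ.eigenvalues_nonneg _) fun h => hx (overlap_eq_zero_left hκ hσ.1 h1 _ h.symm),
      lt_of_le_of_ne (hσ.eigenvalues_nonneg _) fun h =>
        hx (overlap_eq_zero_right hκ.1 hσ h2 _ h.symm)⟩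
  have hJ := sum_mul_logb_le (w := fun x : n × m => overlap hκ.1 hσ.1 M x.1 x.2)
    (x := fun x => sp c (hκ.1.eigenvalues x.1) * sp (-c) (hσ.1.eigenvalues x.2))
    (fun x => overlap_nonneg _ _ _ _ _) ew.symm
    (fun x hx => mul_pos (sp_pos (hpos x hx).1) (sp_pos (hpos x hx).2))
  change c * ((cfc (Real.logb 2) κ * (M * Mᴴ)).trace.re -
    (cfc (Real.logb 2) σ * (Mᴴ * M)).trace.re) ≤
      Real.logb 2 (cfc (sp c) κ * M * cfc (sp (-c)) σ * Mᴴ).trace.re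
  rw [e1, e2, e3, ← Finset.sum_sub_distrib, Finset.mul_sum]
  refine le_trans (le_of_eq (Finset.sum_congr rfl fun x _ => ?_)) hJ
  by_cases hx : overlap hκ.1 hσ.1 M x.1 x.2 = 0
  · simp [hx]
  · obtain ⟨hp, hq⟩ := hpos x hx
    rw [sp_of_ne hp.ne', sp_of_ne hq.ne', Real.logb_mul (by positivity) (by positivity),
      Real.logb_rpow_eq_mul_logb_of_pos hp, Real.logb_rpow_eq_mul_logb_of_pos hq]
    ring

/-- The scalar Klein inequality, from log y ≤ y - 1 at y = k/t; the division by log 2 accounts for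
the base. -/
lemma mul_logb_le {k t : ℝ} (hk : 0 ≤ k) (ht : 0 ≤ t) (h : k = 0 → t = 0) :
    Real.logb 2 k * t ≤ Real.logb 2 t * t + (k - t) / Real.log 2 := by
  have hl := Real.log_pos one_lt_two
  rcases ht.eq_or_lt with rfl | ht
  · simp only [mul_zero, sub_zero, zero_add]; positivity
  have hk' : 0 < k := lt_of_le_of_ne hk fun h0 => ht.ne' (h h0.symm)
  have h1 := Real.log_le_sub_one_of_pos (div_pos hk' ht)
  rw [Real.log_div hk'.ne' ht.ne'] at h1
  have h2 : (Real.log k - Real.log t) * t ≤ (k / t - 1) * t :=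
    mul_le_mul_of_nonneg_right h1 ht.le
  have e : (k / t - 1) * t = k - t := by field_simp
  rw [e] at h2
  have h3 := div_le_div_of_nonneg_right h2 hl.le
  rw [Real.logb, Real.logb]
  have e2 : (Real.log k - Real.log t) * t / Real.log 2 =
    Real.log k / Real.log 2 * t - Real.log t / Real.log 2 * t := by ring
  rw [e2] at h3
  linarith

/-- Klein's inequality. -/
lemma trace_mlog_mul_le {κ ρ : Matrix n n ℂ} (hκ : κ.PosSemidef) (hκ1 : κ.trace.re ≤ 1)
    (hρ : IsDensity ρ) (h : ρ * spow κ 0 = ρ) :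
    (mlog κ * ρ).trace.re ≤ (mlog ρ * ρ).trace.re := by
  obtain ⟨hρ, hρ1⟩ := hρ
  have e1 : (mlog κ * ρ).trace.re = ∑ x : n × n, overlap hκ.1 hρ.1 1 x.1 x.2 *
      (Real.logb 2 (hκ.1.eigenvalues x.1) * hρ.1.eigenvalues x.2) := by
    rw [mlog, cfc_eq_fc hκ.1, trace_fc_mul hκ.1 hρ.1]
    exact Finset.sum_congr rfl fun x _ => mul_assoc _ _ _
  have e2 : (mlog ρ * ρ).trace.re = ∑ x : n × n, overlap hκ.1 hρ.1 1 x.1 x.2 *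
      (Real.logb 2 (hρ.1.eigenvalues x.2) * hρ.1.eigenvalues x.2) := by
    rw [sum_overlap_snd hκ.1 hρ.1 (fun j => Real.logb 2 (hρ.1.eigenvalues j) *
      hρ.1.eigenvalues j), mlog, cfc_eq_fc hρ.1]
    have h1 := fc_mul hρ.1 (fun x => (Real.logb 2 x : ℂ)) (fun x => (x : ℂ))
    rw [fc_id] at h1
    rw [h1, fc_trace, Complex.re_sum]
    exact Finset.sum_congr rfl fun x _ => by rw [← Complex.ofReal_mul, Complex.ofReal_re]
  have e3 : ∑ x : n × n, overlap hκ.1 hρ.1 1 x.1 x.2 *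
      ((hκ.1.eigenvalues x.1 - hρ.1.eigenvalues x.2) / Real.log 2) ≤ 0 := by
    have h1 := sum_overlap_fst hκ.1 hρ.1 hκ.1.eigenvalues
    have h2 := sum_overlap_snd hκ.1 hρ.1 hρ.1.eigenvalues
    rw [← re_trace_eq_sum hκ] at h1
    rw [← re_trace_eq_sum hρ, hρ1, Complex.one_re] at h2
    simp only [← mul_div_assoc, ← Finset.sum_div, mul_sub, Finset.sum_sub_distrib, h1, h2]
    exact div_nonpos_of_nonpos_of_nonneg (by linarith) (Real.log_pos one_lt_two).le
  rw [e1, e2]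
  refine le_trans (Finset.sum_le_sum (g := fun x : n × n => overlap hκ.1 hρ.1 1 x.1 x.2 *
      (Real.logb 2 (hρ.1.eigenvalues x.2) * hρ.1.eigenvalues x.2) +
      overlap hκ.1 hρ.1 1 x.1 x.2 *
      ((hκ.1.eigenvalues x.1 - hρ.1.eigenvalues x.2) / Real.log 2)) fun x _ => ?_) ?_
  · rw [← mul_add]
    by_cases hx : overlap hκ.1 hρ.1 1 x.1 x.2 = 0
    · simp [hx]
    · refine mul_le_mul_of_nonneg_left (mul_logb_le (hκ.eigenvalues_nonneg _)
        (hρ.eigenvalues_nonneg _) fun h0 => ?_) (overlap_nonneg _ _ _ _ _)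
      exact (mul_eq_zero.1 (overlap_mul_eq_zero hκ hρ h h0)).resolve_left hx
  · rw [Finset.sum_add_distrib]
    linarith

open Classical in
/-- The sandwiched Rényi divergence of order `1 / (1 - a)` as a real number. -/
def rdiv (a : ℝ) (ρ σ : Matrix n n ℂ) : ℝ :=
  if a = 0 then (ρ * (mlog ρ - mlog σ)).trace.re else 1 / a * Real.logb 2 (sandwich a ρ σ)

lemma rdiv_zero (ρ σ : Matrix n n ℂ) :
    rdiv 0 ρ σ = (mlog ρ * ρ).trace.re - (mlog σ * ρ).trace.re := by
  rw [rdiv, if_pos rfl, Matrix.mul_sub, trace_sub, Complex.sub_re, trace_mul_comm,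
    trace_mul_comm ρ (mlog σ)]

lemma rdiv_of_ne {a : ℝ} (ha : a ≠ 0) (ρ σ : Matrix n n ℂ) :
    rdiv a ρ σ = 1 / a * Real.logb 2 (sandwich a ρ σ) := if_neg ha

lemma spow_half_mul {ρ : Matrix n n ℂ} (hρ : ρ.PosSemidef) :
    spow ρ (1 / 2) * spow ρ (1 / 2) = ρ := by rw [spow_mul hρ, add_halves, spow_one hρ]

lemma spow_mul_spow_zero_of_dominates {ρ σ : Matrix n n ℂ} (hρ : ρ.PosSemidef)
    (h : ρ * spow σ 0 = ρ) (s : ℝ) : spow ρ s * spow σ 0 = spow ρ s := by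
  have h1 : spow ρ 1 * (spow σ 0 - 1) = 0 := by
    rw [spow_one hρ, Matrix.mul_sub, h, Matrix.mul_one, sub_self]
  have h2 := spow_mul_eq_zero hρ s h1
  rwa [Matrix.mul_sub, Matrix.mul_one, sub_eq_zero] at h2

lemma sandwich_eq_trpow {ρ σ : Matrix n n ℂ} (hρ : ρ.PosSemidef) (hσ : σ.PosSemidef) (c : ℝ) :
    sandwich c ρ σ = trpow (spow ρ (1 / 2) * spow σ (-c) * spow ρ (1 / 2)) (1 / (1 - c)) ^ (1 - c) := by
  have h := trpow_mul_conjTranspose (spow σ (-c / 2) * spow ρ (1 / 2)) (1 / (1 - c))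
  rw [conjTranspose_mul, (spow_isHermitian hσ _).eq, (spow_isHermitian hρ _).eq] at h
  have e1 : spow σ (-c / 2) * ρ * spow σ (-c / 2) = spow σ (-c / 2) * spow ρ (1 / 2) *
      (spow ρ (1 / 2) * spow σ (-c / 2)) := by
    nth_rw 1 [← spow_half_mul hρ]
    simp only [Matrix.mul_assoc]
  rw [sandwich, e1, h, Matrix.mul_assoc, spow_mul_assoc hσ, add_halves, ← Matrix.mul_assoc]

lemma trace_spow_mul_pos {κ Z : Matrix n n ℂ} (hκ : κ.PosSemidef) (hZ : Z.PosSemidef) {s : ℝ}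
    (h : spow Z (1 / 2) * spow κ (s / 2) ≠ 0) : 0 < (spow κ s * Z).trace.re := by
  have e : (spow κ s * Z).trace = ((spow Z (1 / 2) * spow κ (s / 2))ᴴ *
      (spow Z (1 / 2) * spow κ (s / 2))).trace := by
    rw [conjTranspose_mul, (spow_isHermitian hZ _).eq, (spow_isHermitian hκ _).eq,
      Matrix.mul_assoc, ← Matrix.mul_assoc (spow Z _), spow_half_mul hZ,
      trace_mul_comm (spow κ (s / 2)), Matrix.mul_assoc, spow_mul hκ, add_halves, trace_mul_comm]
  rw [e]
  refine re_trace_pos (posSemidef_conjTranspose_mul_self _) fun h0 => h ?_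
  rwa [conjTranspose_mul_self_eq_zero] at h0

variable {ρ σ : Matrix n n ℂ}

/-- The order-one divergence is a lower bound at orders above one. -/
lemma rdiv_zero_le (hρ : IsDensity ρ) (hσ : σ.PosSemidef) (h : ρ * spow σ 0 = ρ)
    {c : ℝ} (hc : 0 ≤ c) (hc1 : c < 1) : rdiv 0 ρ σ ≤ rdiv c ρ σ := by
  rcases hc.eq_or_lt with rfl | hc
  · exact le_rfl
  set X := spow ρ (1 / 2) with hX
  have hXh : Xᴴ = X := (spow_isHermitian hρ.1 _).eq
  have hXX : X * X = ρ := spow_half_mul hρ.1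
  -- Choosing κ = ρ in the variational formula suffices: Jensen gives c D_1 below the log of the
  -- test trace, and Hölder bounds that trace by the sandwich.
  have hJ := trace_mlog_le_logb hρ.1 hσ (M := X) (by rw [hXh, hXX, hρ.2, Complex.one_re])
    (by rw [hX, spow_mul hρ.1, zero_add]) (spow_mul_spow_zero_of_dominates hρ.1 h _) c
  rw [hXh, hXX, ← rdiv_zero] at hJ
  have hZ : (X * spow σ (-c) * X).PosSemidef := by
    have := (spow_posSemidef hσ (-c)).mul_mul_conjTranspose_same X
    rwa [hXh] at this
  have hle := trace_spow_mul_le hρ.1 hZ (by rw [hρ.2, Complex.one_re]) hc hc1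
  rw [← sandwich_eq_trpow hρ.1 hσ, ← Matrix.mul_assoc, ← Matrix.mul_assoc] at hle
  have hne : ρ ≠ 0 := by
    rintro rfl
    have := hρ.2
    simp at this
  rw [rdiv_of_ne hc.ne', one_div, ← div_eq_inv_mul, le_div_iff₀ hc, mul_comm]
  refine hJ.trans (Real.logb_le_logb_of_le one_lt_two ?_ hle)
  have e : (spow ρ c * X * spow σ (-c) * X).trace.re = (spow σ (-c) * spow ρ (1 + c)).trace.re := by
    rw [trace_mul_comm, ← Matrix.mul_assoc, ← Matrix.mul_assoc, trace_mul_comm, hX, spow_mul hρ.1,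
      spow_mul hρ.1]
    congr 4; ring
  rw [e]
  refine trace_spow_mul_pos hσ (spow_posSemidef hρ.1 _) fun h0 => hne ?_
  rw [spow_spow hρ.1] at h0
  have h1 := mul_spow_eq_zero hσ 0 h0
  rw [spow_mul_spow_zero_of_dominates hρ.1 h] at h1
  have h2 := spow_mul_eq_zero hρ.1 (M := (1 : Matrix n n ℂ)) 1 (by rwa [Matrix.mul_one])
  rwa [Matrix.mul_one, spow_one hρ.1] at h2

/-- The order-one divergence is an upper bound at orders below one. -/
lemma rdiv_le_zero (hρ : IsDensity ρ) (hσ : σ.PosSemidef) (h : ρ * spow σ 0 = ρ)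
    {c : ℝ} (hc : c ≤ 0) : rdiv c ρ σ ≤ rdiv 0 ρ σ := by
  rcases hc.eq_or_lt with rfl | hc
  · exact le_rfl
  set X := spow ρ (1 / 2) with hX
  have hXh : Xᴴ = X := (spow_isHermitian hρ.1 _).eq
  have hXX : X * X = ρ := spow_half_mul hρ.1
  have hXσ := spow_mul_spow_zero_of_dominates hρ.1 h (1 / 2)
  rw [← hX] at hXσ
  set Z := X * spow σ (-c) * X with hZdef
  have hZ : Z.PosSemidef := by
    have := (spow_posSemidef hσ (-c)).mul_mul_conjTranspose_same X
    rwa [hXh] at this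
  have hσX : spow σ 0 * X = X := by
    have := congrArg conjTranspose hXσ
    rwa [conjTranspose_mul, hXh, (spow_isHermitian hσ _).eq] at this
  have hZM : (spow σ (-c / 2) * X)ᴴ * (spow σ (-c / 2) * X) = Z := by
    rw [conjTranspose_mul, (spow_isHermitian hσ _).eq, hXh, Matrix.mul_assoc, spow_mul_assoc hσ,
      add_halves, ← Matrix.mul_assoc]
  have hXZ : X * spow Z 0 = X := by
    have h1 := mul_spow_zero_conjTranspose_mul (spow σ (-c / 2) * X)
    rw [hZM] at h1
    have h2 : spow σ (-c / 2) * (X * spow Z 0 - X) = 0 := by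
      rw [Matrix.mul_sub, ← Matrix.mul_assoc, h1, sub_self]
    have h3 := spow_mul_eq_zero hσ 0 h2
    rwa [Matrix.mul_sub, ← Matrix.mul_assoc, hσX, sub_eq_zero] at h3
  have hρne : ρ ≠ 0 := by
    rintro rfl
    have := hρ.2
    simp at this
  have hZ0 : Z ≠ 0 := by
    intro h0
    rw [h0] at hXZ
    have h1 : spow (0 : Matrix n n ℂ) 0 = 0 := by
      have h2 : (0 : Matrix n n ℂ).PosSemidef := PosSemidef.zero
      have := spow_mul_eq_zero h2 (M := (1 : Matrix n n ℂ)) (s := 1) 0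
        (by rw [spow_one h2, Matrix.zero_mul])
      rwa [Matrix.mul_one] at this
    rw [h1, Matrix.mul_zero] at hXZ
    rw [← hXX, ← hXZ, Matrix.zero_mul] at hρne
    exact hρne rfl
  obtain ⟨hκ, hκ1⟩ := optimizer_isDensity hZ hZ0 (1 / (1 - c))
  have hL := trace_spow_optimizer hZ hZ0 (s := c) (by linarith)
  have hκ0 := spow_zero_optimizer hZ hZ0 (1 / (1 - c))
  rw [hZdef, ← sandwich_eq_trpow hρ.1 hσ, ← hZdef] at hL
  generalize optimizer Z (1 / (1 - c)) = κ at hκ hκ1 hL hκ0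
  rw [← hκ0] at hXZ
  have hκX : spow κ 0 * X = X := by
    have := congrArg conjTranspose hXZ
    rwa [conjTranspose_mul, hXh, (spow_isHermitian hκ _).eq] at this
  -- Here κ is the optimizer, so the test trace is the sandwich itself. Klein's inequality then
  -- replaces log κ by log ρ, and dividing by c < 0 reverses the Jensen bound.
  have hJ := trace_mlog_le_logb hκ hσ (M := X) (by rw [hXh, hXX, hρ.2, Complex.one_re]) hκX hXσ c
  rw [hXh, hXX] at hJ
  have hK := trace_mlog_mul_le hκ (by rw [hκ1, Complex.one_re]) hρ
    (by rw [← hXX, Matrix.mul_assoc, hXZ])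
  rw [hZdef, ← Matrix.mul_assoc, ← Matrix.mul_assoc] at hL
  rw [hL] at hJ
  rw [rdiv_zero, rdiv_of_ne hc.ne, one_div, ← div_eq_inv_mul, div_le_iff_of_neg hc]
  refine le_trans ?_ hJ
  rw [mul_comm]
  exact mul_le_mul_of_nonpos_left (by linarith) hc.le

end OrderOne

/-! ### The exact chain rule at order one. -/

section OrderOneChain

variable {A Y : Type*} [Fintype A] [DecidableEq A] [Fintype Y] [DecidableEq Y]

lemma mlog_one_kronecker {T : Matrix Y Y ℂ} (hT : T.IsHermitian) :
    mlog ((1 : Matrix A A ℂ) ⊗ₖ T) = (1 : Matrix A A ℂ) ⊗ₖ mlog T := cfc_one_kronecker _ hT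

lemma traceFst_isDensity {ρ : Matrix (A × Y) (A × Y) ℂ} (hρ : IsDensity ρ) :
    IsDensity (traceFst ρ) := ⟨traceFst_posSemidef hρ.1, by rw [trace_traceFst, hρ.2]⟩

lemma trace_mlog_one_kronecker_mul {T : Matrix Y Y ℂ} (hT : T.IsHermitian)
    (ρ : Matrix (A × Y) (A × Y) ℂ) :
    (mlog ((1 : Matrix A A ℂ) ⊗ₖ T) * ρ).trace = (mlog T * traceFst ρ).trace := by
  rw [mlog_one_kronecker hT, ← trace_traceFst, traceFst_one_kronecker_mul]

/-- Logarithms of 1 ⊗ T see only the marginal, so the terms containing log ρ_Y cancel. -/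
lemma rdiv_zero_chain {ρ : Matrix (A × Y) (A × Y) ℂ} (hρ : IsDensity ρ) {T : Matrix Y Y ℂ}
    (hT : T.IsHermitian) : rdiv 0 ρ ((1 : Matrix A A ℂ) ⊗ₖ T) =
      rdiv 0 ρ ((1 : Matrix A A ℂ) ⊗ₖ traceFst ρ) + rdiv 0 (traceFst ρ) T := by
  simp only [rdiv_zero, trace_mlog_one_kronecker_mul hT,
    trace_mlog_one_kronecker_mul (traceFst_isDensity hρ).1.1]
  ring

lemma traceFst_mul_spow_zero {ρ : Matrix (A × Y) (A × Y) ℂ} {T : Matrix Y Y ℂ}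
    (hT : T.IsHermitian) (h : ρ * spow ((1 : Matrix A A ℂ) ⊗ₖ T) 0 = ρ) :
    traceFst ρ * spow T 0 = traceFst ρ := by
  rw [← traceFst_mul_one_kronecker, ← spow_one_kronecker hT, h]

/-- Klein's inequality on Y makes the marginal the optimal σ at order one. -/
lemma rdiv_zero_traceFst_le {ρ : Matrix (A × Y) (A × Y) ℂ} (hρ : IsDensity ρ) {σ : Matrix Y Y ℂ}
    (hσ : IsDensity σ) (h : ρ * spow ((1 : Matrix A A ℂ) ⊗ₖ σ) 0 = ρ) :
    rdiv 0 ρ ((1 : Matrix A A ℂ) ⊗ₖ traceFst ρ) ≤ rdiv 0 ρ ((1 : Matrix A A ℂ) ⊗ₖ σ) := by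
  simp only [rdiv_zero, trace_mlog_one_kronecker_mul hσ.1.1,
    trace_mlog_one_kronecker_mul (traceFst_isDensity hρ).1.1]
  have := trace_mlog_mul_le hσ.1 (by rw [hσ.2, Complex.one_re]) (traceFst_isDensity hρ)
    (traceFst_mul_spow_zero hσ.1.1 h)
  linarith

/-- For P the kernel projection of ρ_Y, the squared Hilbert–Schmidt norm of ρ^{1/2}(1 ⊗ P) is
computed from ρ_Y P = 0, so it vanishes. -/
lemma mul_spow_traceFst_zero {ρ : Matrix (A × Y) (A × Y) ℂ} (hρ : IsDensity ρ) :
    ρ * spow ((1 : Matrix A A ℂ) ⊗ₖ traceFst ρ) 0 = ρ := by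
  have hY := traceFst_posSemidef hρ.1
  rw [spow_one_kronecker hY.1]
  set P := 1 - spow (traceFst ρ) 0 with hP
  have hPh : Pᴴ = P := by
    rw [hP, conjTranspose_sub, conjTranspose_one, (spow_isHermitian hY _).eq]
  have hYP : traceFst ρ * P = 0 := by
    rw [hP, Matrix.mul_sub, Matrix.mul_one]
    nth_rw 2 [← spow_one hY]
    rw [spow_mul hY, add_zero, spow_one hY, sub_self]
  have hXX := spow_half_mul hρ.1
  have hXh : (spow ρ (1 / 2))ᴴ = spow ρ (1 / 2) := (spow_isHermitian hρ.1 _).eq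
  set X := spow ρ (1 / 2) with hX
  have hM : (X * ((1 : Matrix A A ℂ) ⊗ₖ P))ᴴ * (X * ((1 : Matrix A A ℂ) ⊗ₖ P)) = 0 := by
    rw [← (posSemidef_conjTranspose_mul_self _).trace_eq_zero_iff, conjTranspose_mul, hXh,
      conjTranspose_kronecker, conjTranspose_one, hPh, Matrix.mul_assoc, ← Matrix.mul_assoc X, hXX,
      ← trace_traceFst, traceFst_one_kronecker_mul, traceFst_mul_one_kronecker, hYP,
      Matrix.mul_zero, trace_zero]
  rw [conjTranspose_mul_self_eq_zero] at hM
  have h1 : ρ * ((1 : Matrix A A ℂ) ⊗ₖ P) = 0 := by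
    rw [← hXX, Matrix.mul_assoc, hM, Matrix.mul_zero]
  have e : (1 : Matrix A A ℂ) ⊗ₖ spow (traceFst ρ) 0 = 1 - (1 : Matrix A A ℂ) ⊗ₖ P := by
    rw [eq_sub_iff_add_eq, ← kronecker_add, hP, add_sub_cancel, one_kronecker_one]
  rw [e, Matrix.mul_sub, h1, Matrix.mul_one, sub_zero]

end OrderOneChain

/-! ### Invariance under regrouping of tensor factors. -/

section Reindex

variable {n m : Type*} [Fintype n] [DecidableEq n] [Fintype m] [DecidableEq m]

lemma dominates_submatrix (σ ρ : Matrix n n ℂ) (e : m ≃ n) :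
    Dominates (σ.submatrix e e) (ρ.submatrix e e) ↔ Dominates σ ρ := by
  constructor
  · intro h v hv
    have h1 := h (v ∘ e) (by
      rw [submatrix_mulVec_equiv, Function.comp_assoc, e.self_comp_symm, Function.comp_id, hv]; rfl)
    rw [submatrix_mulVec_equiv, Function.comp_assoc, e.self_comp_symm, Function.comp_id] at h1
    funext i
    simpa using congrFun h1 (e.symm i)
  · intro h v hv
    rw [submatrix_mulVec_equiv] at hv ⊢
    rw [h (v ∘ e.symm)]
    · rfl
    · funext i
      simpa using congrFun hv (e.symm i)

lemma trace_submatrix_equiv (M : Matrix n n ℂ) (e : m ≃ n) : (M.submatrix e e).trace = M.trace :=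
  Equiv.sum_comp e fun i => M i i

lemma mpow_submatrix {H : Matrix n n ℂ} (hH : H.IsHermitian) (s : ℝ) (e : m ≃ n) :
    mpow (H.submatrix e e) s = (mpow H s).submatrix e e := cfc_submatrix _ hH e

lemma mlog_submatrix {H : Matrix n n ℂ} (hH : H.IsHermitian) (e : m ≃ n) :
    mlog (H.submatrix e e) = (mlog H).submatrix e e := cfc_submatrix _ hH e

lemma isHermitian_cfc (f : ℝ → ℝ) (H : Matrix n n ℂ) : (cfc f H).IsHermitian :=
  cfc_predicate f H

lemma renyiDiv_submatrix (α : ℝ) {ρ σ : Matrix n n ℂ} (hρ : ρ.IsHermitian) (hσ : σ.IsHermitian)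
    (e : m ≃ n) : renyiDiv α (ρ.submatrix e e) (σ.submatrix e e) = renyiDiv α ρ σ := by
  have hM : (mpow σ ((1 - α) / (2 * α)) * ρ * mpow σ ((1 - α) / (2 * α))).IsHermitian := by
    have h1 : (mpow σ ((1 - α) / (2 * α)))ᴴ = mpow σ ((1 - α) / (2 * α)) := isHermitian_cfc _ _
    rw [IsHermitian, conjTranspose_mul, conjTranspose_mul, h1, hρ.eq, Matrix.mul_assoc]
  have h0 : (ρ * σ).submatrix e e = 0 ↔ ρ * σ = 0 := by
    constructor
    · intro h
      ext i j
      simpa using congrFun (congrFun h (e.symm i)) (e.symm j)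
    · intro h
      rw [h]; rfl
  rw [renyiDiv, renyiDiv, relEntropy, relEntropy, mpow_submatrix hσ, mlog_submatrix hρ,
    mlog_submatrix hσ, dominates_submatrix, submatrix_mul_equiv, submatrix_mul_equiv,
    submatrix_mul_equiv, mpow_submatrix hM, trace_submatrix_equiv]
  have h3 : (ρ.submatrix e e * ((mlog ρ).submatrix e e - (mlog σ).submatrix e e)).trace =
      (ρ * (mlog ρ - mlog σ)).trace := by
    rw [← trace_submatrix_equiv (ρ * (mlog ρ - mlog σ)) e, ← submatrix_mul_equiv _ _ e e e]
    rfl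
  rw [h3]
  classical
  exact if_congr Iff.rfl rfl (if_congr (and_congr_left fun _ => not_congr h0) rfl rfl)

lemma one_kronecker_submatrix_prodAssoc {A B C : Type*} [DecidableEq A] [DecidableEq B]
    (τ : Matrix C C ℂ) : (1 : Matrix (A × B) (A × B) ℂ) ⊗ₖ τ =
      ((1 : Matrix A A ℂ) ⊗ₖ ((1 : Matrix B B ℂ) ⊗ₖ τ)).submatrix (Equiv.prodAssoc A B C)
        (Equiv.prodAssoc A B C) := by
  ext ⟨⟨i, j⟩, k⟩ ⟨⟨i', j'⟩, k'⟩
  simp only [kroneckerMap_apply, submatrix_apply, Equiv.prodAssoc_apply, one_apply, Prod.mk.injEq]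
  by_cases h1 : i = i' <;> by_cases h2 : j = j' <;> simp [h1, h2]

end Reindex

/-! ### Extended-real divergences expressed by real ones. -/

section Values

variable {n : Type*} [Fintype n] [DecidableEq n] {ρ σ : Matrix n n ℂ}

lemma one_div_mul_logb_rpow {α x : ℝ} (hα : 0 < α) (h1 : α ≠ 1) (hx : 0 ≤ x) :
    1 / (1 - 1 / α) * Real.logb 2 (x ^ (1 - (1 - 1 / α))) = 1 / (α - 1) * Real.logb 2 x := by
  rw [sub_sub_cancel]
  rcases hx.eq_or_lt with rfl | hx
  · rw [Real.zero_rpow (by positivity), Real.logb_zero, mul_zero, mul_zero]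
  · rw [Real.logb_rpow_eq_mul_logb_of_pos hx, ← mul_assoc]
    have : α - 1 ≠ 0 := sub_ne_zero.2 h1
    congr 1
    field_simp

/-- The dictionary a = 1 - 1/α: the outer power 1 - a = 1/α in `sandwich` turns the prefactor 1/(α -
1) into 1/a. -/
lemma renyiDiv_eq_rdiv {α : ℝ} (hα : 0 < α) (hρ : ρ.PosSemidef) (hσ : σ.PosSemidef)
    (h0 : ρ * σ ≠ 0) (h : Dominates σ ρ ∨ α < 1) :
    renyiDiv α ρ σ = (rdiv (1 - 1 / α) ρ σ : ℝ) := by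
  by_cases h1 : α = 1
  · subst h1
    rw [renyiDiv, if_pos rfl, relEntropy, if_pos (h.resolve_right (lt_irrefl _)), rdiv,
      if_pos (by norm_num)]
  · have ha : 1 - 1 / α ≠ 0 := by
      rw [sub_ne_zero, ne_eq, eq_div_iff hα.ne', one_mul]; exact h1
    have hs : (1 - α) / (2 * α) ≠ 0 := div_ne_zero (sub_ne_zero.2 (Ne.symm h1)) (by positivity)
    have hp : (spow σ ((1 - α) / (2 * α)) * ρ * spow σ ((1 - α) / (2 * α))).PosSemidef := by
      have := hρ.mul_mul_conjTranspose_same (spow σ ((1 - α) / (2 * α)))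
      rwa [(spow_isHermitian hσ _).eq] at this
    rw [renyiDiv, if_neg h1, if_pos ⟨h0, h⟩, rdiv_of_ne ha, sandwich, mpow_eq_spow hs,
      mpow_eq_spow hα.ne', show -(1 - 1 / α) / 2 = (1 - α) / (2 * α) by field_simp; ring,
      show 1 / (1 - (1 - 1 / α)) = α by rw [sub_sub_cancel, one_div_one_div], ← trpow,
      one_div_mul_logb_rpow hα h1 (trpow_nonneg hp α)]

lemma renyiDiv_eq_top {α : ℝ} (h1 : α = 1 → ¬ Dominates σ ρ)
    (h : ¬ (ρ * σ ≠ 0 ∧ (Dominates σ ρ ∨ α < 1))) : renyiDiv α ρ σ = ⊤ := by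
  rw [renyiDiv]
  split_ifs with h0
  · rw [relEntropy, if_neg (h1 h0)]
  · rfl

lemma mul_ne_zero_of_dominates (hσ : σ.PosSemidef) (hρ : ρ ≠ 0) (h : Dominates σ ρ) :
    ρ * σ ≠ 0 := by
  intro h0
  rw [dominates_iff hσ] at h
  have := mul_spow_eq_zero hσ 0 (s := 1) (by rwa [spow_one hσ])
  exact hρ (h.symm.trans this)

lemma spow_zero_mul_of_dominates (hρ : ρ.PosSemidef) (hσ : σ.PosSemidef) (h : Dominates σ ρ) :
    spow σ 0 * spow ρ (1 / 2) = spow ρ (1 / 2) := by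
  have h1 := congrArg conjTranspose
    (spow_mul_spow_zero_of_dominates hρ ((dominates_iff hσ ρ).1 h) (1 / 2))
  rwa [conjTranspose_mul, (spow_isHermitian hρ _).eq, (spow_isHermitian hσ _).eq] at h1

lemma IsDensity.ne_zero {n : Type*} [Fintype n] {ρ : Matrix n n ℂ} (hρ : IsDensity ρ) : ρ ≠ 0 := by
  rintro rfl
  have := hρ.2
  simp at this

end Values

/-! ### The chain rule for arbitrary T on Y, all orders together. -/

section Core

variable {A Y : Type*} [Fintype A] [DecidableEq A] [Fintype Y] [DecidableEq Y]

lemma one_sub_one_div_lt_zero_iff {α : ℝ} (hα : 0 < α) : 1 - 1 / α < 0 ↔ α < 1 := by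
  rw [sub_neg, lt_div_iff₀ hα, one_mul]

lemma rdiv_chain_of_nonneg {ρ : Matrix (A × Y) (A × Y) ℂ} (hρ : IsDensity ρ) {T σ : Matrix Y Y ℂ}
    (hT : T.PosSemidef) {a b c : ℝ} (habc : a * (b + c) = b * c) (hbc : 0 ≤ b + c)
    (h00 : b = 0 → c = 0 → a ≤ 0) (ha1 : a < 1) (hc : -1 ≤ c) (hc1 : c < 1) (hb : -1 < b)
    (hb1 : b < 1) (hne : ρ * ((1 : Matrix A A ℂ) ⊗ₖ T) ≠ 0)
    (hsupp : (a < 0 ∧ c < 0) ∨ Dominates ((1 : Matrix A A ℂ) ⊗ₖ T) ρ)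
    (hσ : IsDensity σ) (hσne : ρ * ((1 : Matrix A A ℂ) ⊗ₖ σ) ≠ 0)
    (hσd : Dominates ((1 : Matrix A A ℂ) ⊗ₖ σ) ρ ∨ b < 0) :
    rdiv a ρ ((1 : Matrix A A ℂ) ⊗ₖ T) ≤
      rdiv b ρ ((1 : Matrix A A ℂ) ⊗ₖ σ) + rdiv c (traceFst ρ) T := by
  have h1 := one_kronecker_posSemidef (A := A) hT
  have h2 := one_kronecker_posSemidef (A := A) hσ.1
  -- If exactly one of b, c vanishes, the relation forces a = 0; if both vanish, a is free and `h00`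
  -- fixes its sign. Either way a and the pair b, c lie on opposite sides of order one.
  by_cases hz : b = 0 ∨ c = 0
  · have hs : a ≤ 0 ∧ 0 ≤ b ∧ 0 ≤ c := by
      rcases hz with rfl | rfl
      · rw [zero_add, zero_mul] at habc
        rcases mul_eq_zero.1 habc with rfl | rfl
        · exact ⟨le_rfl, le_rfl, by linarith⟩
        · exact ⟨h00 rfl rfl, le_rfl, le_rfl⟩
      · rw [add_zero, mul_zero] at habc
        rcases mul_eq_zero.1 habc with rfl | rfl
        · exact ⟨le_rfl, by linarith, le_rfl⟩
        · exact ⟨h00 rfl rfl, le_rfl, le_rfl⟩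
    obtain ⟨ha, hb0, hc0⟩ := hs
    have hd := (dominates_iff h1 ρ).1 (hsupp.resolve_left fun h => hc0.not_gt h.2)
    have hd' := (dominates_iff h2 ρ).1 (hσd.resolve_right hb0.not_gt)
    have e1 := rdiv_le_zero hρ h1 hd ha
    have e2 := rdiv_zero_chain hρ hT.1
    have e3 := rdiv_zero_traceFst_le hρ hσ hd'
    have e4 := rdiv_zero_le hρ h2 hd' hb0 hb1
    have e5 := rdiv_zero_le (traceFst_isDensity hρ) hT (traceFst_mul_spow_zero hT.1 hd) hc0 hc1
    linarith
  · push Not at hz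
    obtain ⟨hb0, hc0⟩ := hz
    have hbc' : b + c ≠ 0 := by
      intro h
      rw [h, mul_zero] at habc
      exact mul_ne_zero hb0 hc0 habc.symm
    have ha0 : a ≠ 0 := by
      rintro rfl
      rw [zero_mul] at habc
      exact mul_ne_zero hb0 hc0 habc.symm
    have hXX : spow ρ (1 / 2) * (spow ρ (1 / 2))ᴴ = ρ := by
      rw [(spow_isHermitian hρ.1 _).eq, spow_half_mul hρ.1]
    have h := sandwich_chain_of_pos (X := spow ρ (1 / 2)) (σ := σ) hT habc hb0 hc0
      (lt_of_le_of_ne hbc hbc'.symm) ha1 hc hc1 hb hb1 (by rwa [hXX])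
      (hsupp.imp_right fun h => spow_zero_mul_of_dominates hρ.1 h1 h)
      ⟨hσ, by rwa [hXX], by rwa [hXX]⟩
    rw [hXX] at h
    rw [rdiv_of_ne ha0, rdiv_of_ne hb0, rdiv_of_ne hc0]
    linarith

lemma rdiv_chain_of_nonpos {ρ : Matrix (A × Y) (A × Y) ℂ} (hρ : IsDensity ρ) {T : Matrix Y Y ℂ}
    (hT : T.PosSemidef) {a b c t : ℝ} (habc : a * (b + c) = b * c) (hbc : b + c ≤ 0)
    (h00 : b = 0 → c = 0 → 0 ≤ a) (ha1 : a < 1) (hc : -1 ≤ c) (hc1 : c < 1) (hb : -1 < b)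
    (hb1 : b < 1) (hne : ρ * ((1 : Matrix A A ℂ) ⊗ₖ T) ≠ 0)
    (hsupp : (a < 0 ∧ c < 0) ∨ Dominates ((1 : Matrix A A ℂ) ⊗ₖ T) ρ)
    (h : ∀ σ, IsDensity σ → ρ * ((1 : Matrix A A ℂ) ⊗ₖ σ) ≠ 0 →
      (Dominates ((1 : Matrix A A ℂ) ⊗ₖ σ) ρ ∨ b < 0) → t < rdiv b ρ ((1 : Matrix A A ℂ) ⊗ₖ σ)) :
    t + rdiv c (traceFst ρ) T ≤ rdiv a ρ ((1 : Matrix A A ℂ) ⊗ₖ T) := by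
  have h1 := one_kronecker_posSemidef (A := A) hT
  by_cases hz : b = 0 ∨ c = 0
  · have hs : 0 ≤ a ∧ b ≤ 0 ∧ c ≤ 0 := by
      rcases hz with rfl | rfl
      · rw [zero_add, zero_mul] at habc
        rcases mul_eq_zero.1 habc with rfl | rfl
        · exact ⟨le_rfl, le_rfl, by linarith⟩
        · exact ⟨h00 rfl rfl, le_rfl, le_rfl⟩
      · rw [add_zero, mul_zero] at habc
        rcases mul_eq_zero.1 habc with rfl | rfl
        · exact ⟨le_rfl, by linarith, le_rfl⟩
        · exact ⟨h00 rfl rfl, le_rfl, le_rfl⟩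
    obtain ⟨ha, hb0, hc0⟩ := hs
    have hd := (dominates_iff h1 ρ).1 (hsupp.resolve_left fun h => ha.not_gt h.1)
    have hY := traceFst_isDensity hρ
    have h2 := one_kronecker_posSemidef (A := A) hY.1
    have hd' := mul_spow_traceFst_zero hρ
    have hdom := (dominates_iff h2 ρ).2 hd'
    -- The bound over all σ is used only at the marginal of ρ, for which the order-one chain rule is
    -- exact.
    have e0 := h _ hY (mul_ne_zero_of_dominates h2 hρ.ne_zero hdom) (Or.inl hdom)
    have e1 := rdiv_zero_le hρ h1 hd ha ha1
    have e2 := rdiv_zero_chain hρ hT.1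
    have e4 := rdiv_le_zero hρ h2 hd' hb0
    have e5 := rdiv_le_zero hY hT (traceFst_mul_spow_zero hT.1 hd) hc0
    linarith
  · push Not at hz
    obtain ⟨hb0, hc0⟩ := hz
    have hbc' : b + c ≠ 0 := by
      intro h
      rw [h, mul_zero] at habc
      exact mul_ne_zero hb0 hc0 habc.symm
    have ha0 : a ≠ 0 := by
      rintro rfl
      rw [zero_mul] at habc
      exact mul_ne_zero hb0 hc0 habc.symm
    have hXX : spow ρ (1 / 2) * (spow ρ (1 / 2))ᴴ = ρ := by
      rw [(spow_isHermitian hρ.1 _).eq, spow_half_mul hρ.1]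
    have h := sandwich_chain_of_neg (X := spow ρ (1 / 2)) (h' := -t) hT habc hb0 hc0
      (lt_of_le_of_ne hbc hbc') ha1 hc hc1 hb hb1 (by rwa [hXX])
      (hsupp.imp_right fun h => spow_zero_mul_of_dominates hρ.1 h1 h)
      (fun σ hσ => by
        obtain ⟨hσ1, hσ2, hσ3⟩ := hσ
        rw [hXX] at hσ2 hσ3 ⊢
        have := h σ hσ1 hσ2 hσ3
        rw [rdiv_of_ne hb0] at this
        linarith)
    rw [hXX] at h
    rw [rdiv_of_ne ha0, rdiv_of_ne hc0]
    linarith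

/-- Orthogonality of ρ to 1 ⊗ T passes to the marginal. With both divergences infinite, the two
sides of the chain rule are -∞. -/
lemma chain_of_orthogonal {ρ : Matrix (A × Y) (A × Y) ℂ} {T : Matrix Y Y ℂ} {α γ : ℝ}
    (hα : α < 1) (hγ : γ < 1) (h0 : ρ * ((1 : Matrix A A ℂ) ⊗ₖ T) = 0) :
    renyiDiv α ρ ((1 : Matrix A A ℂ) ⊗ₖ T) = ⊤ ∧ renyiDiv γ (traceFst ρ) T = ⊤ := by
  refine ⟨renyiDiv_eq_top (fun h => absurd h hα.ne) fun h => h.1 h0,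
    renyiDiv_eq_top (fun h => absurd h hγ.ne) fun h => h.1 ?_⟩
  rw [← traceFst_mul_one_kronecker, h0]
  ext i j
  simp [traceFst]

lemma renyiDiv_chain {α β γ : ℝ} (hrel : α * β * γ - 2 * β * γ - α + β + γ = 0)
    (hα : 1 / 2 ≤ α) (hγ : 1 / 2 ≤ γ) (hβ : 1 / 2 < β) {ρ : Matrix (A × Y) (A × Y) ℂ}
    (hρ : IsDensity ρ) {T : Matrix Y Y ℂ} (hT : T.PosSemidef)
    (hsupp : (α < 1 ∧ γ < 1) ∨ Dominates ((1 : Matrix A A ℂ) ⊗ₖ T) ρ) :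
    (1 / β + 1 / γ ≤ 2 → (β = 1 → γ = 1 → α ≤ 1) →
      condEntropyUp β ρ + -renyiDiv γ (traceFst ρ) T ≤
        -renyiDiv α ρ ((1 : Matrix A A ℂ) ⊗ₖ T)) ∧
    (2 ≤ 1 / β + 1 / γ → (β = 1 → γ = 1 → 1 ≤ α) →
      -renyiDiv α ρ ((1 : Matrix A A ℂ) ⊗ₖ T) ≤
        condEntropyUp β ρ + -renyiDiv γ (traceFst ρ) T) := by
  have hα0 : 0 < α := by linarith
  have hβ0 : 0 < β := by linarith
  have hγ0 : 0 < γ := by linarith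
  have h1 := one_kronecker_posSemidef (A := A) hT
  by_cases h0 : ρ * ((1 : Matrix A A ℂ) ⊗ₖ T) = 0
  · have hs := hsupp.resolve_right fun h => mul_ne_zero_of_dominates h1 hρ.ne_zero h h0
    obtain ⟨e1, e2⟩ := chain_of_orthogonal hs.1 hs.2 h0
    rw [e1, e2, EReal.neg_top, EReal.add_bot]
    exact ⟨fun _ _ => le_rfl, fun _ _ => le_rfl⟩
  have hY := traceFst_isDensity hρ
  have hXX : spow ρ (1 / 2) * (spow ρ (1 / 2))ᴴ = ρ := by
    rw [(spow_isHermitian hρ.1 _).eq, spow_half_mul hρ.1]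
  have hY0 : traceFst ρ * T ≠ 0 := by
    have := traceFst_mul_ne_zero (X := spow ρ (1 / 2)) hT (by rwa [hXX])
    rwa [hXX] at this
  have hYd : Dominates ((1 : Matrix A A ℂ) ⊗ₖ T) ρ → Dominates T (traceFst ρ) := fun h =>
    (dominates_iff hT _).2 (traceFst_mul_spow_zero hT.1 ((dominates_iff h1 _).1 h))
  rw [renyiDiv_eq_rdiv hα0 hρ.1 h1 h0 (hsupp.symm.imp_right And.left),
    renyiDiv_eq_rdiv hγ0 hY.1 hT hY0 (hsupp.symm.imp hYd And.right)]
  -- Clearing denominators in a(b + c) = bc gives the polynomial relation, which stays meaningful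
  -- when some order is 1.
  have habc : (1 - 1 / α) * ((1 - 1 / β) + (1 - 1 / γ)) = (1 - 1 / β) * (1 - 1 / γ) := by
    field_simp
    linarith
  have hlt : ∀ x : ℝ, 0 < x → 1 - 1 / x < 1 := fun x hx => by
    have : 0 < 1 / x := by positivity
    linarith
  have hge : -1 ≤ 1 - 1 / γ := by
    have : 1 / γ ≤ 2 := by rw [div_le_iff₀ hγ0]; linarith
    linarith
  have hgt : -1 < 1 - 1 / β := by
    have : 1 / β < 2 := by rw [div_lt_iff₀ hβ0]; linarith
    linarith
  have hone : ∀ x : ℝ, 0 < x → 1 - 1 / x = 0 → x = 1 := fun x hx h => by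
    field_simp at h
    linarith
  have hsupp' : (1 - 1 / α < 0 ∧ 1 - 1 / γ < 0) ∨ Dominates ((1 : Matrix A A ℂ) ⊗ₖ T) ρ := by
    rwa [one_sub_one_div_lt_zero_iff hα0, one_sub_one_div_lt_zero_iff hγ0]
  have hfin : ∀ σ : Matrix Y Y ℂ, IsDensity σ → ρ * ((1 : Matrix A A ℂ) ⊗ₖ σ) ≠ 0 →
      (Dominates ((1 : Matrix A A ℂ) ⊗ₖ σ) ρ ∨ 1 - 1 / β < 0) →
      renyiDiv β ρ ((1 : Matrix A A ℂ) ⊗ₖ σ) =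
        (rdiv (1 - 1 / β) ρ ((1 : Matrix A A ℂ) ⊗ₖ σ) : ℝ) := fun σ hσ hσ0 hσd =>
    renyiDiv_eq_rdiv hβ0 hρ.1 (one_kronecker_posSemidef hσ.1) hσ0
      (hσd.imp_right (one_sub_one_div_lt_zero_iff hβ0).1)
  refine ⟨fun hs hs1 => ?_, fun hs hs1 => ?_⟩
  · have key : ((rdiv (1 - 1 / α) ρ ((1 : Matrix A A ℂ) ⊗ₖ T) -
        rdiv (1 - 1 / γ) (traceFst ρ) T : ℝ) : EReal) ≤
        ⨅ σ : {σ : Matrix Y Y ℂ // IsDensity σ}, renyiDiv β ρ ((1 : Matrix A A ℂ) ⊗ₖ σ.1) := by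
      refine le_iInf fun σ => ?_
      obtain ⟨σ, hσ⟩ := σ
      dsimp only
      by_cases hf : ρ * ((1 : Matrix A A ℂ) ⊗ₖ σ) ≠ 0 ∧
          (Dominates ((1 : Matrix A A ℂ) ⊗ₖ σ) ρ ∨ β < 1)
      · have hf2 := hf.2.imp_right (one_sub_one_div_lt_zero_iff hβ0).2
        rw [hfin σ hσ hf.1 hf2, EReal.coe_le_coe_iff, sub_le_iff_le_add]
        exact rdiv_chain_of_nonneg hρ hT habc (by linarith)
          (fun hb hc => by
            have := hs1 (hone β hβ0 hb) (hone γ hγ0 hc)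
            rw [sub_nonpos, le_div_iff₀ hα0]; linarith)
          (hlt α hα0) hge (hlt γ hγ0) hgt (hlt β hβ0) h0 hsupp' hσ hf.1 hf2
      · rw [renyiDiv_eq_top (fun _ hd => hf ⟨mul_ne_zero_of_dominates
          (one_kronecker_posSemidef hσ.1) hρ.ne_zero hd, Or.inl hd⟩) hf]
        exact le_top
    have h2 := EReal.neg_le_neg_iff.2 key
    refine (add_le_add_left h2 _).trans (le_of_eq ?_)
    rw [← EReal.coe_neg, ← EReal.coe_neg, ← EReal.coe_neg, ← EReal.coe_add]
    congr 1
    ring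
  · have key : (⨅ σ : {σ : Matrix Y Y ℂ // IsDensity σ}, renyiDiv β ρ ((1 : Matrix A A ℂ) ⊗ₖ σ.1)) ≤
        ((rdiv (1 - 1 / α) ρ ((1 : Matrix A A ℂ) ⊗ₖ T) -
        rdiv (1 - 1 / γ) (traceFst ρ) T : ℝ) : EReal) := by
      by_contra hcon
      -- A real t strictly below the infimum gives strict real inequalities for every σ with finite
      -- divergence, as the minimax argument requires.
      obtain ⟨t, ht1, ht2⟩ := EReal.lt_iff_exists_real_btwn.1 (not_le.1 hcon)
      rw [EReal.coe_lt_coe_iff] at ht1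
      have := rdiv_chain_of_nonpos (t := t) hρ hT habc (by linarith)
        (fun hb hc => by
          have := hs1 (hone β hβ0 hb) (hone γ hγ0 hc)
          rw [sub_nonneg, div_le_iff₀ hα0]; linarith)
        (hlt α hα0) hge (hlt γ hγ0) hgt (hlt β hβ0) h0 hsupp' fun σ hσ hσ0 hσd => by
          have h3 := ht2.trans_le (iInf_le _ (⟨σ, hσ⟩ : {σ : Matrix Y Y ℂ // IsDensity σ}))
          rwa [hfin σ hσ hσ0 hσd, EReal.coe_lt_coe_iff] at h3
      linarith
    have h2 := EReal.neg_le_neg_iff.2 key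
    refine le_trans (le_of_eq ?_) (add_le_add_left h2 _)
    rw [← EReal.coe_neg, ← EReal.coe_neg, ← EReal.coe_neg, ← EReal.coe_add]
    congr 1
    ring

end Core

end QRenyi
end

theorem theorem3p5 {A B C : Type*} [Fintype A] [DecidableEq A] [Fintype B] [DecidableEq B]
    [Fintype C] [DecidableEq C] (α β γ : ℝ)
    (hrel : α * β * γ - 2 * β * γ - α + β + γ = 0)
    (hα : 1 / 2 ≤ α) (hγ : 1 / 2 ≤ γ) (hβ : 1 / 2 < β)
    (ρ : Matrix (A × B × C) (A × B × C) ℂ) (hρ : QRenyi.IsDensity ρ)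
    (τ : Matrix C C ℂ) (hτ : τ.PosSemidef)
    (hsupp : (α < 1 ∧ γ < 1) ∨
      QRenyi.Dominates ((1 : Matrix (A × B) (A × B) ℂ) ⊗ₖ τ) (QRenyi.regroup ρ)) :
    (1 / β + 1 / γ ≤ 2 → (β = 1 → γ = 1 → α ≤ 1) →
      QRenyi.condEntropyUp β ρ + QRenyi.condEntropyRel γ (QRenyi.traceFst ρ) τ ≤
        QRenyi.condEntropyRel α (QRenyi.regroup ρ) τ) ∧
    (2 ≤ 1 / β + 1 / γ → (β = 1 → γ = 1 → 1 ≤ α) →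
      QRenyi.condEntropyRel α (QRenyi.regroup ρ) τ ≤
        QRenyi.condEntropyUp β ρ + QRenyi.condEntropyRel γ (QRenyi.traceFst ρ) τ) := by
  -- The theorem is the chain rule on A ⊗ Y with Y = BC and T = 1_B ⊗ τ; the product form of T
  -- matters only for regrouping the factors.
  have hT := QRenyi.one_kronecker_posSemidef (A := B) hτ
  rw [QRenyi.one_kronecker_submatrix_prodAssoc, QRenyi.regroup, QRenyi.dominates_submatrix]
    at hsupp
  have e : QRenyi.condEntropyRel α (QRenyi.regroup ρ) τ = -QRenyi.renyiDiv α ρ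
      ((1 : Matrix A A ℂ) ⊗ₖ ((1 : Matrix B B ℂ) ⊗ₖ τ)) := by
    rw [QRenyi.condEntropyRel, QRenyi.one_kronecker_submatrix_prodAssoc, QRenyi.regroup,
      QRenyi.renyiDiv_submatrix α hρ.1.1 (QRenyi.one_kronecker_posSemidef hT).1]
  rw [e]
  exact QRenyi.renyiDiv_chain hrel hα hγ hβ hρ hT hsupp
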